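/- Let $d\ge 2$ and let $T_d\subset\mathbb R^2$ be the triangle with vertices $(0,0),(d,0),(0,d)$. Areas of polygons below are integer areas, i.e. twice the Euclidean area; a lattice triangle is primitive if its integer area is $1$. Let $C\subset\mathbb R^2$ be a non-singular tropical curve with Newton polygon $T_d$: $C$ is the set of points where the maximum $P(x)=\max_i(a_i+\langle x,i\rangle)$ is attained by at least two monomials, where $P$ is a tropical polynomial with Newton polygon $T_d$, and all two-dimensional cells of the dual subdivision of $T_d$ are primitive triangles. For a vertex $v$ of $C$ let $\Delta_v$ be the dual triangle; we write $\Delta_v=T_1$ if $\Delta_v$ is a lattice translate of $T_1$. The length $l(e)$ of a bounded edge $e$ of $C$, and distances along $e$, are measured in multiples of the primitive integer vector directing $e$. *Intersection multiplicities.* For two tropical curves $C_1,C_2$ defined by $P_1,P_2$, the tropical intersection points are the points of $C_1\cap C_2$ that are vertices of the curve $C_3$ defined by the tropical product of $P_1$ and $P_2$. The multiplicity of such a point $x$ is $\frac12\big(\mathrm{Area}(\Delta^{3}_x)-\mathrm{Area}(\Delta^{1}_x)-\mathrm{Area}(\Delta^{2}_x)\big)$, where $\Delta^{k}_x$ is the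 cell of the subdivision dual to $C_k$ that corresponds to $x$. The multiplicity of a connected component of $C_1\cap C_2$ is the sum of the multiplicities of the tropical intersection points it contains. *Inflection components.* For a vertex $v$ of $C$, let $L$ be the tropical line with vertex $v$ (defined by $\max(x-v_1,\,y-v_2,\,0)$), and let $E$ be the component of $C\cap L$ containing $v$. If $E$ has multiplicity at least $3$, define $\mathfrak I_L\subset E$ as follows. - If $E=\{v\}$ or $E$ is an unbounded edge, then $\mathfrak I_L=\{v\}$. - If $E$ is a bounded edge $e$ of $C$, then $\mathfrak I_L=\{v,p_e\}$, where $p_e\in e$ is at distance $l(e)/3$ from $v$. - If $E$ is the union of two bounded edges $e_1,e_2$ and one unbounded edge $e_3$: if $l(e_1)>l(e_2)$, then $\mathfrak I_L=\{p_{e_1}\}$ with $p_{e_1}\in e_1$ at distance $\frac{l(e_1)-l(e_2)}3$ from $v$; if $l(e_1)=l(e_2)$, then $\mathfrak I_L=e_3$. - If $E$ is the union of three bounded edges $e_1,e_2,e_3$: if $l(e_1)\ge l(e_2)>l(e_3)$, then $\mathfrak I_L=\{p_{e_1},p_{e_2}\}$ with $p_{e_i}\in e_i$ at distance $\frac{l(e_i)-l(e_3)}3$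 from $v$; if $l(e_1)>l(e_2)=l(e_3)$, then $\mathfrak I_L$ is the segment $[v,p_{e_1}]$ with $p_{e_1}\in e_1$ at distance $\frac{l(e_1)-l(e_2)}3$ from $v$; if $l(e_1)=l(e_2)=l(e_3)$, then $\mathfrak I_L=\{v\}$. Let $I_C$ be the union of the sets $\mathfrak I_L$ over all vertices $v$ of $C$ for which $E$ has multiplicity at least $3$. The *inflection components* of $C$ are the connected components of $I_C$; their set is denoted by $\mathfrak I_C$. *Multiplicities.* For a lattice polygon $\Delta$ with an edge $\delta$, put $r_\delta=0$ if $\delta$ is not parallel to an edge of $T_1$. If $\delta$ lies on a line $i=a$ (resp. $j=a$, $i+j=a$), put $r_\delta=\mathrm{Card}(\delta\cap\mathbb Z^2)-1$ if $\Delta$ lies in the half-plane $i\le a$ (resp. $j\le a$, $i+j\ge a$), and $r_\delta=2(\mathrm{Card}(\delta\cap\mathbb Z^2)-1)$ otherwise. Put $i_\Delta=3\,\mathrm{Area}(\Delta)-\sum_\delta r_\delta$, the sum over the edges of $\Delta$. The multiplicity $\mu_{\mathcal E}$ of an inflection component $\mathcal E$ is $i_{\Delta_v}$ if $\mathcal E=\{v\}$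 for a vertex $v$ of $C$ with $\Delta_v\ne T_1$; it is $6$ if $\mathcal E$ is bounded and contains a vertex $v$ of $C$ with $\Delta_v=T_1$; it is $3$ in all other cases. Then $\mathfrak I_C$ is finite and $$\sum_{\mathcal E\in\mathfrak I_C}\mu_{\mathcal E}=3d(d-2).$$ -/

import Mathlib

open MeasureTheory
open scoped Pointwise

noncomputable section

namespace TropicalInflection

/-! ### Lattice polygons in the plane -/

/-- The embedding of the lattice `ℤ²` in `ℝ²`. -/
def toReal (i : ℤ × ℤ) : ℝ × ℝ := ((i.1 : ℝ), (i.2 : ℝ))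

/-- The convex hull in `ℝ²` of a set of lattice points. -/
def hull (A : Set (ℤ × ℤ)) : Set (ℝ × ℝ) := convexHull ℝ (toReal '' A)

/-- The triangle `T_d` with vertices `(0,0)`, `(d,0)`, `(0,d)`. -/
def stdTriangle (d : ℕ) : Set (ℝ × ℝ) := hull {(0, 0), ((d : ℤ), 0), (0, (d : ℤ))}

/-- The integer area: twice the Euclidean area. -/
def area (S : Set (ℝ × ℝ)) : ℝ := 2 * volume.real S

/-- Primitive triangles: the lattice triangles of integer area `1`, i.e. the images of `T_1` under
an element of `GL₂(ℤ)` composed with a translation. -/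
def IsPrimitiveTriangle (S : Set (ℝ × ℝ)) : Prop :=
  ∃ p q r : ℤ × ℤ, S = hull {p, q, r} ∧
    |(q.1 - p.1) * (r.2 - p.2) - (q.2 - p.2) * (r.1 - p.1)| = 1

/-- Being the triangle `T_1` (polygons dual to faces of curves are considered up to lattice
translations). -/
def IsUnitTriangle (S : Set (ℝ × ℝ)) : Prop :=
  ∃ a : ℤ × ℤ, S = hull {a, a + (1, 0), a + (0, 1)}

/-- `δ` is an edge (a one-dimensional face) of the convex polygon `Δ`. -/
def IsPolygonEdge (Δ δ : Set (ℝ × ℝ)) : Prop :=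
  IsExposed ℝ Δ δ ∧ ∃ a b : ℝ × ℝ, a ≠ b ∧ δ = segment ℝ a b

/-- The lattice length `Card (δ ∩ ℤ²) - 1` of a lattice segment `δ`. -/
def segmentLength (δ : Set (ℝ × ℝ)) : ℝ := ((δ ∩ Set.range toReal).ncard : ℝ) - 1

/-- The three linear forms `i`, `j`, `-(i + j)`. They are constant on the edges of `T_1`. -/
def form : Fin 3 → ℝ × ℝ → ℝ := ![fun x => x.1, fun x => x.2, fun x => -(x.1 + x.2)]

open Classical in
/-- The number `r_δ` of an edge `δ` of `Δ`. It is `0` if `δ` is not parallel to an edge of `T_1`.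
If `δ` lies on a line `i = a` (resp. `j = a`, `i + j = a`), it is the lattice length of `δ` when `Δ`
lies in the half-plane `i ≤ a` (resp. `j ≤ a`, `i + j ≥ a`), and twice this length otherwise. -/
def edgeDefect (Δ δ : Set (ℝ × ℝ)) : ℝ :=
  if ∃ k a, (∀ x ∈ δ, form k x = a) ∧ ∀ x ∈ Δ, form k x ≤ a then segmentLength δ
  else if ∃ k a, ∀ x ∈ δ, form k x = a then 2 * segmentLength δ
  else 0

/-- `i_Δ = 3 Area(Δ) - ∑ r_δ`, the sum over the edges `δ` of `Δ`. -/
def inflNumber (Δ : Set (ℝ × ℝ)) : ℝ :=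
  3 * area Δ - ∑ᶠ δ ∈ {δ | IsPolygonEdge Δ δ}, edgeDefect Δ δ

/-! ### Tropical polynomials and plane tropical curves -/

/-- A tropical (max-plus) polynomial in two variables: a finite non-empty set of monomials with
coefficients different from `-∞`. Values of `coeff` outside `support` are irrelevant. Exponents in
`ℤ²` are allowed; they lie in `ℕ²` as soon as the Newton polygon is some `T_d`. -/
structure TropPoly where
  support : Finset (ℤ × ℤ)
  nonempty : support.Nonempty
  coeff : ℤ × ℤ → ℝ

namespace TropPoly

/-- The value `a_i + ⟨x, i⟩` of the monomial of exponent `i` at the point `x`. -/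
def term (P : TropPoly) (i : ℤ × ℤ) (x : ℝ × ℝ) : ℝ :=
  P.coeff i + ((i.1 : ℝ) * x.1 + (i.2 : ℝ) * x.2)

/-- The piecewise linear function `x ↦ max (a_i + ⟨x, i⟩)`. -/
def eval (P : TropPoly) (x : ℝ × ℝ) : ℝ := P.support.sup' P.nonempty fun i => P.term i x

open Classical in
/-- The set of exponents of the monomials that attain the maximum at `x`. -/
def active (P : TropPoly) (x : ℝ × ℝ) : Finset (ℤ × ℤ) :=
  P.support.filter fun i => P.term i x = P.eval x

/-- The underlying set of the tropical curve of `P`: the maximum is attained at least twice. -/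
def curve (P : TropPoly) : Set (ℝ × ℝ) := {x | 2 ≤ (P.active x).card}

/-- The Newton polygon. -/
def newtonPolygon (P : TropPoly) : Set (ℝ × ℝ) := hull P.support

/-- The cell of the dual subdivision which is dual to the face containing `x` in its relative
interior. -/
def dualCell (P : TropPoly) (x : ℝ × ℝ) : Set (ℝ × ℝ) := hull (P.active x)

/-- `x` is a vertex of the curve of `P`: its dual cell has dimension two. -/
def IsVertex (P : TropPoly) (x : ℝ × ℝ) : Prop :=
  ¬ Collinear ℝ (toReal '' (P.active x : Set (ℤ × ℤ)))

/-- The curve of `P` is non-singular: the two-dimensional cells of the dual subdivision are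
primitive triangles. -/
def NonSingular (P : TropPoly) : Prop :=
  ∀ x, P.IsVertex x → IsPrimitiveTriangle (P.dualCell x)

/-- The (closed) edges of the curve of `P`: the one-dimensional faces of the subdivision of the
plane induced by `P`. The closed face with `x` in its relative interior is the set of all `y` at
which every monomial active at `x` is active. -/
def edges (P : TropPoly) : Set (Set (ℝ × ℝ)) :=
  {e | ∃ x ∈ P.curve, ¬ P.IsVertex x ∧ e = {y | P.active x ⊆ P.active y}}

/-- The tropical product of two tropical polynomials. -/
def mul (P Q : TropPoly) : TropPoly where
  support := P.support + Q.support
  nonempty := P.nonempty.add Q.nonempty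
  coeff k := sSup {s | ∃ i ∈ P.support, ∃ j ∈ Q.support, i + j = k ∧ s = P.coeff i + Q.coeff j}

/-- The tropical intersection points of the curves of `P` and `Q`: the vertices of the curve of the
product that lie on both curves. -/
def tropInter (P Q : TropPoly) : Set (ℝ × ℝ) :=
  {x | x ∈ P.curve ∩ Q.curve ∧ (P.mul Q).IsVertex x}

/-- The multiplicity of a tropical intersection point. The dual cell of a point which is not a
vertex has area `0`, so the two subtracted terms are the areas of the triangles (polygons) dual to
`x` as a vertex of either curve, where it is one. -/
def interMult (P Q : TropPoly) (x : ℝ × ℝ) : ℝ :=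
  (area ((P.mul Q).dualCell x) - (area (P.dualCell x) + area (Q.dualCell x))) / 2

/-- The multiplicity of a component `E` of the intersection of the curves of `P` and `Q`. -/
def compMult (P Q : TropPoly) (E : Set (ℝ × ℝ)) : ℝ :=
  ∑ᶠ x ∈ P.tropInter Q ∩ E, P.interMult Q x

end TropPoly

open Classical in
/-- The tropical line with vertex `v`, defined by `max (x - v₁, y - v₂, 0)`. -/
def tropLine (v : ℝ × ℝ) : TropPoly where
  support := {(1, 0), (0, 1), (0, 0)}
  nonempty := ⟨(1, 0), by simp⟩
  coeff i := if i = (1, 0) then -v.1 else if i = (0, 1) then -v.2 else 0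

/-! ### Inflection components -/

/-- The point reached from `v` by moving in the integer direction `u` by the lattice length `t`. -/
def pointAt (v : ℝ × ℝ) (u : ℤ × ℤ) (t : ℝ) : ℝ × ℝ := v + t • toReal u

/-- The segment of lattice length `l` issued from `v` in the primitive direction `u`. -/
def seg (v : ℝ × ℝ) (u : ℤ × ℤ) (l : ℝ) : Set (ℝ × ℝ) := segment ℝ v (pointAt v u l)

/-- The half-line issued from `v` in the direction `u`. -/
def ray (v : ℝ × ℝ) (u : ℤ × ℤ) : Set (ℝ × ℝ) := {x | ∃ t : ℝ, 0 ≤ t ∧ x = pointAt v u t}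

namespace TropPoly

/-- The curve has a bounded edge which starts at `v`, has primitive integer direction `u` and
lattice length `l`. (All edges of a non-singular curve have weight `1`.) -/
def BoundedEdge (P : TropPoly) (v : ℝ × ℝ) (u : ℤ × ℤ) (l : ℝ) : Prop :=
  IsCoprime u.1 u.2 ∧ 0 < l ∧ seg v u l ∈ P.edges

/-- The curve has an unbounded edge which starts at `v` and has primitive integer direction `u`. -/
def UnboundedEdge (P : TropPoly) (v : ℝ × ℝ) (u : ℤ × ℤ) : Prop :=
  IsCoprime u.1 u.2 ∧ ray v u ∈ P.edges

/-- The component containing `v` of the intersection of the curve with the tropical line with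
vertex `v`. -/
def lineComp (P : TropPoly) (v : ℝ × ℝ) : Set (ℝ × ℝ) :=
  connectedComponentIn (P.curve ∩ (tropLine v).curve) v

/-- `P.IsLocus v S` says that `S` is the set `𝓘_L` attached to the tropical line `L` with vertex
`v`, a vertex of the curve. It depends on the shape of the component `E = P.lineComp v` and, when
`E` consists of three edges, on their lattice lengths. -/
inductive IsLocus (P : TropPoly) (v : ℝ × ℝ) : Set (ℝ × ℝ) → Prop
  | point (hE : P.lineComp v = {v}) : IsLocus P v {v}
  | unbounded (u : ℤ × ℤ) (he : P.UnboundedEdge v u) (hE : P.lineComp v = ray v u) :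
      IsLocus P v {v}
  | bounded (u : ℤ × ℤ) (l : ℝ) (he : P.BoundedEdge v u l) (hE : P.lineComp v = seg v u l) :
      IsLocus P v {v, pointAt v u (l / 3)}
  | twoBounded_lt (u₁ u₂ u₃ : ℤ × ℤ) (l₁ l₂ : ℝ) (h12 : u₁ ≠ u₂) (h13 : u₁ ≠ u₃) (h23 : u₂ ≠ u₃)
      (he₁ : P.BoundedEdge v u₁ l₁) (he₂ : P.BoundedEdge v u₂ l₂) (he₃ : P.UnboundedEdge v u₃)
      (hE : P.lineComp v = seg v u₁ l₁ ∪ seg v u₂ l₂ ∪ ray v u₃) (hl : l₂ < l₁) :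
      IsLocus P v {pointAt v u₁ ((l₁ - l₂) / 3)}
  | twoBounded_eq (u₁ u₂ u₃ : ℤ × ℤ) (l₁ l₂ : ℝ) (h12 : u₁ ≠ u₂) (h13 : u₁ ≠ u₃) (h23 : u₂ ≠ u₃)
      (he₁ : P.BoundedEdge v u₁ l₁) (he₂ : P.BoundedEdge v u₂ l₂) (he₃ : P.UnboundedEdge v u₃)
      (hE : P.lineComp v = seg v u₁ l₁ ∪ seg v u₂ l₂ ∪ ray v u₃) (hl : l₁ = l₂) :
      IsLocus P v (ray v u₃)
  | threeBounded_lt (u₁ u₂ u₃ : ℤ × ℤ) (l₁ l₂ l₃ : ℝ)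
      (h12 : u₁ ≠ u₂) (h13 : u₁ ≠ u₃) (h23 : u₂ ≠ u₃)
      (he₁ : P.BoundedEdge v u₁ l₁) (he₂ : P.BoundedEdge v u₂ l₂) (he₃ : P.BoundedEdge v u₃ l₃)
      (hE : P.lineComp v = seg v u₁ l₁ ∪ seg v u₂ l₂ ∪ seg v u₃ l₃)
      (hl₁ : l₂ ≤ l₁) (hl₂ : l₃ < l₂) :
      IsLocus P v {pointAt v u₁ ((l₁ - l₃) / 3), pointAt v u₂ ((l₂ - l₃) / 3)}
  | threeBounded_eq_lt (u₁ u₂ u₃ : ℤ × ℤ) (l₁ l₂ l₃ : ℝ)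
      (h12 : u₁ ≠ u₂) (h13 : u₁ ≠ u₃) (h23 : u₂ ≠ u₃)
      (he₁ : P.BoundedEdge v u₁ l₁) (he₂ : P.BoundedEdge v u₂ l₂) (he₃ : P.BoundedEdge v u₃ l₃)
      (hE : P.lineComp v = seg v u₁ l₁ ∪ seg v u₂ l₂ ∪ seg v u₃ l₃)
      (hl₁ : l₂ < l₁) (hl₂ : l₂ = l₃) :
      IsLocus P v (seg v u₁ ((l₁ - l₂) / 3))
  | threeBounded_eq (u₁ u₂ u₃ : ℤ × ℤ) (l₁ l₂ l₃ : ℝ)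
      (h12 : u₁ ≠ u₂) (h13 : u₁ ≠ u₃) (h23 : u₂ ≠ u₃)
      (he₁ : P.BoundedEdge v u₁ l₁) (he₂ : P.BoundedEdge v u₂ l₂) (he₃ : P.BoundedEdge v u₃ l₃)
      (hE : P.lineComp v = seg v u₁ l₁ ∪ seg v u₂ l₂ ∪ seg v u₃ l₃)
      (hl₁ : l₁ = l₂) (hl₂ : l₂ = l₃) :
      IsLocus P v {v}

/-- The set `I_C`: the union of the sets `𝓘_L` over the tropical lines `L` whose vertex `v` is a
vertex of the curve `C` and lies in a component of `C ∩ L` of multiplicity at least `3`. -/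
def inflSet (P : TropPoly) : Set (ℝ × ℝ) :=
  {x | ∃ v S, P.IsVertex v ∧ 3 ≤ P.compMult (tropLine v) (P.lineComp v) ∧ P.IsLocus v S ∧ x ∈ S}

/-- The inflection components: the connected components of `I_C`. -/
def inflComponents (P : TropPoly) : Set (Set (ℝ × ℝ)) :=
  {K | ∃ x ∈ P.inflSet, K = connectedComponentIn P.inflSet x}

open Classical in
/-- The multiplicity of an inflection component `K`: it is `i_Δ` if `K` is a vertex dual to
`Δ ≠ T_1`, it is `6` if `K` is bounded and contains a vertex dual to `T_1`, and it is `3` in all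
other cases. -/
def inflMult (P : TropPoly) (K : Set (ℝ × ℝ)) : ℝ :=
  if h : ∃ v, P.IsVertex v ∧ ¬ IsUnitTriangle (P.dualCell v) ∧ K = {v} then
    inflNumber (P.dualCell h.choose)
  else if Bornology.IsBounded K ∧ ∃ v ∈ K, P.IsVertex v ∧ IsUnitTriangle (P.dualCell v) then 6
  else 3

end TropPoly

end TropicalInflection

end

/-! The count is local at the vertices. Let `phi k` run over the forms i, j, -(i+j), and let `dir k`
be the rays of a tropical line. An edge of the triangle dual to a vertex v on which `phi k` is
minimal (`MinEdge`) is dual to an edge of the curve leaving v along `dir k`. One on which `phi k` is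
maximal (`MaxEdge`) is dual to an edge arriving at v in that direction. Let min and max be the
numbers of such forms k, and b the number of leaving edges that are bounded. The tropical line with
vertex v produces inflection components of total multiplicity 3 - max - 2 min + 3b
(`splits_locusAt`).

Local part. A primitive triangle has area 1, an edge of the first kind has defect 1 and one of the
second kind defect 2, so i_Δ = 3 - max - 2 min. By `mem_lineComp` the component of the intersection
at v consists of v and the leaving edges. Its multiplicity comes from v and from the far ends of the
bounded leaving edges (`compMult_eq`). Only the comparison with 3 matters, so bounds for areas of
Minkowski sums that leave some slack are enough (`le_area_add_unit`, `area_add_unit_le_of_narrow`,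
`area_add_edge`). By `IsPrim.classify` there are four cases. For T_1 the locus has multiplicity 0,
3, 6 when b = 1, 2, 3, which is 3(b - 1). For -T_1 the locus is empty. If there is one edge of each
kind and no large variation, then i_Δ = 0, and the locus is empty when b = 0 and contributes 3 when
b = 1. In the wide case the vertex always counts with i_Δ, and a bounded leaving edge adds one point
of multiplicity 3.

Gluing. The locus of v lies in the star of v, that is v with its leaving edges deprived of their far
ends. Every open edge in a line direction leaves exactly one vertex, so stars of different vertices
are disjoint (`disjoint_star`). A finite disjoint union of closed connected sets has these sets as
its components (`setOf_connectedComponentIn_eq`), so the local contributions add up.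

Global part. The dual triangles tile T_d, hence there are d² vertices (`card_vertices`). Each
bounded edge in a line direction has one leaving and one arriving end (`card_maxEdge`), and d
unbounded edges leave in each of the three directions (`card_unbounded`). If B is the number of
bounded ones, the sum is 3d² - B - 2(B + 3d) + 3B = 3d(d - 2). -/

namespace TropicalInflection

/-! ### Lattice forms and directions -/

/-- The pairing of an exponent with a vector of the plane. -/
def pair (i : ℤ × ℤ) (h : ℝ × ℝ) : ℝ := (i.1 : ℝ) * h.1 + (i.2 : ℝ) * h.2

/-- The three linear forms `i`, `j`, `-(i + j)` on the lattice. -/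
def phi : Fin 3 → ℤ × ℤ → ℤ := ![fun i => i.1, fun i => i.2, fun i => -(i.1 + i.2)]

/-- The directions of the three rays of a tropical line. -/
def dir : Fin 3 → ℤ × ℤ := ![(-1, 0), (0, -1), (1, 1)]

/-- The determinant of the lattice triangle `p q r`. -/
def det3 (p q r : ℤ × ℤ) : ℤ := (q.1 - p.1) * (r.2 - p.2) - (q.2 - p.2) * (r.1 - p.1)

@[simp] lemma toReal_fst (i : ℤ × ℤ) : (toReal i).1 = i.1 := rfl
@[simp] lemma toReal_snd (i : ℤ × ℤ) : (toReal i).2 = i.2 := rfl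

lemma toReal_injective : Function.Injective toReal := by
  intro a b h
  have h1 := congrArg Prod.fst h
  have h2 := congrArg Prod.snd h
  simp only [toReal_fst, toReal_snd, Int.cast_inj] at h1 h2
  exact Prod.ext h1 h2

lemma toReal_add (a b : ℤ × ℤ) : toReal (a + b) = toReal a + toReal b := by
  ext <;> simp [toReal]

lemma pair_dir (k : Fin 3) (i : ℤ × ℤ) : pair i (toReal (dir k)) = -(phi k i : ℝ) := by
  fin_cases k <;> simp [pair, toReal, dir, phi]

lemma phi_add (k : Fin 3) (i j : ℤ × ℤ) : phi k (i + j) = phi k i + phi k j := by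
  fin_cases k <;> simp [phi]
  abel

lemma phi_sum (i : ℤ × ℤ) : phi 0 i + phi 1 i + phi 2 i = 0 := by
  simp [phi]

lemma form_toReal (k : Fin 3) (i : ℤ × ℤ) : form k (toReal i) = phi k i := by
  fin_cases k <;> simp [form, phi, toReal]

lemma dir_ne_zero (k : Fin 3) : toReal (dir k) ≠ 0 := by
  fin_cases k <;> simp [toReal, dir]

lemma dir_isCoprime (k : Fin 3) : IsCoprime (dir k).1 (dir k).2 := by
  fin_cases k
  exacts [⟨-1, 0, by simp [dir]⟩, ⟨0, -1, by simp [dir]⟩, ⟨1, 0, by simp [dir]⟩]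

/-- The three forms sum to zero, so any two of them are coordinates on the lattice. In particular a
segment is parallel to at most one edge of T_1. -/
lemma eq_of_phi_eq {k k' : Fin 3} (hk : k ≠ k') {p q : ℤ × ℤ} (h : phi k p = phi k q)
    (h' : phi k' p = phi k' q) : p = q := by
  have h1 := phi_sum p
  have h2 := phi_sum q
  fin_cases k <;> fin_cases k' <;> simp [phi] at * <;> ext <;> omega

lemma pointAt_zero (v : ℝ × ℝ) (u : ℤ × ℤ) : pointAt v u 0 = v := by simp [pointAt]

lemma pointAt_add (v : ℝ × ℝ) (u : ℤ × ℤ) (s t : ℝ) :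
    pointAt (pointAt v u s) u t = pointAt v u (s + t) := by
  simp only [pointAt, add_smul, add_assoc]

lemma pointAt_dir_injective (v : ℝ × ℝ) (k : Fin 3) : Function.Injective (pointAt v (dir k)) := by
  intro s t h
  simp only [pointAt, add_right_inj] at h
  exact smul_left_injective ℝ (dir_ne_zero k) h

/-- Different rays of a tropical line only meet in its vertex. -/
lemma pointAt_dir_eq {v : ℝ × ℝ} {k k' : Fin 3} {s t : ℝ} (hs : 0 < s) (ht : 0 ≤ t)
    (h : pointAt v (dir k) s = pointAt v (dir k') t) : k = k' ∧ s = t := by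
  have h1 := congrArg Prod.fst h
  have h2 := congrArg Prod.snd h
  fin_cases k <;> fin_cases k' <;> simp [pointAt, dir] at h1 h2 ⊢ <;> linarith

lemma mem_seg {v x : ℝ × ℝ} {u : ℤ × ℤ} {l : ℝ} (hl : 0 < l) :
    x ∈ seg v u l ↔ ∃ t, 0 ≤ t ∧ t ≤ l ∧ x = pointAt v u t := by
  rw [seg, segment_eq_image']
  constructor
  · rintro ⟨θ, ⟨h0, h1⟩, rfl⟩
    refine ⟨θ * l, by positivity, by nlinarith, ?_⟩
    simp [pointAt, smul_smul]
  · rintro ⟨t, h0, h1, rfl⟩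
    refine ⟨t / l, ⟨by positivity, (div_le_one hl).2 h1⟩, ?_⟩
    simp [pointAt, smul_smul, div_mul_cancel₀ _ hl.ne']

lemma self_mem_seg (v : ℝ × ℝ) (u : ℤ × ℤ) (l : ℝ) : v ∈ seg v u l := left_mem_segment ℝ _ _

lemma pointAt_mem_seg (v : ℝ × ℝ) (u : ℤ × ℤ) (l : ℝ) : pointAt v u l ∈ seg v u l :=
  right_mem_segment ℝ _ _

lemma det3_ne_zero_of_abs {p q r : ℤ × ℤ} (h : |det3 p q r| = 1) : det3 p q r ≠ 0 := by
  intro h0; simp [h0] at h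

lemma not_collinear_of_det {S : Set (ℤ × ℤ)} {p q r : ℤ × ℤ} (hp : p ∈ S) (hq : q ∈ S)
    (hr : r ∈ S) (h : det3 p q r ≠ 0) : ¬ Collinear ℝ (toReal '' S) := by
  intro hc
  rw [collinear_iff_of_mem (Set.mem_image_of_mem toReal hp)] at hc
  obtain ⟨w, hw⟩ := hc
  obtain ⟨s, hs⟩ := hw _ (Set.mem_image_of_mem toReal hq)
  obtain ⟨t, ht⟩ := hw _ (Set.mem_image_of_mem toReal hr)
  have h1 := congrArg Prod.fst hs
  have h2 := congrArg Prod.snd hs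
  have h3 := congrArg Prod.fst ht
  have h4 := congrArg Prod.snd ht
  simp at h1 h2 h3 h4
  apply h
  have : ((det3 p q r : ℤ) : ℝ) = 0 := by
    simp only [det3]; push_cast
    rw [h1, h2, h3, h4]; ring
  exact_mod_cast this

lemma collinear_of_line {S : Set (ℝ × ℝ)} {m n c : ℝ} (h0 : m ≠ 0 ∨ n ≠ 0)
    (hS : ∀ x ∈ S, m * x.1 + n * x.2 = c) : Collinear ℝ S := by
  rcases S.eq_empty_or_nonempty with rfl | ⟨p, hp⟩
  · simp [collinear_empty]
  rw [collinear_iff_of_mem hp]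
  refine ⟨(-n, m), fun q hq => ?_⟩
  have e : (q.1 - p.1) * m + (q.2 - p.2) * n = 0 := by
    have := hS p hp; have := hS q hq; linarith
  have hn : 0 < m ^ 2 + n ^ 2 := by
    rcases h0 with h | h <;> positivity
  -- The coefficient of the orthogonal projection of q - p on the direction (-n, m) of the line.
  refine ⟨(-(q.1 - p.1) * n + (q.2 - p.2) * m) / (m ^ 2 + n ^ 2), ?_⟩
  ext
  · simp
    field_simp
    linear_combination m * e
  · simp
    field_simp
    linear_combination n * e

/-! ### Monomials active at a point -/

namespace TropPoly

variable {P : TropPoly}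

lemma term_eq (P : TropPoly) (i : ℤ × ℤ) (x : ℝ × ℝ) : P.term i x = P.coeff i + pair i x := rfl

lemma term_add_smul (P : TropPoly) (i : ℤ × ℤ) (x h : ℝ × ℝ) (t : ℝ) :
    P.term i (x + t • h) = P.term i x + t * pair i h := by
  simp [term_eq, pair]; ring

lemma mem_active {i : ℤ × ℤ} {x : ℝ × ℝ} :
    i ∈ P.active x ↔ i ∈ P.support ∧ ∀ j ∈ P.support, P.term j x ≤ P.term i x := by
  rw [active, Finset.mem_filter, eval]
  refine and_congr_right fun hi => ⟨fun h j hj => ?_, fun h => ?_⟩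
  · rw [h]; exact Finset.le_sup' (fun i => P.term i x) hj
  · exact le_antisymm (Finset.le_sup' (fun i => P.term i x) hi) (Finset.sup'_le _ _ h)

lemma active_subset (x : ℝ × ℝ) : P.active x ⊆ P.support := fun _ h => (mem_active.1 h).1

lemma term_eq_of_mem_active {i j : ℤ × ℤ} {x : ℝ × ℝ} (hi : i ∈ P.active x)
    (hj : j ∈ P.active x) : P.term i x = P.term j x :=
  le_antisymm ((mem_active.1 hj).2 _ (mem_active.1 hi).1)
    ((mem_active.1 hi).2 _ (mem_active.1 hj).1)

lemma mem_active_of_term_eq {i j : ℤ × ℤ} {x : ℝ × ℝ} (hi : i ∈ P.active x)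
    (hj : j ∈ P.support) (h : P.term j x = P.term i x) : j ∈ P.active x :=
  mem_active.2 ⟨hj, fun s hs => h ▸ (mem_active.1 hi).2 s hs⟩

lemma term_lt_of_not_mem_active {i j : ℤ × ℤ} {x : ℝ × ℝ} (hi : i ∈ P.active x)
    (hj : j ∈ P.support) (h : j ∉ P.active x) : P.term j x < P.term i x :=
  lt_of_le_of_ne ((mem_active.1 hi).2 j hj) fun e => h (mem_active_of_term_eq hi hj e)

lemma active_nonempty (x : ℝ × ℝ) : (P.active x).Nonempty := by
  obtain ⟨i, hi, h⟩ := P.support.exists_max_image (fun i => P.term i x) P.nonempty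
  exact ⟨i, mem_active.2 ⟨hi, h⟩⟩

lemma eval_eq_term {i : ℤ × ℤ} {x : ℝ × ℝ} (hi : i ∈ P.active x) : P.eval x = P.term i x := by
  simp only [active, Finset.mem_filter] at hi
  exact hi.2.symm

lemma term_le_eval {i : ℤ × ℤ} (hi : i ∈ P.support) (x : ℝ × ℝ) : P.term i x ≤ P.eval x :=
  Finset.le_sup' (fun i => P.term i x) hi

lemma continuous_term (P : TropPoly) (i : ℤ × ℤ) : Continuous (P.term i) := by
  unfold term; fun_prop

lemma continuous_eval (P : TropPoly) : Continuous P.eval := by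
  unfold eval
  exact Continuous.finset_sup'_apply P.nonempty fun i _ => P.continuous_term i

/-- The monomials active just after `x` in the direction `h` are those active at `x` of largest
slope. -/
lemma eventually_active (P : TropPoly) (x h : ℝ × ℝ) : ∀ᶠ t in nhdsWithin (0 : ℝ) (Set.Ioi 0),
    ∀ i, i ∈ P.active (x + t • h) ↔
      i ∈ P.active x ∧ ∀ j ∈ P.active x, pair j h ≤ pair i h := by
  obtain ⟨m, hm, hmax⟩ := (P.active x).exists_max_image (fun i => pair i h) (active_nonempty x)
  -- The finitely many inactive monomials are strictly below the maximum at x, and by continuity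
  -- they remain so for small t.
  have key : ∀ᶠ t in nhdsWithin (0 : ℝ) (Set.Ioi 0), ∀ s ∈ P.support, s ∉ P.active x →
      P.term s (x + t • h) < P.term m (x + t • h) := by
    rw [Filter.eventually_all_finset]
    intro s hs
    by_cases hsa : s ∈ P.active x
    · simp [hsa]
    refine Filter.Eventually.filter_mono nhdsWithin_le_nhds ?_
    have hc : Continuous fun t : ℝ => P.term m (x + t • h) - P.term s (x + t • h) := by
      simp only [term_add_smul]; fun_prop
    have h0 : 0 < P.term m (x + (0 : ℝ) • h) - P.term s (x + (0 : ℝ) • h) := by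
      simpa using term_lt_of_not_mem_active hm hs hsa
    filter_upwards [hc.continuousAt.eventually (lt_mem_nhds h0)] with t ht _
    linarith
  filter_upwards [key, self_mem_nhdsWithin] with t ht ht0 i
  have ht0 : 0 < t := ht0
  have hmt : m ∈ P.active (x + t • h) := by
    refine mem_active.2 ⟨active_subset _ hm, fun j hj => ?_⟩
    by_cases hja : j ∈ P.active x
    · rw [term_add_smul, term_add_smul, term_eq_of_mem_active hja hm]
      have := hmax j hja
      gcongr
    · exact (ht j hj hja).le
  constructor
  · intro hi
    have hia : i ∈ P.active x := by
      by_contra hn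
      exact (ht i (active_subset _ hi) hn).not_ge ((mem_active.1 hi).2 m (active_subset _ hm))
    refine ⟨hia, fun j hj => ?_⟩
    have := (mem_active.1 hi).2 m (active_subset _ hm)
    rw [term_add_smul, term_add_smul, term_eq_of_mem_active hm hia] at this
    have h1 : t * pair m h ≤ t * pair i h := by linarith
    exact (hmax j hj).trans (le_of_mul_le_mul_left h1 ht0)
  · rintro ⟨hi, hle⟩
    refine mem_active_of_term_eq hmt (active_subset _ hi) ?_
    rw [term_add_smul, term_add_smul, term_eq_of_mem_active hi hm,
      le_antisymm (hmax i hi) (hle m hm)]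

/-- Along a line the difference of two monomials is affine in t, so its sign at both ends is kept in
between. -/
lemma mem_active_between {x h : ℝ × ℝ} {p : ℤ × ℤ} {l t : ℝ} (hp : p ∈ P.active x)
    (hl : p ∈ P.active (x + l • h)) (h0 : 0 ≤ t) (h1 : t ≤ l) : p ∈ P.active (x + t • h) := by
  refine mem_active.2 ⟨active_subset _ hp, fun s hs => ?_⟩
  have a := (mem_active.1 hp).2 s hs
  have b := (mem_active.1 hl).2 s hs
  rw [term_add_smul, term_add_smul] at b ⊢
  rcases h0.eq_or_lt with rfl | h0
  · simpa using a
  have hl0 : 0 < l := h0.trans_le h1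
  have : l * (P.term s x + t * pair s h) ≤ l * (P.term p x + t * pair p h) := by
    nlinarith [mul_nonneg (sub_nonneg.2 h1) (sub_nonneg.2 a), mul_nonneg h0.le (sub_nonneg.2 b)]
  exact le_of_mul_le_mul_left this hl0

/-- Between two points at which `p` is active, the active monomials are those which are active at
the first one and have the slope of `p`. -/
lemma active_between {x h : ℝ × ℝ} {p : ℤ × ℤ} {l t : ℝ} (hp : p ∈ P.active x)
    (hl : p ∈ P.active (x + l • h)) (h0 : 0 < t) (h1 : t < l) (s : ℤ × ℤ) :
    s ∈ P.active (x + t • h) ↔ s ∈ P.active x ∧ pair s h = pair p h := by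
  have hpt := mem_active_between hp hl h0.le h1.le
  constructor
  · intro hs
    have hss := active_subset _ hs
    have e := term_eq_of_mem_active hs hpt
    have a := (mem_active.1 hp).2 s hss
    have b := (mem_active.1 hl).2 s hss
    rw [term_add_smul, term_add_smul] at b e
    -- The difference of the two monomials is affine, nonnegative at 0 and at l, and zero at the
    -- interior time t, so it vanishes at 0.
    have e1 : P.term s x = P.term p x := by nlinarith
    refine ⟨mem_active_of_term_eq hp hss e1, ?_⟩
    exact mul_left_cancel₀ h0.ne' (by linarith)
  · rintro ⟨hs, e⟩
    refine mem_active_of_term_eq hpt (active_subset _ hs) ?_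
    rw [term_add_smul, term_add_smul, term_eq_of_mem_active hs hp, e]

/-- In the direction h, the monomial p can only be overtaken by one of larger slope. If there is
any, the first time at which one catches up is the minimum of (gap at x) / (difference of slopes)
over these finitely many monomials. This dichotomy becomes the one between unbounded and bounded
edges. -/
lemma active_forever_or_exists {x h : ℝ × ℝ} {p : ℤ × ℤ} (hp : p ∈ P.active x)
    (hmax : ∀ s ∈ P.active x, pair s h ≤ pair p h) :
    ((∀ s ∈ P.support, pair s h ≤ pair p h) ∧ ∀ t : ℝ, 0 ≤ t → p ∈ P.active (x + t • h)) ∨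
      ∃ l : ℝ, 0 < l ∧ p ∈ P.active (x + l • h) ∧
        ∃ s ∈ P.active (x + l • h), pair p h < pair s h := by
  by_cases hM : ∀ s ∈ P.support, pair s h ≤ pair p h
  · refine Or.inl ⟨hM, fun t ht => mem_active.2 ⟨active_subset _ hp, fun s hs => ?_⟩⟩
    rw [term_add_smul, term_add_smul]
    have := hM s hs
    have := (mem_active.1 hp).2 s hs
    gcongr
  right
  push Not at hM
  let M := P.support.filter fun s => pair p h < pair s h
  have hMne : M.Nonempty := by
    obtain ⟨s, hs, h1⟩ := hM
    exact ⟨s, Finset.mem_filter.2 ⟨hs, h1⟩⟩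
  let f : ℤ × ℤ → ℝ := fun s => (P.term p x - P.term s x) / (pair s h - pair p h)
  obtain ⟨s, hs, hmin⟩ := M.exists_min_image f hMne
  obtain ⟨hss, hsp⟩ := Finset.mem_filter.1 hs
  have hnot : s ∉ P.active x := fun hsa => (hmax s hsa).not_gt hsp
  have hlt := term_lt_of_not_mem_active hp hss hnot
  have hl : 0 < f s := div_pos (sub_pos.2 hlt) (sub_pos.2 hsp)
  have hpl : p ∈ P.active (x + f s • h) := by
    refine mem_active.2 ⟨active_subset _ hp, fun j hj => ?_⟩
    rw [term_add_smul, term_add_smul]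
    have hjx := (mem_active.1 hp).2 j hj
    by_cases hjM : pair p h < pair j h
    · have h2 := hmin j (Finset.mem_filter.2 ⟨hj, hjM⟩)
      have h3 : f s * (pair j h - pair p h) ≤ P.term p x - P.term j x :=
        (le_div_iff₀ (sub_pos.2 hjM)).1 h2
      linarith
    · push Not at hjM
      gcongr
  refine ⟨f s, hl, hpl, s, mem_active_of_term_eq hpl hss ?_, hsp⟩
  rw [term_add_smul, term_add_smul]
  have : f s * (pair s h - pair p h) = P.term p x - P.term s x :=
    div_mul_cancel₀ _ (sub_pos.2 hsp).ne'
  linarith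

end TropPoly
/-! ### Hulls of lattice points -/

lemma hull_le {A : Set (ℤ × ℤ)} {m n c : ℝ} (h : ∀ i ∈ A, m * i.1 + n * i.2 ≤ c) {x : ℝ × ℝ}
    (hx : x ∈ hull A) : m * x.1 + n * x.2 ≤ c := by
  have hlin : IsLinearMap ℝ fun x : ℝ × ℝ => m * x.1 + n * x.2 :=
    ⟨fun x y => by simp; ring, fun a x => by simp; ring⟩
  refine convexHull_min (t := {x : ℝ × ℝ | m * x.1 + n * x.2 ≤ c}) ?_
    (convex_halfSpace_le hlin c) hx
  rintro _ ⟨i, hi, rfl⟩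
  exact h i hi

lemma le_hull {A : Set (ℤ × ℤ)} {m n c : ℝ} (h : ∀ i ∈ A, c ≤ m * i.1 + n * i.2) {x : ℝ × ℝ}
    (hx : x ∈ hull A) : c ≤ m * x.1 + n * x.2 := by
  have := hull_le (A := A) (m := -m) (n := -n) (c := -c) (fun i hi => by linarith [h i hi]) hx
  linarith

lemma toReal_mem_hull {A : Set (ℤ × ℤ)} {i : ℤ × ℤ} (h : i ∈ A) : toReal i ∈ hull A :=
  subset_convexHull ℝ _ (Set.mem_image_of_mem _ h)

lemma hull_mono {A B : Set (ℤ × ℤ)} (h : A ⊆ B) : hull A ⊆ hull B :=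
  convexHull_mono (Set.image_mono h)

lemma hull_subset_hull {A B : Set (ℤ × ℤ)} (h : ∀ i ∈ A, toReal i ∈ hull B) :
    hull A ⊆ hull B :=
  convexHull_min (by rintro _ ⟨i, hi, rfl⟩; exact h i hi) (convex_convexHull ℝ _)

lemma isCompact_hull {A : Set (ℤ × ℤ)} (h : A.Finite) : IsCompact (hull A) :=
  (h.image toReal).isCompact_convexHull ℝ

/-- The only lattice points of a primitive triangle are its vertices. -/
lemma mem_of_toReal_mem_hull {p q r s : ℤ × ℤ} (hd : |det3 p q r| = 1)
    (hs : toReal s ∈ hull {p, q, r}) : s = p ∨ s = q ∨ s = r := by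
  set D := det3 p q r with hD
  have hDD : D * D = 1 := by
    rcases (abs_eq one_pos.le).1 hd with h | h <;> rw [h] <;> norm_num
  have hDR : ((q.1 - p.1 : ℝ) * (r.2 - p.2) - (q.2 - p.2) * (r.1 - p.1)) = D := by
    rw [hD, det3]; push_cast; ring
  have hDDR : (D : ℝ) * D = 1 := by exact_mod_cast hDD
  -- An affine inequality with integer coefficients which holds at the three vertices holds at s,
  -- and is then an inequality between integers.
  have key : ∀ m n c : ℤ, (0 ≤ m * p.1 + n * p.2 + c) → (0 ≤ m * q.1 + n * q.2 + c) →
      (0 ≤ m * r.1 + n * r.2 + c) → 0 ≤ m * s.1 + n * s.2 + c := by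
    intro m n c h1 h2 h3
    have := le_hull (A := {p, q, r}) (m := m) (n := n) (c := -c) (by
      rintro i (rfl | rfl | rfl) <;> norm_cast <;> linarith) hs
    simp only [toReal_fst, toReal_snd] at this
    have h4 : -c ≤ m * s.1 + n * s.2 := by exact_mod_cast this
    linarith
  -- Since D = ±1, the integers D * det3 p s r and D * det3 p q s are the barycentric coordinates of
  -- s relative to q and r. Being nonnegative with sum at most 1, they leave only the three
  -- vertices.
  have hb : 0 ≤ D * det3 p s r := by
    have := key (D * (r.2 - p.2)) (-D * (r.1 - p.1)) (-D * (p.1 * r.2 - p.2 * r.1))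
      (le_of_eq (by ring))
      (by rw [hD, det3] at *; nlinarith) (le_of_eq (by ring))
    simp only [det3]; linarith
  have hc : 0 ≤ D * det3 p q s := by
    have := key (-D * (q.2 - p.2)) (D * (q.1 - p.1)) (-D * (q.1 * p.2 - q.2 * p.1))
      (le_of_eq (by ring)) (le_of_eq (by ring))
      (by rw [hD, det3] at *; nlinarith)
    simp only [det3]; linarith
  have ha : 0 ≤ 1 - D * det3 p s r - D * det3 p q s := by
    have := key (-D * (r.2 - p.2) + D * (q.2 - p.2)) (D * (r.1 - p.1) - D * (q.1 - p.1))
      (1 + D * (p.1 * r.2 - p.2 * r.1) + D * (q.1 * p.2 - q.2 * p.1))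
      (by linarith)
      (by rw [← hDD, hD]; simp only [det3]; linarith)
      (by rw [← hDD, hD]; simp only [det3]; linarith)
    simp only [det3]; linarith
  have e1 : s.1 - p.1 = (D * det3 p s r) * (q.1 - p.1) + (D * det3 p q s) * (r.1 - p.1) := by
    have : D * (s.1 - p.1) = det3 p s r * (q.1 - p.1) + det3 p q s * (r.1 - p.1) := by
      rw [hD]; simp only [det3]; ring
    linear_combination D * this - (s.1 - p.1) * hDD
  have e2 : s.2 - p.2 = (D * det3 p s r) * (q.2 - p.2) + (D * det3 p q s) * (r.2 - p.2) := by
    have : D * (s.2 - p.2) = det3 p s r * (q.2 - p.2) + det3 p q s * (r.2 - p.2) := by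
      rw [hD]; simp only [det3]; ring
    linear_combination D * this - (s.2 - p.2) * hDD
  generalize D * det3 p s r = b at *
  generalize D * det3 p q s = c at *
  have h3 : (b = 0 ∧ c = 0) ∨ (b = 1 ∧ c = 0) ∨ (b = 0 ∧ c = 1) := by omega
  rcases h3 with ⟨rfl, rfl⟩ | ⟨rfl, rfl⟩ | ⟨rfl, rfl⟩
  · left; ext <;> linarith
  · right; left; ext <;> linarith
  · right; right; ext <;> linarith

/-- The vertices of a primitive triangle. -/
def IsPrim (A : Finset (ℤ × ℤ)) : Prop := ∃ p q r, A = {p, q, r} ∧ |det3 p q r| = 1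

lemma IsPrim.rotate {p q r : ℤ × ℤ} : det3 q r p = det3 p q r := by simp only [det3]; ring

lemma IsPrim.swap {p q r : ℤ × ℤ} : det3 q p r = -det3 p q r := by simp only [det3]; ring

lemma det3_ne {p q r : ℤ × ℤ} (h : |det3 p q r| = 1) : p ≠ q ∧ p ≠ r ∧ q ≠ r := by
  refine ⟨?_, ?_, ?_⟩ <;> rintro rfl <;> simp [det3, mul_comm] at h

/-- Two chosen vertices of a primitive triangle can be completed by a third one. -/
lemma IsPrim.exists_third {A : Finset (ℤ × ℤ)} (hA : IsPrim A) {p q : ℤ × ℤ} (hp : p ∈ A)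
    (hq : q ∈ A) (hpq : p ≠ q) : ∃ r, A = {p, q, r} ∧ |det3 p q r| = 1 := by
  obtain ⟨a, b, c, rfl, hd⟩ := hA
  have h1 : det3 b c a = det3 a b c := IsPrim.rotate
  have h2 : det3 c a b = det3 a b c := by rw [← h1]; exact IsPrim.rotate
  have h3 : |det3 b a c| = 1 := by rw [IsPrim.swap, abs_neg, hd]
  have h4 : |det3 c b a| = 1 := by rw [IsPrim.swap, abs_neg, h1, hd]
  have h5 : |det3 a c b| = 1 := by rw [IsPrim.swap, abs_neg, h2, hd]
  simp only [Finset.mem_insert, Finset.mem_singleton] at hp hq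
  rcases hp with rfl | rfl | rfl <;> rcases hq with rfl | rfl | rfl
  · exact absurd rfl hpq
  · exact ⟨c, rfl, hd⟩
  · exact ⟨b, by ext; simp; tauto, h5⟩
  · exact ⟨c, by ext; simp; tauto, h3⟩
  · exact absurd rfl hpq
  · exact ⟨a, by ext; simp; tauto, by rw [h1, hd]⟩
  · exact ⟨b, by ext; simp; tauto, by rw [h2, hd]⟩
  · exact ⟨a, by ext; simp; tauto, h4⟩
  · exact absurd rfl hpq

lemma IsPrim.card {A : Finset (ℤ × ℤ)} (hA : IsPrim A) : A.card = 3 := by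
  obtain ⟨p, q, r, rfl, hd⟩ := hA
  obtain ⟨h1, h2, h3⟩ := det3_ne hd
  exact Finset.card_eq_three.2 ⟨p, q, r, h1, h2, h3, rfl⟩

/-! ### Vertices of a non-singular curve -/

namespace TropPoly

variable {P : TropPoly}

lemma not_isVertex_of_subset_pair {x : ℝ × ℝ} {p q : ℤ × ℤ} (h : P.active x ⊆ {p, q}) :
    ¬ P.IsVertex x := by
  intro hv
  refine hv ((collinear_pair ℝ (toReal p) (toReal q)).subset ?_)
  rintro _ ⟨i, hi, rfl⟩
  have := h hi
  simp only [Finset.mem_insert, Finset.mem_singleton] at this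
  rcases this with rfl | rfl <;> simp

/-- Non-singularity only describes the cell as a subset of the plane. Active exponents are lattice
points of that cell, hence among its three vertices, and if one vertex were missing the active set
would be collinear. -/
lemma IsVertex.isPrim (hP : P.NonSingular) {v : ℝ × ℝ} (hv : P.IsVertex v) :
    IsPrim (P.active v) := by
  obtain ⟨p, q, r, h, hd⟩ := hP v hv
  refine ⟨p, q, r, ?_, hd⟩
  have hsub : P.active v ⊆ {p, q, r} := by
    intro s hs
    have : toReal s ∈ P.dualCell v := toReal_mem_hull hs
    rw [h] at this
    simpa using mem_of_toReal_mem_hull hd this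
  refine le_antisymm hsub ?_
  obtain ⟨n1, n2, n3⟩ := det3_ne hd
  intro s hs
  by_contra hn
  simp only [Finset.mem_insert, Finset.mem_singleton] at hs
  have aux : ∀ a b : ℤ × ℤ, ({p, q, r} : Finset (ℤ × ℤ)) ⊆ {s, a, b} → False := by
    intro a b hab
    refine not_isVertex_of_subset_pair (P := P) (x := v) (p := a) (q := b) ?_ hv
    intro t ht
    have := hab (hsub ht)
    simp only [Finset.mem_insert, Finset.mem_singleton] at this ⊢
    rcases this with rfl | h | h
    · exact absurd ht hn
    · exact Or.inl h
    · exact Or.inr h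
  rcases hs with rfl | rfl | rfl
  · exact aux q r (fun _ h => h)
  · exact aux p r (fun t h => by simp at h ⊢; tauto)
  · exact aux p q (fun t h => by simp at h ⊢; tauto)

lemma isVertex_of_det {x : ℝ × ℝ} {p q r : ℤ × ℤ} (hp : p ∈ P.active x) (hq : q ∈ P.active x)
    (hr : r ∈ P.active x) (h : det3 p q r ≠ 0) : P.IsVertex x :=
  not_collinear_of_det (S := (P.active x : Set (ℤ × ℤ))) hp hq hr h

/-- A vertex is determined by the monomials which are active at it. -/
lemma eq_of_active {x y : ℝ × ℝ} {p q r : ℤ × ℤ} (hd : det3 p q r ≠ 0)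
    (hx : p ∈ P.active x ∧ q ∈ P.active x ∧ r ∈ P.active x)
    (hy : p ∈ P.active y ∧ q ∈ P.active y ∧ r ∈ P.active y) : x = y := by
  have a1 := term_eq_of_mem_active hx.1 hx.2.1
  have a2 := term_eq_of_mem_active hx.1 hx.2.2
  have b1 := term_eq_of_mem_active hy.1 hy.2.1
  have b2 := term_eq_of_mem_active hy.1 hy.2.2
  simp only [term_eq, pair] at a1 a2 b1 b2
  have hd' : ((q.1 - p.1 : ℝ) * (r.2 - p.2) - (q.2 - p.2) * (r.1 - p.1)) ≠ 0 := by
    have : ((det3 p q r : ℤ) : ℝ) ≠ 0 := by exact_mod_cast hd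
    rw [det3] at this; push_cast at this; exact this
  ext
  · refine sub_eq_zero.1 ((mul_eq_zero.1 (?_ : _ * (x.1 - y.1) = 0)).resolve_left hd')
    linear_combination (r.2 - p.2 : ℝ) * (b1 - a1) - (q.2 - p.2 : ℝ) * (b2 - a2)
  · refine sub_eq_zero.1 ((mul_eq_zero.1 (?_ : _ * (x.2 - y.2) = 0)).resolve_left hd')
    linear_combination (q.1 - p.1 : ℝ) * (b2 - a2) - (r.1 - p.1 : ℝ) * (b1 - a1)

/-- A vertex is recovered from its active set, which is one of the finitely many subsets of the
support. -/
lemma finite_setOf_isVertex (hP : P.NonSingular) : {v | P.IsVertex v}.Finite := by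
  refine Set.Finite.of_finite_image (f := P.active)
    ((P.support.powerset.finite_toSet).subset ?_) ?_
  · rintro _ ⟨v, -, rfl⟩
    exact Finset.mem_coe.2 (Finset.mem_powerset.2 (active_subset v))
  · intro v hv w hw h
    obtain ⟨p, q, r, e, hd⟩ := IsVertex.isPrim hP hv
    refine eq_of_active (P := P) (det3_ne_zero_of_abs hd) ?_ ?_
    · simp [e]
    · rw [← h]; simp [e]

end TropPoly
/-- The form `phi k` takes its minimum on `A` at two of the points of `A`. -/
def MinEdge (A : Finset (ℤ × ℤ)) (k : Fin 3) : Prop :=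
  ∃ p ∈ A, ∃ q ∈ A, p ≠ q ∧ phi k p = phi k q ∧ ∀ s ∈ A, phi k p ≤ phi k s

/-- The form `phi k` takes its maximum on `A` at two of the points of `A`. -/
def MaxEdge (A : Finset (ℤ × ℤ)) (k : Fin 3) : Prop :=
  ∃ p ∈ A, ∃ q ∈ A, p ≠ q ∧ phi k p = phi k q ∧ ∀ s ∈ A, phi k s ≤ phi k p

instance (A : Finset (ℤ × ℤ)) (k : Fin 3) : Decidable (MinEdge A k) := by
  unfold MinEdge; infer_instance

instance (A : Finset (ℤ × ℤ)) (k : Fin 3) : Decidable (MaxEdge A k) := by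
  unfold MaxEdge; infer_instance

lemma det3_ne_zero_of_phi {k : Fin 3} {p q r : ℤ × ℤ} (hpq : p ≠ q) (h : phi k p = phi k q)
    (hr : phi k r ≠ phi k p) : det3 p q r ≠ 0 := by
  intro h0
  apply hpq
  fin_cases k <;> simp only [phi, det3] at * <;> simp at h hr
  · rw [h] at h0
    have : (q.2 - p.2) * (r.1 - q.1) = 0 := by linarith
    rcases mul_eq_zero.1 this with h2 | h2
    · ext <;> omega
    · omega
  · rw [h] at h0
    have : (q.1 - p.1) * (r.2 - q.2) = 0 := by linarith
    rcases mul_eq_zero.1 this with h2 | h2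
    · ext <;> omega
    · omega
  · have e : q.2 - p.2 = -(q.1 - p.1) := by linarith
    rw [e] at h0
    have : (q.1 - p.1) * (r.1 + r.2 - p.1 - p.2) = 0 := by linarith
    rcases mul_eq_zero.1 this with h2 | h2
    · ext <;> omega
    · omega

lemma phi_third_ne {k : Fin 3} {p q r : ℤ × ℤ} (hd : det3 p q r ≠ 0) (h : phi k p = phi k q) :
    phi k r ≠ phi k p := by
  intro hr
  apply hd
  fin_cases k <;> simp only [phi, det3] at * <;> simp at h hr
  · rw [h, hr, h]; ring
  · rw [h, hr, h]; ring
  · have e1 : q.2 = p.1 + p.2 - q.1 := by linarith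
    have e2 : r.2 = p.1 + p.2 - r.1 := by linarith
    rw [e1, e2]; ring

lemma pair_dir_le {k : Fin 3} {p s : ℤ × ℤ} :
    pair s (toReal (dir k)) ≤ pair p (toReal (dir k)) ↔ phi k p ≤ phi k s := by
  rw [pair_dir, pair_dir, neg_le_neg_iff, Int.cast_le]

lemma pair_dir_lt {k : Fin 3} {p s : ℤ × ℤ} :
    pair s (toReal (dir k)) < pair p (toReal (dir k)) ↔ phi k p < phi k s := by
  rw [pair_dir, pair_dir, neg_lt_neg_iff, Int.cast_lt]

lemma pair_dir_eq {k : Fin 3} {p s : ℤ × ℤ} :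
    pair s (toReal (dir k)) = pair p (toReal (dir k)) ↔ phi k s = phi k p := by
  rw [pair_dir, pair_dir, neg_inj, Int.cast_inj]

/-- A vector orthogonal to an edge of `T_1` is a multiple of the corresponding direction. -/
lemma exists_smul_dir {k : Fin 3} {p q : ℤ × ℤ} (hpq : p ≠ q) (h : phi k p = phi k q)
    {y : ℝ × ℝ} (hy : pair p y = pair q y) : ∃ t : ℝ, y = t • toReal (dir k) := by
  simp only [pair] at hy
  fin_cases k <;> simp only [phi] at * <;> simp at h
  · have hne : (p.2 : ℝ) - q.2 ≠ 0 := by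
      rw [sub_ne_zero]; intro e; exact hpq (Prod.ext h (by exact_mod_cast e))
    refine ⟨-y.1, ?_⟩
    have : y.2 = 0 := by
      rw [h] at hy
      exact (mul_eq_zero.1 (by linarith : ((p.2 : ℝ) - q.2) * y.2 = 0)).resolve_left hne
    ext <;> simp [dir, this]
  · have hne : (p.1 : ℝ) - q.1 ≠ 0 := by
      rw [sub_ne_zero]; intro e; exact hpq (Prod.ext (by exact_mod_cast e) h)
    refine ⟨-y.2, ?_⟩
    have : y.1 = 0 := by
      rw [h] at hy
      exact (mul_eq_zero.1 (by linarith : ((p.1 : ℝ) - q.1) * y.1 = 0)).resolve_left hne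
    ext <;> simp [dir, this]
  · have hR : (p.1 : ℝ) + p.2 = q.1 + q.2 := by
      have : p.1 + p.2 = q.1 + q.2 := by linarith
      exact_mod_cast this
    have hne : (p.1 : ℝ) - q.1 ≠ 0 := by
      rw [sub_ne_zero]; intro e
      have e' : p.1 = q.1 := by exact_mod_cast e
      exact hpq (Prod.ext e' (by linarith))
    refine ⟨y.1, ?_⟩
    have : y.1 - y.2 = 0 := by
      refine (mul_eq_zero.1 (?_ : ((p.1 : ℝ) - q.1) * (y.1 - y.2) = 0)).resolve_left hne
      linear_combination hy - y.2 * hR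
    ext <;> simp [dir]; linarith

/-! ### Edges of the curve leaving a vertex along a tropical line -/

namespace TropPoly

variable {P : TropPoly} {v : ℝ × ℝ} {k : Fin 3} {p q : ℤ × ℤ}

/-- `p` and `q` span the edge of the triangle dual to `v` on which `phi k` is minimal. -/
structure MinPair (P : TropPoly) (v : ℝ × ℝ) (k : Fin 3) (p q : ℤ × ℤ) : Prop where
  left : p ∈ P.active v
  right : q ∈ P.active v
  ne : p ≠ q
  eq : phi k p = phi k q
  le : ∀ s ∈ P.active v, phi k p ≤ phi k s

lemma minEdge_iff : MinEdge (P.active v) k ↔ ∃ p q, P.MinPair v k p q :=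
  ⟨fun ⟨p, hp, q, hq, h1, h2, h3⟩ => ⟨p, q, hp, hq, h1, h2, h3⟩,
    fun ⟨p, q, h⟩ => ⟨p, h.left, q, h.right, h.ne, h.eq, h.le⟩⟩

lemma MinPair.symm (h : P.MinPair v k p q) : P.MinPair v k q p :=
  ⟨h.right, h.left, h.ne.symm, h.eq.symm, fun s hs => h.eq ▸ h.le s hs⟩

lemma MinPair.mem_iff (hP : P.NonSingular) (hv : P.IsVertex v) (h : P.MinPair v k p q)
    (s : ℤ × ℤ) : (s ∈ P.active v ∧ phi k s = phi k p) ↔ s = p ∨ s = q := by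
  obtain ⟨r, hr, hd⟩ := (IsVertex.isPrim hP hv).exists_third h.left h.right h.ne
  have hne := phi_third_ne (det3_ne_zero_of_abs hd) h.eq
  rw [hr]
  simp only [Finset.mem_insert, Finset.mem_singleton]
  constructor
  · rintro ⟨rfl | rfl | rfl, h2⟩
    · exact Or.inl rfl
    · exact Or.inr rfl
    · exact absurd h2 hne
  · rintro (rfl | rfl)
    · exact ⟨Or.inl rfl, rfl⟩
    · exact ⟨Or.inr (Or.inl rfl), h.eq.symm⟩

lemma MinPair.exists_third (hP : P.NonSingular) (hv : P.IsVertex v) (h : P.MinPair v k p q) :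
    ∃ r, P.active v = {p, q, r} ∧ |det3 p q r| = 1 ∧ phi k p < phi k r := by
  obtain ⟨r, hr, hd⟩ := (IsVertex.isPrim hP hv).exists_third h.left h.right h.ne
  refine ⟨r, hr, hd, lt_of_le_of_ne (h.le r (by simp [hr])) ?_⟩
  exact (phi_third_ne (det3_ne_zero_of_abs hd) h.eq).symm

lemma MinPair.active_between (hP : P.NonSingular) (hv : P.IsVertex v) (h : P.MinPair v k p q)
    {l t : ℝ} (hl : p ∈ P.active (pointAt v (dir k) l)) (h0 : 0 < t) (h1 : t < l) :
    P.active (pointAt v (dir k) t) = {p, q} := by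
  ext s
  simp only [Finset.mem_insert, Finset.mem_singleton]
  rw [← h.mem_iff hP hv s, ← pair_dir_eq]
  exact TropPoly.active_between h.left hl h0 h1 s

/-- The set on which `p` and `q` are active is the part of the ray issued from `v` on which `p` is
active. -/
lemma MinPair.setOf_eq (hP : P.NonSingular) (hv : P.IsVertex v) (h : P.MinPair v k p q) :
    {y | ({p, q} : Finset (ℤ × ℤ)) ⊆ P.active y} =
      {y | ∃ t : ℝ, 0 ≤ t ∧ p ∈ P.active (pointAt v (dir k) t) ∧ y = pointAt v (dir k) t} := by
  ext y
  simp only [Set.mem_ofPred_eq, Finset.insert_subset_iff, Finset.singleton_subset_iff]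
  constructor
  · rintro ⟨hp, hq⟩
    have e1 := term_eq_of_mem_active hp hq
    have e2 := term_eq_of_mem_active h.left h.right
    obtain ⟨t, ht⟩ := exists_smul_dir (y := y - v) h.ne h.eq (by
      simp only [term_eq, pair, Prod.fst_sub, Prod.snd_sub] at *; linarith)
    have hy : y = pointAt v (dir k) t := by rw [pointAt, ← ht]; abel
    refine ⟨t, ?_, hy ▸ hp, hy⟩
    -- Behind v the third vertex r of the dual triangle, whose slope along `dir k` is smaller,
    -- overtakes p.
    by_contra! hneg
    obtain ⟨r, hr, hd, hlt⟩ := h.exists_third hP hv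
    have hra : r ∈ P.active v := by simp [hr]
    have := (mem_active.1 hp).2 r (active_subset _ hra)
    rw [hy, pointAt, term_add_smul, term_add_smul, term_eq_of_mem_active hra h.left] at this
    have h2 := pair_dir_lt.2 hlt
    nlinarith
  · rintro ⟨t, ht, hp, rfl⟩
    refine ⟨hp, mem_active_of_term_eq hp (active_subset _ h.right) ?_⟩
    rw [pointAt, term_add_smul, term_add_smul, term_eq_of_mem_active h.left h.right,
      pair_dir_eq.2 h.eq]

lemma mem_edges_of_active_eq {x : ℝ × ℝ} (hpq : p ≠ q) (h : P.active x = {p, q}) :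
    {y | ({p, q} : Finset (ℤ × ℤ)) ⊆ P.active y} ∈ P.edges :=
  ⟨x, by simp [curve, h, Finset.card_pair hpq], not_isVertex_of_subset_pair h.subset,
    by rw [h]⟩

/-- Follow p from v along `dir k` with `active_forever_or_exists`. If p is overtaken, the monomial s
that catches up has smaller `phi k`. With p and q it is therefore not collinear, the far end is a
vertex, and s is the third vertex of the primitive triangle there. -/
lemma MinPair.unboundedEdge_or (hP : P.NonSingular) (hv : P.IsVertex v)
    (h : P.MinPair v k p q) :
    (P.UnboundedEdge v (dir k) ∧ (∀ s ∈ P.support, phi k p ≤ phi k s) ∧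
        ∀ t, 0 < t → P.active (pointAt v (dir k) t) = {p, q}) ∨
      ∃ l, P.BoundedEdge v (dir k) l ∧
        (∀ t, 0 < t → t < l → P.active (pointAt v (dir k) t) = {p, q}) ∧
        ∃ s, P.active (pointAt v (dir k) l) = {p, q, s} ∧ |det3 p q s| = 1 ∧
          phi k s < phi k p := by
  rcases active_forever_or_exists (h := toReal (dir k)) h.left
    (fun s hs => pair_dir_le.2 (h.le s hs)) with ⟨hsup, hall⟩ | ⟨l, hl, hpl, s, hs, hps⟩
  · left
    have hact : ∀ t, 0 < t → P.active (pointAt v (dir k) t) = {p, q} := fun t ht =>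
      h.active_between hP hv (l := t + 1) (hall _ (by positivity)) ht (by linarith)
    refine ⟨⟨dir_isCoprime k, ?_⟩, fun s hs => pair_dir_le.1 (hsup s hs), hact⟩
    have := mem_edges_of_active_eq h.ne (hact 1 one_pos)
    rw [h.setOf_eq hP hv] at this
    convert this using 1
    ext y
    constructor
    · rintro ⟨t, ht, rfl⟩; exact ⟨t, ht, hall t ht, rfl⟩
    · rintro ⟨t, ht, -, rfl⟩; exact ⟨t, ht, rfl⟩
  · right
    have hact : ∀ t, 0 < t → t < l → P.active (pointAt v (dir k) t) = {p, q} := fun t ht htl =>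
      h.active_between hP hv hpl ht htl
    have hlt := pair_dir_lt.1 hps
    have hql : q ∈ P.active (v + l • toReal (dir k)) := by
      refine mem_active_of_term_eq hpl (active_subset _ h.right) ?_
      rw [term_add_smul, term_add_smul, term_eq_of_mem_active h.left h.right,
        pair_dir_eq.2 h.eq]
    refine ⟨l, ⟨dir_isCoprime k, hl, ?_⟩, hact, s, ?_⟩
    · have := mem_edges_of_active_eq h.ne (hact (l / 2) (by linarith) (by linarith))
      rw [h.setOf_eq hP hv] at this
      convert this using 1
      ext y
      rw [mem_seg hl]
      constructor
      · rintro ⟨t, ht, htl, rfl⟩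
        exact ⟨t, ht, mem_active_between h.left hpl ht htl, rfl⟩
      · rintro ⟨t, ht, hpt, rfl⟩
        refine ⟨t, ht, ?_, rfl⟩
        -- If p were still active beyond l, then s, active at the interior time l, would have the
        -- slope of p.
        by_contra! hlt'
        have e := (TropPoly.active_between h.left hpt hl hlt' s).1 hs
        exact hps.ne' e.2
    · have hd := det3_ne_zero_of_phi h.ne h.eq hlt.ne
      have hw : P.IsVertex (pointAt v (dir k) l) := isVertex_of_det hpl hql hs hd
      obtain ⟨r, hr, hdr⟩ := (IsVertex.isPrim hP hw).exists_third hpl hql h.ne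
      have hs' : s ∈ P.active (pointAt v (dir k) l) := hs
      rw [hr] at hs'
      simp only [Finset.mem_insert, Finset.mem_singleton] at hs'
      rcases hs' with rfl | rfl | rfl
      · exact absurd rfl hlt.ne
      · exact absurd h.eq hlt.ne'
      · exact ⟨hr, hdr, hlt⟩

/-- An edge of the curve issued from a vertex in one of the three directions is dual to the edge
of the triangle on which `phi k` is minimal. -/
lemma exists_minPair_of_mem_edges (hP : P.NonSingular) (hv : P.IsVertex v) {e : Set (ℝ × ℝ)}
    (he : e ∈ P.edges) (hve : v ∈ e) {l : ℝ} (hl : 0 < l) (hle : pointAt v (dir k) l ∈ e) :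
    ∃ p q, P.MinPair v k p q ∧ e = {y | ({p, q} : Finset (ℤ × ℤ)) ⊆ P.active y} := by
  obtain ⟨x, hx, hxv, rfl⟩ := he
  obtain ⟨p, hp, q, hq, hpq⟩ := Finset.one_lt_card.1 (show 1 < (P.active x).card from hx)
  have hpv := hve hp
  have hqv := hve hq
  obtain ⟨r, hr, hd⟩ := (IsVertex.isPrim hP hv).exists_third hpv hqv hpq
  have hpe := hle hp
  have hqe := hle hq
  have heq : phi k p = phi k q := by
    have e := term_eq_of_mem_active hpe hqe
    rw [pointAt, term_add_smul, term_add_smul, term_eq_of_mem_active hpv hqv] at e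
    refine (pair_dir_eq.1 (mul_left_cancel₀ hl.ne' ?_)); linarith
  have hne := phi_third_ne (det3_ne_zero_of_abs hd) heq
  have hrv : r ∈ P.active v := by simp [hr]
  have hle' : phi k p ≤ phi k r := by
    have e := (mem_active.1 hpe).2 r (active_subset _ hrv)
    rw [pointAt, term_add_smul, term_add_smul, term_eq_of_mem_active hrv hpv] at e
    exact pair_dir_le.1 (le_of_mul_le_mul_left (by linarith) hl)
  refine ⟨p, q, ⟨hpv, hqv, hpq, heq, ?_⟩, ?_⟩
  · rw [hr]
    rintro s hs
    simp only [Finset.mem_insert, Finset.mem_singleton] at hs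
    rcases hs with rfl | rfl | rfl
    exacts [le_rfl, heq.le, hle']
  · have hax : P.active x = {p, q} := by
      ext s
      simp only [Finset.mem_insert, Finset.mem_singleton]
      constructor
      · intro hs
        have := hve hs
        rw [hr] at this
        simp only [Finset.mem_insert, Finset.mem_singleton] at this
        rcases this with h | h | rfl
        · exact Or.inl h
        · exact Or.inr h
        · exact absurd (isVertex_of_det hp hq hs (det3_ne_zero_of_abs hd)) hxv
      · rintro (rfl | rfl) <;> assumption
    rw [hax]

lemma BoundedEdge.minPair (hP : P.NonSingular) (hv : P.IsVertex v) {l : ℝ}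
    (h : P.BoundedEdge v (dir k) l) : ∃ p q, P.MinPair v k p q ∧
      seg v (dir k) l = {y | ({p, q} : Finset (ℤ × ℤ)) ⊆ P.active y} :=
  exists_minPair_of_mem_edges hP hv h.2.2 (self_mem_seg _ _ _) h.2.1 (pointAt_mem_seg _ _ _)

lemma self_mem_ray (v : ℝ × ℝ) (u : ℤ × ℤ) : v ∈ ray v u := ⟨0, le_rfl, by simp [pointAt]⟩

lemma UnboundedEdge.minPair (hP : P.NonSingular) (hv : P.IsVertex v)
    (h : P.UnboundedEdge v (dir k)) : ∃ p q, P.MinPair v k p q ∧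
      ray v (dir k) = {y | ({p, q} : Finset (ℤ × ℤ)) ⊆ P.active y} :=
  exists_minPair_of_mem_edges hP hv h.2 (self_mem_ray _ _) one_pos ⟨1, zero_le_one, rfl⟩

lemma MinPair.subset_pair (hP : P.NonSingular) (hv : P.IsVertex v) (h : P.MinPair v k p q)
    {p' q' : ℤ × ℤ} (h' : P.MinPair v k p' q') :
    ({p, q} : Finset (ℤ × ℤ)) ⊆ {p', q'} := by
  have he : phi k p = phi k p' := le_antisymm (h.le _ h'.left) (h'.le _ h.left)
  intro s hs
  simp only [Finset.mem_insert, Finset.mem_singleton] at hs ⊢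
  have h1 := (h.mem_iff hP hv s).2 hs
  exact (h'.mem_iff hP hv s).1 ⟨h1.1, h1.2.trans he⟩

lemma MinPair.pair_eq (hP : P.NonSingular) (hv : P.IsVertex v) (h : P.MinPair v k p q)
    {p' q' : ℤ × ℤ} (h' : P.MinPair v k p' q') : ({p, q} : Finset (ℤ × ℤ)) = {p', q'} :=
  (h.subset_pair hP hv h').antisymm (h'.subset_pair hP hv h)

lemma seg_dir_injective {l l' : ℝ} (hl : 0 < l) (hl' : 0 < l')
    (h : seg v (dir k) l = seg v (dir k) l') : l = l' := by
  have aux : ∀ {l l' : ℝ}, 0 < l → 0 < l' → seg v (dir k) l = seg v (dir k) l' → l ≤ l' := by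
    intro l l' hl hl' h
    obtain ⟨t, -, ht, e⟩ := (mem_seg hl').1 (h ▸ pointAt_mem_seg v (dir k) l)
    exact (pointAt_dir_injective v k e).trans_le ht
  exact le_antisymm (aux hl hl' h) (aux hl' hl h.symm)

lemma seg_ne_ray {l : ℝ} (hl : 0 < l) : seg v (dir k) l ≠ ray v (dir k) := by
  intro h
  have : pointAt v (dir k) (l + 1) ∈ ray v (dir k) := ⟨l + 1, by positivity, rfl⟩
  rw [← h, mem_seg hl] at this
  obtain ⟨t, -, ht, e⟩ := this
  linarith [pointAt_dir_injective v k e]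

lemma BoundedEdge.unique (hP : P.NonSingular) (hv : P.IsVertex v) {l l' : ℝ}
    (h : P.BoundedEdge v (dir k) l) (h' : P.BoundedEdge v (dir k) l') : l = l' := by
  obtain ⟨p, q, hpq, e⟩ := h.minPair hP hv
  obtain ⟨p', q', hpq', e'⟩ := h'.minPair hP hv
  exact seg_dir_injective h.2.1 h'.2.1 (by rw [e, e', hpq.pair_eq hP hv hpq'])

lemma BoundedEdge.not_unboundedEdge (hP : P.NonSingular) (hv : P.IsVertex v) {l : ℝ}
    (h : P.BoundedEdge v (dir k) l) : ¬ P.UnboundedEdge v (dir k) := by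
  intro h'
  obtain ⟨p, q, hpq, e⟩ := h.minPair hP hv
  obtain ⟨p', q', hpq', e'⟩ := h'.minPair hP hv
  exact seg_ne_ray h.2.1 (by rw [e, e', hpq.pair_eq hP hv hpq'])

lemma minEdge_iff_edge (hP : P.NonSingular) (hv : P.IsVertex v) :
    MinEdge (P.active v) k ↔ P.UnboundedEdge v (dir k) ∨ ∃ l, P.BoundedEdge v (dir k) l := by
  constructor
  · intro h
    obtain ⟨p, q, hpq⟩ := minEdge_iff.1 h
    rcases hpq.unboundedEdge_or hP hv with h | ⟨l, h, -⟩
    exacts [Or.inl h.1, Or.inr ⟨l, h⟩]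
  · rintro (h | ⟨l, h⟩)
    · obtain ⟨p, q, hpq, -⟩ := h.minPair hP hv
      exact minEdge_iff.2 ⟨p, q, hpq⟩
    · obtain ⟨p, q, hpq, -⟩ := h.minPair hP hv
      exact minEdge_iff.2 ⟨p, q, hpq⟩

/-- The monomials active along a bounded edge and at its far end. -/
lemma MinPair.of_boundedEdge (hP : P.NonSingular) (hv : P.IsVertex v) (h : P.MinPair v k p q)
    {l : ℝ} (hl : P.BoundedEdge v (dir k) l) :
    (∀ t, 0 < t → t < l → P.active (pointAt v (dir k) t) = {p, q}) ∧
      ∃ s, P.active (pointAt v (dir k) l) = {p, q, s} ∧ |det3 p q s| = 1 ∧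
        phi k s < phi k p := by
  rcases h.unboundedEdge_or hP hv with ⟨h, -⟩ | ⟨l', h, h'⟩
  · exact absurd h (hl.not_unboundedEdge hP hv)
  · rwa [hl.unique hP hv h]

lemma MinPair.of_unboundedEdge (hP : P.NonSingular) (hv : P.IsVertex v)
    (h : P.MinPair v k p q) (hu : P.UnboundedEdge v (dir k)) :
    (∀ s ∈ P.support, phi k p ≤ phi k s) ∧
      ∀ t, 0 < t → P.active (pointAt v (dir k) t) = {p, q} := by
  rcases h.unboundedEdge_or hP hv with ⟨-, h⟩ | ⟨l', h, h'⟩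
  · exact h
  · exact absurd hu (h.not_unboundedEdge hP hv)

lemma BoundedEdge.isVertex_end (hP : P.NonSingular) (hv : P.IsVertex v) {l : ℝ}
    (h : P.BoundedEdge v (dir k) l) : P.IsVertex (pointAt v (dir k) l) := by
  obtain ⟨p, q, hpq, -⟩ := h.minPair hP hv
  obtain ⟨-, s, hs, hd, -⟩ := hpq.of_boundedEdge hP hv h
  exact isVertex_of_det (p := p) (q := q) (r := s) (by simp [hs]) (by simp [hs]) (by simp [hs])
    (det3_ne_zero_of_abs hd)

end TropPoly
/-! ### Tropical lines -/

/-- The exponents of the polynomial of a tropical line that are active along one of its rays. -/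
def lineEdge : Fin 3 → Finset (ℤ × ℤ) :=
  ![{(0, 1), (0, 0)}, {(1, 0), (0, 0)}, {(1, 0), (0, 1)}]

lemma mem_tropLine_support {v : ℝ × ℝ} {i : ℤ × ℤ} :
    i ∈ (tropLine v).support ↔ i = (1, 0) ∨ i = (0, 1) ∨ i = (0, 0) := by
  simp [tropLine]

lemma tropLine_term_x (v x : ℝ × ℝ) : (tropLine v).term (1, 0) x = x.1 - v.1 := by
  simp [TropPoly.term, tropLine]; ring

lemma tropLine_term_y (v x : ℝ × ℝ) : (tropLine v).term (0, 1) x = x.2 - v.2 := by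
  simp [TropPoly.term, tropLine]; ring

lemma tropLine_term_one (v x : ℝ × ℝ) : (tropLine v).term (0, 0) x = 0 := by
  simp [TropPoly.term, tropLine]

lemma mem_tropLine_active {v x : ℝ × ℝ} {i : ℤ × ℤ} : i ∈ (tropLine v).active x ↔
    (i = (1, 0) ∧ x.2 - v.2 ≤ x.1 - v.1 ∧ 0 ≤ x.1 - v.1) ∨
    (i = (0, 1) ∧ x.1 - v.1 ≤ x.2 - v.2 ∧ 0 ≤ x.2 - v.2) ∨
    (i = (0, 0) ∧ x.1 - v.1 ≤ 0 ∧ x.2 - v.2 ≤ 0) := by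
  rw [TropPoly.mem_active]
  simp only [mem_tropLine_support, forall_eq_or_imp, forall_eq, tropLine_term_x, tropLine_term_y,
    tropLine_term_one]
  constructor
  · rintro ⟨rfl | rfl | rfl, h⟩
    · rw [tropLine_term_x] at h; exact Or.inl ⟨rfl, h.2.1, h.2.2⟩
    · rw [tropLine_term_y] at h; exact Or.inr (Or.inl ⟨rfl, h.1, h.2.2⟩)
    · rw [tropLine_term_one] at h; exact Or.inr (Or.inr ⟨rfl, h.1, h.2.1⟩)
  · rintro (⟨rfl, h⟩ | ⟨rfl, h⟩ | ⟨rfl, h⟩)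
    · rw [tropLine_term_x]; exact ⟨Or.inl rfl, le_rfl, h.1, h.2⟩
    · rw [tropLine_term_y]; exact ⟨Or.inr (Or.inl rfl), h.1, le_rfl, h.2⟩
    · rw [tropLine_term_one]; exact ⟨Or.inr (Or.inr rfl), h.1, h.2, le_rfl⟩

lemma tropLine_active_self (v : ℝ × ℝ) :
    (tropLine v).active v = {(1, 0), (0, 1), (0, 0)} := by
  ext i
  simp [mem_tropLine_active]

lemma tropLine_active_ray (v : ℝ × ℝ) (k : Fin 3) {t : ℝ} (ht : 0 < t) :
    (tropLine v).active (pointAt v (dir k) t) = lineEdge k := by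
  ext i
  rw [mem_tropLine_active]
  fin_cases k <;> simp [pointAt, dir, lineEdge, ht.le, ht.not_ge]

lemma mem_tropLine_curve {v x : ℝ × ℝ} :
    x ∈ (tropLine v).curve ↔ ∃ k t, 0 ≤ t ∧ x = pointAt v (dir k) t := by
  constructor
  · intro hx
    obtain ⟨i, hi, j, hj, hij⟩ := Finset.one_lt_card.1
      (show 1 < ((tropLine v).active x).card from hx)
    rw [mem_tropLine_active] at hi hj
    have h2 : (x.1 - v.1 = x.2 - v.2 ∧ 0 ≤ x.1 - v.1) ∨ (x.1 - v.1 = 0 ∧ x.2 - v.2 ≤ 0) ∨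
        (x.2 - v.2 = 0 ∧ x.1 - v.1 ≤ 0) := by
      rcases hi with ⟨rfl, a, b⟩ | ⟨rfl, a, b⟩ | ⟨rfl, a, b⟩ <;>
        rcases hj with ⟨rfl, c, d⟩ | ⟨rfl, c, d⟩ | ⟨rfl, c, d⟩ <;>
        first
        | exact absurd rfl hij
        | exact Or.inl ⟨by linarith, by linarith⟩
        | exact Or.inr (Or.inl ⟨by linarith, by linarith⟩)
        | exact Or.inr (Or.inr ⟨by linarith, by linarith⟩)
    rcases h2 with ⟨a, b⟩ | ⟨a, b⟩ | ⟨a, b⟩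
    · exact ⟨2, x.1 - v.1, b, by ext <;> simp [pointAt, dir]; linarith⟩
    · exact ⟨1, v.2 - x.2, by linarith, by ext <;> simp [pointAt, dir]; linarith⟩
    · exact ⟨0, v.1 - x.1, by linarith, by ext <;> simp [pointAt, dir]; linarith⟩
  · rintro ⟨k, t, ht, rfl⟩
    rcases ht.eq_or_lt with rfl | ht
    · rw [pointAt_zero]
      change 2 ≤ ((tropLine v).active v).card
      rw [tropLine_active_self]; decide
    · change 2 ≤ ((tropLine v).active _).card
      rw [tropLine_active_ray v k ht]
      fin_cases k <;> decide

lemma form_pointAt (k j : Fin 3) (v : ℝ × ℝ) (t : ℝ) :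
    form k (pointAt v (dir j) t) = form k v + t * phi k (dir j) := by
  fin_cases k <;> simp [form, pointAt, phi]
  ring

lemma continuous_form (k : Fin 3) : Continuous (form k) := by
  fin_cases k <;> simp [form] <;> fun_prop

lemma phi_dir_self (k : Fin 3) : phi k (dir k) < 0 := by
  fin_cases k <;> decide

lemma phi_dir_of_ne {k j : Fin 3} (h : k ≠ j) : 0 ≤ phi k (dir j) := by
  revert k j; decide

/-! ### The component at v of the intersection with the tropical line -/

namespace TropPoly

variable {P : TropPoly} {v : ℝ × ℝ} {k : Fin 3}

lemma mem_curve_of_pair {p q : ℤ × ℤ} {x : ℝ × ℝ} (hpq : p ≠ q)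
    (h : ({p, q} : Finset (ℤ × ℤ)) ⊆ P.active x) : x ∈ P.curve := by
  change 2 ≤ (P.active x).card
  rw [← Finset.card_pair hpq]
  exact Finset.card_le_card h

lemma IsVertex.mem_curve (hP : P.NonSingular) (hv : P.IsVertex v) : v ∈ P.curve := by
  change 2 ≤ (P.active v).card
  rw [(IsVertex.isPrim hP hv).card]
  norm_num

/-- Just after v the active monomials are those active at v with the largest slope along `dir k`,
i.e. the smallest `phi k`. A point of the curve there has at least two of them. -/
lemma minEdge_of_forall_mem_curve {l : ℝ} (hl : 0 < l)
    (h : ∀ t, 0 < t → t < l → pointAt v (dir k) t ∈ P.curve) : MinEdge (P.active v) k := by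
  have h1 := P.eventually_active v (toReal (dir k))
  have h2 : ∀ᶠ t in nhdsWithin (0 : ℝ) (Set.Ioi 0), t ∈ Set.Ioo 0 l := Ioo_mem_nhdsGT hl
  obtain ⟨t, ht, h0, htl⟩ := (h1.and h2).exists
  obtain ⟨p, hp, q, hq, hpq⟩ := Finset.one_lt_card.1
    (show 1 < (P.active (pointAt v (dir k) t)).card from h t h0 htl)
  obtain ⟨hpv, hpm⟩ := (ht p).1 hp
  obtain ⟨hqv, hqm⟩ := (ht q).1 hq
  exact ⟨p, hpv, q, hqv, hpq, le_antisymm (pair_dir_le.1 (hpm q hqv)) (pair_dir_le.1 (hqm p hpv)),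
    fun s hs => pair_dir_le.1 (hpm s hs)⟩

/-- Intermediate value theorem for `form k` on the connected component. On the ray `dir k` this form
strictly decreases from its value at v, while on the two other rays it never falls below that value.
So the intermediate value is taken only at the point at distance s on the ray `dir k`, which must
belong to the component. -/
lemma mem_curve_of_mem_lineComp (hv : v ∈ P.curve) {t s : ℝ}
    (hx : pointAt v (dir k) t ∈ P.lineComp v) (h0 : 0 < s) (h1 : s < t) :
    pointAt v (dir k) s ∈ P.curve := by
  have hv' : v ∈ P.curve ∩ (tropLine v).curve :=
    ⟨hv, mem_tropLine_curve.2 ⟨0, 0, le_rfl, (pointAt_zero _ _).symm⟩⟩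
  have hvE : v ∈ P.lineComp v := mem_connectedComponentIn hv'
  have hneg : ((phi k (dir k) : ℤ) : ℝ) < 0 := by exact_mod_cast phi_dir_self k
  have hiv := isPreconnected_connectedComponentIn.intermediate_value (s := P.lineComp v) hx hvE
    (continuous_form k).continuousOn
  obtain ⟨y, hy, e⟩ := hiv (show form k v + s * phi k (dir k) ∈ Set.Icc _ _ by
    rw [form_pointAt]; constructor <;> nlinarith)
  have hyL := connectedComponentIn_subset _ _ hy
  obtain ⟨j, r, hr, rfl⟩ := mem_tropLine_curve.1 hyL.2
  rw [form_pointAt] at e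
  by_cases hkj : k = j
  · subst hkj
    have : r = s := mul_right_cancel₀ hneg.ne (by linarith)
    exact this ▸ hyL.1
  · have : (0 : ℝ) ≤ phi k (dir j) := by exact_mod_cast phi_dir_of_ne hkj
    nlinarith [mul_nonneg hr this]

/-- The component of the intersection with the tropical line consists of the vertex and of the
edges of the curve which leave it in one of the directions of the line. -/
lemma mem_lineComp (hP : P.NonSingular) (hv : P.IsVertex v) {x : ℝ × ℝ} :
    x ∈ P.lineComp v ↔ x = v ∨ ∃ k t, 0 < t ∧ x = pointAt v (dir k) t ∧
      (P.UnboundedEdge v (dir k) ∨ ∃ l, P.BoundedEdge v (dir k) l ∧ t ≤ l) := by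
  have hvC := IsVertex.mem_curve hP hv
  have hv' : v ∈ P.curve ∩ (tropLine v).curve :=
    ⟨hvC, mem_tropLine_curve.2 ⟨0, 0, le_rfl, (pointAt_zero _ _).symm⟩⟩
  constructor
  · intro hx
    obtain ⟨k, t, ht, rfl⟩ := mem_tropLine_curve.1 (connectedComponentIn_subset _ _ hx).2
    rcases ht.eq_or_lt with rfl | ht
    · exact Or.inl (pointAt_zero _ _)
    refine Or.inr ⟨k, t, ht, rfl, ?_⟩
    have hc : ∀ s, 0 < s → s < t → pointAt v (dir k) s ∈ P.curve := fun s h0 h1 =>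
      mem_curve_of_mem_lineComp hvC hx h0 h1
    rcases (minEdge_iff_edge hP hv).1 (minEdge_of_forall_mem_curve ht hc) with h | ⟨l, hl⟩
    · exact Or.inl h
    · refine Or.inr ⟨l, hl, ?_⟩
      by_contra! hlt
      obtain ⟨p, q, hpq, -⟩ := hl.minPair hP hv
      obtain ⟨-, s, hs, hd, hsp⟩ := hpq.of_boundedEdge hP hv hl
      -- If the component went on past the far end, `phi k` would be minimal at two vertices of the
      -- triangle there. But s is its only minimum.
      have : MinEdge (P.active (pointAt v (dir k) l)) k := by
        refine minEdge_of_forall_mem_curve (sub_pos.2 hlt) fun r h0 h1 => ?_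
        rw [pointAt_add]
        exact hc _ (add_pos hl.2.1 h0) (by linarith)
      obtain ⟨a, ha, b, hb, hab, e, hmin⟩ := this
      have hpq' := hpq.eq
      have h3 := hmin s (by simp [hs])
      rw [hs] at ha hb
      simp only [Finset.mem_insert, Finset.mem_singleton] at ha hb
      rcases ha with rfl | rfl | rfl
      · linarith
      · linarith
      · rcases hb with rfl | rfl | rfl
        · linarith
        · linarith
        · exact hab rfl
  · rintro (rfl | ⟨k, t, ht, rfl, h⟩)
    · exact mem_connectedComponentIn hv'
    · have hsub : seg v (dir k) t ⊆ P.curve ∩ (tropLine v).curve := by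
        intro y hy
        obtain ⟨s, hs0, hst, rfl⟩ := (mem_seg ht).1 hy
        refine ⟨?_, mem_tropLine_curve.2 ⟨k, s, hs0, rfl⟩⟩
        rcases h with h | ⟨l, h, htl⟩
        · obtain ⟨p, q, hpq, e⟩ := h.minPair hP hv
          exact mem_curve_of_pair hpq.ne (e.subset ⟨s, hs0, rfl⟩)
        · obtain ⟨p, q, hpq, e⟩ := h.minPair hP hv
          exact mem_curve_of_pair hpq.ne
            (e.subset ((mem_seg h.2.1).2 ⟨s, hs0, hst.trans htl, rfl⟩))
      exact (convex_segment _ _).isPreconnected.subset_connectedComponentIn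
        (self_mem_seg _ _ _) hsub (pointAt_mem_seg _ _ _)

end TropPoly
/-! ### Areas -/

lemma volume_eq_zero_of_collinear {S : Set (ℝ × ℝ)} (h : Collinear ℝ S) : volume S = 0 := by
  refine measure_mono_null (subset_affineSpan ℝ S) (Measure.addHaar_affineSubspace _ _ ?_)
  intro htop
  have h1 := collinear_iff_finrank_le_one.1 h
  rw [← direction_affineSpan, htop, AffineSubspace.direction_top, finrank_top] at h1
  simp at h1

lemma collinear_convexHull {S : Set (ℝ × ℝ)} (h : Collinear ℝ S) :
    Collinear ℝ (convexHull ℝ S) := by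
  rw [Collinear, ← direction_affineSpan, affineSpan_convexHull, direction_affineSpan]
  exact h

lemma area_eq_zero_of_collinear {S : Set (ℝ × ℝ)} (h : Collinear ℝ S) : area S = 0 := by
  simp [area, Measure.real, volume_eq_zero_of_collinear h]

lemma volume_hull_ne_top {A : Set (ℤ × ℤ)} (h : A.Finite) : volume (hull A) ≠ ⊤ :=
  (isCompact_hull h).measure_lt_top.ne

lemma area_mono {A B : Set (ℤ × ℤ)} (hB : B.Finite) (h : hull A ⊆ hull B) :
    area (hull A) ≤ area (hull B) :=
  mul_le_mul_of_nonneg_left (measureReal_mono h (volume_hull_ne_top hB)) two_pos.le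

/-- Two polygons on different sides of a line contained in a third one. -/
lemma area_add_le {A B C : Set (ℤ × ℤ)} (hA : A.Finite) (hB : B.Finite) (hC : C.Finite)
    (hAC : hull A ⊆ hull C) (hBC : hull B ⊆ hull C) (m n c : ℤ) (h0 : m ≠ 0 ∨ n ≠ 0)
    (h1 : ∀ i ∈ A, m * i.1 + n * i.2 ≤ c) (h2 : ∀ i ∈ B, c ≤ m * i.1 + n * i.2) :
    area (hull A) + area (hull B) ≤ area (hull C) := by
  have hd : AEDisjoint volume (hull A) (hull B) := by
    refine volume_eq_zero_of_collinear (collinear_of_line (m := m) (n := n) (c := c) ?_ ?_)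
    · exact_mod_cast h0
    · rintro x ⟨hx1, hx2⟩
      exact le_antisymm (hull_le (fun i hi => by exact_mod_cast h1 i hi) hx1)
        (le_hull (fun i hi => by exact_mod_cast h2 i hi) hx2)
  unfold area
  rw [← mul_add, ← measureReal_union₀ (isCompact_hull hB).measurableSet.nullMeasurableSet hd
    (volume_hull_ne_top hA) (volume_hull_ne_top hB)]
  exact mul_le_mul_of_nonneg_left
    (measureReal_mono (Set.union_subset hAC hBC) (volume_hull_ne_top hC)) two_pos.le

lemma mem_convexHull_unit {x : ℝ × ℝ} :
    x ∈ convexHull ℝ ({(0, 0), (1, 0), (0, 1)} : Set (ℝ × ℝ)) ↔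
      0 ≤ x.1 ∧ 0 ≤ x.2 ∧ x.1 + x.2 ≤ 1 := by
  constructor
  · intro hx
    have hconv : Convex ℝ {x : ℝ × ℝ | 0 ≤ x.1 ∧ 0 ≤ x.2 ∧ x.1 + x.2 ≤ 1} := by
      rintro x ⟨h1, h2, h3⟩ y ⟨g1, g2, g3⟩ a b ha hb hab
      refine ⟨?_, ?_, ?_⟩ <;> simp
      · positivity
      · positivity
      · nlinarith
    refine convexHull_min ?_ hconv hx
    rintro _ (rfl | rfl | rfl) <;> simp
  · rintro ⟨h1, h2, h3⟩
    have hc := convex_convexHull ℝ ({(0, 0), (1, 0), (0, 1)} : Set (ℝ × ℝ))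
    have := hc.sum_mem (t := Finset.univ) (w := ![1 - x.1 - x.2, x.1, x.2])
      (z := ![(0, 0), (1, 0), (0, 1)])
      (by intro i _; fin_cases i <;> simp <;> linarith)
      (by simp [Fin.sum_univ_three]; ring)
      (by intro i _; apply subset_convexHull; fin_cases i <;> simp)
    convert this using 1
    ext <;> simp [Fin.sum_univ_three]

/-- Fubini: the slice over x in [0, 1] has length 1 - x, and the other slices are empty. -/
lemma volume_convexHull_unit :
    volume (convexHull ℝ ({(0, 0), (1, 0), (0, 1)} : Set (ℝ × ℝ))) = ENNReal.ofReal (1 / 2) := by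
  have hm : MeasurableSet (convexHull ℝ ({(0, 0), (1, 0), (0, 1)} : Set (ℝ × ℝ))) :=
    ((Set.toFinite _).isCompact_convexHull ℝ).measurableSet
  rw [Measure.volume_eq_prod, Measure.prod_apply hm]
  have : ∀ x : ℝ, volume (Prod.mk x ⁻¹' convexHull ℝ ({(0, 0), (1, 0), (0, 1)} : Set (ℝ × ℝ))) =
      (Set.Icc (0 : ℝ) 1).indicator (fun x => ENNReal.ofReal (1 - x)) x := by
    intro x
    have e : (Prod.mk x ⁻¹' convexHull ℝ ({(0, 0), (1, 0), (0, 1)} : Set (ℝ × ℝ))) =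
        {y | 0 ≤ x ∧ 0 ≤ y ∧ x + y ≤ 1} := by
      ext y; exact mem_convexHull_unit
    rw [e]
    by_cases hx : x ∈ Set.Icc (0 : ℝ) 1
    · rw [Set.indicator_of_mem hx]
      have : {y | 0 ≤ x ∧ 0 ≤ y ∧ x + y ≤ 1} = Set.Icc 0 (1 - x) := by
        ext y
        simp only [Set.mem_ofPred_eq, Set.mem_Icc]
        exact ⟨fun h => ⟨h.2.1, by linarith⟩, fun h => ⟨hx.1, h.1, by linarith⟩⟩
      rw [this, Real.volume_Icc, sub_zero]
    · rw [Set.indicator_of_notMem hx]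
      have : {y | 0 ≤ x ∧ 0 ≤ y ∧ x + y ≤ 1} = ∅ := by
        ext y
        simp only [Set.mem_ofPred_eq, Set.mem_empty_iff_false, iff_false]
        rintro ⟨h1, h2, h3⟩
        exact hx ⟨h1, by linarith⟩
      rw [this, measure_empty]
  rw [lintegral_congr this, lintegral_indicator measurableSet_Icc,
    ← ofReal_integral_eq_lintegral_ofReal]
  · rw [integral_Icc_eq_integral_Ioc, ← intervalIntegral.integral_of_le zero_le_one]
    congr 1
    rw [intervalIntegral.integral_sub (by simp) (by simp), integral_id]
    norm_num
  · exact (by fun_prop : Continuous fun x : ℝ => 1 - x).continuousOn.integrableOn_Icc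
  · filter_upwards [ae_restrict_mem measurableSet_Icc] with x hx
    simpa using hx.2

/-- The triangle is the image of the unit triangle under an affine map whose linear part has
determinant `det3 p q r`. The factor 2 in `area` cancels the 1/2. -/
lemma area_triangle (p q r : ℤ × ℤ) : area (hull {p, q, r}) = |(det3 p q r : ℝ)| := by
  let L : ℝ × ℝ →ₗ[ℝ] ℝ × ℝ := Matrix.toLin (Module.Basis.finTwoProd ℝ) (Module.Basis.finTwoProd ℝ)
    !![(q.1 - p.1 : ℝ), (r.1 - p.1 : ℝ); (q.2 - p.2 : ℝ), (r.2 - p.2 : ℝ)]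
  have hL : ∀ x : ℝ × ℝ, L x = ((q.1 - p.1 : ℝ) * x.1 + (r.1 - p.1) * x.2,
      (q.2 - p.2 : ℝ) * x.1 + (r.2 - p.2) * x.2) := fun x =>
    Matrix.toLin_finTwoProd_apply _ _ _ _ x
  let f : ℝ × ℝ →ᵃ[ℝ] ℝ × ℝ := L.toAffineMap + AffineMap.const ℝ _ (toReal p)
  have hf : ∀ x, f x = L x + toReal p := fun x => rfl
  have e : hull {p, q, r} = f '' convexHull ℝ ({(0, 0), (1, 0), (0, 1)} : Set (ℝ × ℝ)) := by
    rw [AffineMap.image_convexHull, hull]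
    congr 1
    simp only [Set.image_insert_eq, Set.image_singleton]
    congr 1
    · ext <;> simp [hf, hL]
    · congr 1
      · ext <;> simp [hf, hL]
      · congr 1; ext <;> simp [hf, hL]
  have e2 : hull {p, q, r} = (fun x => x + toReal p) ''
      (L '' convexHull ℝ ({(0, 0), (1, 0), (0, 1)} : Set (ℝ × ℝ))) := by
    rw [e, Set.image_image]; rfl
  rw [area, Measure.real, e2, Set.image_add_right, measure_preimage_add_right,
    Measure.addHaar_image_linearMap, volume_convexHull_unit, LinearMap.det_toLin,
    Matrix.det_fin_two_of, ENNReal.toReal_mul, ENNReal.toReal_ofReal (abs_nonneg _),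
    ENNReal.toReal_ofReal (by norm_num)]
  rw [det3]; push_cast
  ring_nf

lemma area_pair (p q : ℤ × ℤ) : area (hull {p, q}) = 0 := by
  refine area_eq_zero_of_collinear (collinear_convexHull ?_)
  rw [Set.image_pair]
  exact collinear_pair ℝ _ _

lemma IsPrim.area_eq {A : Finset (ℤ × ℤ)} (hA : IsPrim A) : area (hull A) = 1 := by
  obtain ⟨p, q, r, rfl, hd⟩ := hA
  have : ((({p, q, r} : Finset (ℤ × ℤ)) : Set (ℤ × ℤ))) = {p, q, r} := by simp
  rw [this, area_triangle]
  exact_mod_cast hd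

/-- Membership in a dilated standard triangle. -/
lemma mem_hull_std {a : ℤ × ℤ} {n : ℤ} (hn : 0 < n) {x : ℝ × ℝ} :
    x ∈ hull {a, a + (n, 0), a + (0, n)} ↔
      (a.1 : ℝ) ≤ x.1 ∧ (a.2 : ℝ) ≤ x.2 ∧ x.1 + x.2 ≤ a.1 + a.2 + n := by
  have hnR : (0 : ℝ) < n := by exact_mod_cast hn
  constructor
  · intro hx
    refine ⟨?_, ?_, ?_⟩
    · have := le_hull (m := 1) (n := 0) (c := a.1) (by
        rintro i (rfl | rfl | rfl) <;> simp <;> linarith) hx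
      linarith
    · have := le_hull (m := 0) (n := 1) (c := a.2) (by
        rintro i (rfl | rfl | rfl) <;> simp <;> linarith) hx
      linarith
    · have := hull_le (m := 1) (n := 1) (c := a.1 + a.2 + n) (by
        rintro i (rfl | rfl | rfl) <;> simp <;> linarith) hx
      linarith
  · rintro ⟨h1, h2, h3⟩
    have hc := convex_convexHull ℝ (toReal '' ({a, a + (n, 0), a + (0, n)} : Set (ℤ × ℤ)))
    have := hc.sum_mem (t := Finset.univ)
      (w := ![(a.1 + a.2 + n - x.1 - x.2) / n, (x.1 - a.1) / n, (x.2 - a.2) / n])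
      (z := ![toReal a, toReal (a + (n, 0)), toReal (a + (0, n))])
      (by
        intro i _
        fin_cases i <;> simp
        · exact div_nonneg (by linarith) hnR.le
        · exact div_nonneg (by linarith) hnR.le
        · exact div_nonneg (by linarith) hnR.le)
      (by simp [Fin.sum_univ_three]; field_simp; ring)
      (by intro i _; apply subset_convexHull; fin_cases i <;> simp [Set.image_insert_eq])
    rw [hull]
    convert this using 1
    ext <;> simp [Fin.sum_univ_three] <;> field_simp <;> ring

/-! ### Active monomials of a tropical product -/

namespace TropPoly

variable {P Q : TropPoly}

/-- Finiteness ensures that the supremum defining a coefficient of the product is an upper bound and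
is attained. -/
lemma mul_coeff_aux (P Q : TropPoly) (k : ℤ × ℤ) :
    {s | ∃ i ∈ P.support, ∃ j ∈ Q.support, i + j = k ∧ s = P.coeff i + Q.coeff j}.Finite := by
  refine ((P.support ×ˢ Q.support).finite_toSet.image
    (fun ij => P.coeff ij.1 + Q.coeff ij.2)).subset ?_
  rintro s ⟨i, hi, j, hj, -, rfl⟩
  exact ⟨(i, j), by simp [hi, hj], rfl⟩

lemma term_add_term_le {i j : ℤ × ℤ} (hi : i ∈ P.support) (hj : j ∈ Q.support) (x : ℝ × ℝ) :
    P.term i x + Q.term j x ≤ (P.mul Q).term (i + j) x := by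
  have : P.coeff i + Q.coeff j ≤ (P.mul Q).coeff (i + j) :=
    le_csSup (mul_coeff_aux P Q (i + j)).bddAbove ⟨i, hi, j, hj, rfl, rfl⟩
  simp only [term_eq, pair, Prod.fst_add, Prod.snd_add]
  push_cast
  linarith

lemma exists_term_mul {k : ℤ × ℤ} (hk : k ∈ (P.mul Q).support) :
    ∃ i ∈ P.support, ∃ j ∈ Q.support, i + j = k ∧
      ∀ x, (P.mul Q).term k x = P.term i x + Q.term j x := by
  obtain ⟨i, hi, j, hj, rfl⟩ := Finset.mem_add.1 hk
  obtain ⟨i', hi', j', hj', e, hs⟩ := Set.Nonempty.csSup_mem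
    (s := {s | ∃ i' ∈ P.support, ∃ j' ∈ Q.support, i' + j' = i + j ∧
      s = P.coeff i' + Q.coeff j'}) ⟨_, i, hi, j, hj, rfl, rfl⟩ (mul_coeff_aux P Q (i + j))
  refine ⟨i', hi', j', hj', e, fun x => ?_⟩
  have : (P.mul Q).coeff (i + j) = P.coeff i' + Q.coeff j' := hs
  rw [← e] at this ⊢
  simp only [term_eq, pair, Prod.fst_add, Prod.snd_add, this]
  push_cast
  ring

/-- The maximum of the product is the sum of the two maxima, reached exactly by sums of active
exponents. Cells of the product are thus Minkowski sums, which turns intersection multiplicities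
into areas of such sums. -/
lemma active_mul (P Q : TropPoly) (x : ℝ × ℝ) :
    (P.mul Q).active x = P.active x + Q.active x := by
  ext k
  constructor
  · intro hk
    obtain ⟨i, hi, j, hj, rfl, e⟩ := exists_term_mul (active_subset _ hk)
    obtain ⟨m, hm⟩ := P.active_nonempty x
    obtain ⟨n, hn⟩ := Q.active_nonempty x
    have h1 := term_add_term_le (active_subset _ hm) (active_subset _ hn) x
    have h2 := (mem_active.1 hk).2 (m + n)
      (Finset.add_mem_add (active_subset _ hm) (active_subset _ hn))
    have h3 := (mem_active.1 hm).2 i hi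
    have h4 := (mem_active.1 hn).2 j hj
    have h5 := e x
    exact Finset.add_mem_add (mem_active_of_term_eq hm hi (by linarith))
      (mem_active_of_term_eq hn hj (by linarith))
  · intro hk
    obtain ⟨i, hi, j, hj, rfl⟩ := Finset.mem_add.1 hk
    refine mem_active.2 ⟨Finset.add_mem_add (active_subset _ hi) (active_subset _ hj), ?_⟩
    intro s hs
    obtain ⟨i', hi', j', hj', -, e⟩ := exists_term_mul hs
    rw [e x]
    exact (add_le_add ((mem_active.1 hi).2 i' hi') ((mem_active.1 hj).2 j' hj')).trans
      (term_add_term_le (active_subset _ hi) (active_subset _ hj) x)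

end TropPoly
/-! ### The dual subdivision -/

namespace TropPoly

variable {P : TropPoly} {d : ℕ}

lemma mem_stdTriangle (hd : 0 < d) {x : ℝ × ℝ} :
    x ∈ stdTriangle d ↔ 0 ≤ x.1 ∧ 0 ≤ x.2 ∧ x.1 + x.2 ≤ d := by
  have := mem_hull_std (a := (0, 0)) (n := (d : ℤ)) (by exact_mod_cast hd) (x := x)
  simpa [stdTriangle] using this

lemma support_bounds (hd : 0 < d) (hN : P.newtonPolygon = stdTriangle d) {i : ℤ × ℤ}
    (hi : i ∈ P.support) : 0 ≤ i.1 ∧ 0 ≤ i.2 ∧ i.1 + i.2 ≤ d := by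
  have h : toReal i ∈ P.newtonPolygon := toReal_mem_hull hi
  rw [hN, mem_stdTriangle hd] at h
  simp only [toReal_fst, toReal_snd] at h
  exact_mod_cast h

/-- If a corner of T_d were not an exponent, all exponents would by integrality stay at distance one
from it in a suitable form, and their hull would miss the corner. -/
lemma corner_mem_support (hd : 0 < d) (hN : P.newtonPolygon = stdTriangle d) :
    (0, 0) ∈ P.support ∧ ((d : ℤ), 0) ∈ P.support ∧ (0, (d : ℤ)) ∈ P.support := by
  have hdR : (0 : ℝ) < d := by exact_mod_cast hd
  have mem : ∀ x : ℝ × ℝ, 0 ≤ x.1 ∧ 0 ≤ x.2 ∧ x.1 + x.2 ≤ d → x ∈ hull (P.support : Set (ℤ × ℤ)) :=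
    fun x hx => by
      have := (mem_stdTriangle hd).2 hx
      rwa [← hN] at this
  refine ⟨?_, ?_, ?_⟩ <;> by_contra hn
  · have := le_hull (m := 1) (n := 1) (c := 1) (fun i hi => ?_) (mem (0, 0) (by simp))
    · norm_num at this
    · have hb := support_bounds hd hN hi
      have : 1 ≤ i.1 + i.2 := by
        by_contra! hlt
        exact hn ((show i = (0, 0) from Prod.ext (by simp; omega) (by simp; omega)) ▸ Finset.mem_coe.1 hi)
      simp only [one_mul]
      exact_mod_cast this
  · have := hull_le (m := 1) (n := 0) (c := d - 1) (fun i hi => ?_) (mem (d, 0) (by simp))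
    · norm_num at this
    · have hb := support_bounds hd hN hi
      have : i.1 ≤ d - 1 := by
        by_contra! hlt
        exact hn ((show i = ((d : ℤ), 0) from Prod.ext (by simp; omega) (by simp; omega)) ▸ Finset.mem_coe.1 hi)
      simp only [one_mul, zero_mul, add_zero]
      exact_mod_cast this
  · have := hull_le (m := 0) (n := 1) (c := d - 1) (fun i hi => ?_) (mem (0, d) (by simp))
    · norm_num at this
    · have hb := support_bounds hd hN hi
      have : i.2 ≤ d - 1 := by
        by_contra! hlt
        exact hn ((show i = (0, (d : ℤ)) from Prod.ext (by simp; omega) (by simp; omega)) ▸ Finset.mem_coe.1 hi)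
      simp only [one_mul, zero_mul, zero_add]
      exact_mod_cast this

/-- For z in the interior of the Newton polygon, P minus the linear form z is coercive: the
monomials at the three corners already bound its sublevel sets. So it has a minimum. -/
lemma exists_forall_eval_sub_le (hd : 0 < d) (hN : P.newtonPolygon = stdTriangle d) {z : ℝ × ℝ}
    (h1 : 0 < z.1) (h2 : 0 < z.2) (h3 : z.1 + z.2 < d) :
    ∃ x, ∀ y, P.eval x - (z.1 * x.1 + z.2 * x.2) ≤ P.eval y - (z.1 * y.1 + z.2 * y.2) := by
  have hdR : (0 : ℝ) < d := by exact_mod_cast hd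
  obtain ⟨c0, c1, c2⟩ := corner_mem_support hd hN
  let f : ℝ × ℝ → ℝ := fun y => P.eval y - (z.1 * y.1 + z.2 * y.2)
  have hf : Continuous f := by
    have := P.continuous_eval
    fun_prop
  let M := f 0
  -- On the sublevel set, d * y.1 + coeff (d, 0) ≤ M + ⟨z, y⟩, and similarly for y.2. Adding these
  -- with weights z.1 and z.2 gives (d - z.1 - z.2) ⟨z, y⟩ ≤ the numerator, so U bounds ⟨z, y⟩. Then
  -- u1, u2 bound y.1, y.2 above, and the constant monomial gives the lower bounds w1, w2.
  let U := (z.1 * (M - P.coeff (d, 0)) + z.2 * (M - P.coeff (0, d))) / (d - z.1 - z.2)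
  let u1 := (M - P.coeff (d, 0) + U) / d
  let u2 := (M - P.coeff (0, d) + U) / d
  let w1 := (P.coeff (0, 0) - M - z.2 * u2) / z.1
  let w2 := (P.coeff (0, 0) - M - z.1 * u1) / z.2
  have hbd : {y | f y ≤ M} ⊆ Set.Icc (w1, w2) (u1, u2) := by
    intro y hy
    have hy' : P.eval y - (z.1 * y.1 + z.2 * y.2) ≤ M := hy
    have e0 := term_le_eval c0 y
    have e1 := term_le_eval c1 y
    have e2 := term_le_eval c2 y
    simp only [term] at e0 e1 e2
    push_cast at e0 e1 e2
    have hU : z.1 * y.1 + z.2 * y.2 ≤ U := by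
      rw [le_div_iff₀ (by linarith)]
      nlinarith [mul_le_mul_of_nonneg_left e1 h1.le, mul_le_mul_of_nonneg_left e2 h2.le,
        mul_le_mul_of_nonneg_left hy' h1.le, mul_le_mul_of_nonneg_left hy' h2.le]
    have hu1 : y.1 ≤ u1 := by rw [le_div_iff₀ hdR]; linarith
    have hu2 : y.2 ≤ u2 := by rw [le_div_iff₀ hdR]; linarith
    have hw1 : w1 ≤ y.1 := by
      rw [div_le_iff₀ h1]; nlinarith [mul_le_mul_of_nonneg_left hu2 h2.le]
    have hw2 : w2 ≤ y.2 := by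
      rw [div_le_iff₀ h2]; nlinarith [mul_le_mul_of_nonneg_left hu1 h1.le]
    exact ⟨⟨hw1, hw2⟩, hu1, hu2⟩
  have hK : IsCompact {y | f y ≤ M} :=
    isCompact_Icc.of_isClosed_subset (isClosed_le hf continuous_const) hbd
  obtain ⟨x, hx, hmin⟩ := hK.exists_isMinOn ⟨0, le_refl M⟩ hf.continuousOn
  refine ⟨x, fun y => ?_⟩
  rcases le_total (f y) M with hy | hy
  · exact hmin hy
  · exact le_trans hx hy

/-- If z were outside the cell, a linear form would separate them. Its gradient g is a direction in
which every active monomial has slope less than ⟨z, g⟩, so P minus the linear form z would decrease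
along g, against minimality. -/
lemma mem_dualCell_of_forall_le {x z : ℝ × ℝ}
    (h : ∀ y, P.eval x - (z.1 * x.1 + z.2 * x.2) ≤ P.eval y - (z.1 * y.1 + z.2 * y.2)) :
    z ∈ P.dualCell x := by
  by_contra hz
  obtain ⟨f, u, hfu, huz⟩ := geometric_hahn_banach_closed_point (convex_convexHull ℝ _)
    (isCompact_hull (P.active x).finite_toSet).isClosed hz
  have hf : ∀ y : ℝ × ℝ, f y = y.1 * f (1, 0) + y.2 * f (0, 1) := by
    intro y
    have : y = y.1 • ((1, 0) : ℝ × ℝ) + y.2 • ((0, 1) : ℝ × ℝ) := by ext <;> simp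
    conv_lhs => rw [this]
    rw [map_add, map_smul, map_smul, smul_eq_mul, smul_eq_mul]
  let g : ℝ × ℝ := (f (1, 0), f (0, 1))
  obtain ⟨t, ht, ht0⟩ := ((P.eventually_active x g).and self_mem_nhdsWithin).exists
  have ht0 : 0 < t := ht0
  obtain ⟨m, hm⟩ := P.active_nonempty (x + t • g)
  have hmx := ((ht m).1 hm).1
  have h1 := h (x + t • g)
  rw [eval_eq_term hm, eval_eq_term hmx, term_add_smul] at h1
  have h2 := hfu _ (toReal_mem_hull (Finset.mem_coe.2 hmx))
  rw [hf] at h2 huz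
  simp only [toReal_fst, toReal_snd] at h2
  have h3 : pair m g < z.1 * g.1 + z.2 * g.2 := by simp only [pair, g]; linarith
  simp only [Prod.fst_add, Prod.snd_add, Prod.smul_fst, Prod.smul_snd, smul_eq_mul] at h1
  nlinarith

lemma dualCell_subset (x : ℝ × ℝ) : P.dualCell x ⊆ P.newtonPolygon :=
  hull_mono (Finset.coe_subset.2 (active_subset x))

/-- The triangles dual to the vertices cover the Newton polygon. -/
lemma exists_isVertex_mem_dualCell (hd : 0 < d) (hN : P.newtonPolygon = stdTriangle d)
    (hP : P.NonSingular) {z : ℝ × ℝ} (hz : z ∈ stdTriangle d) :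
    ∃ v, P.IsVertex v ∧ z ∈ P.dualCell v := by
  have hdR : (0 : ℝ) < d := by exact_mod_cast hd
  let U : Set (ℝ × ℝ) := ⋃ v ∈ {v | P.IsVertex v}, P.dualCell v
  have hU : IsClosed U := (finite_setOf_isVertex hP).isClosed_biUnion fun v _ =>
    (isCompact_hull (P.active v).finite_toSet).isClosed
  let O : Set (ℝ × ℝ) := {z | 0 < z.1 ∧ 0 < z.2 ∧ z.1 + z.2 < d}
  have hO : IsOpen O := (isOpen_lt continuous_const continuous_fst).inter
    ((isOpen_lt continuous_const continuous_snd).inter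
      (isOpen_lt (continuous_fst.add continuous_snd) continuous_const))
  -- The hulls of collinear sets of exponents are finitely many null sets. They absorb those z whose
  -- minimiser is not a vertex.
  let N : Set (ℝ × ℝ) := ⋃ S ∈ {S | S ∈ P.support.powerset ∧
    Collinear ℝ (toReal '' (S : Set (ℤ × ℤ)))}, hull (S : Set (ℤ × ℤ))
  have hNull : volume N = 0 := by
    refine (measure_biUnion_null_iff ?_).2 fun S hS =>
      volume_eq_zero_of_collinear (collinear_convexHull hS.2)
    exact (P.support.powerset.finite_toSet.subset fun S hS => hS.1).countable
  have hON : O \ U ⊆ N := by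
    rintro z ⟨⟨h1, h2, h3⟩, hzU⟩
    obtain ⟨x, hx⟩ := exists_forall_eval_sub_le hd hN h1 h2 h3
    have hzx := mem_dualCell_of_forall_le hx
    by_cases hv : P.IsVertex x
    · exact absurd (Set.mem_biUnion (show x ∈ {v | P.IsVertex v} from hv) hzx) hzU
    · exact Set.mem_biUnion (show P.active x ∈ {S | S ∈ P.support.powerset ∧
        Collinear ℝ (toReal '' (S : Set (ℤ × ℤ)))} from
        ⟨Finset.mem_powerset.2 (active_subset x), not_not.1 hv⟩) hzx
  -- An open null set is empty.
  have hempty : O \ U = ∅ :=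
    (hO.sdiff hU).eq_empty_of_measure_zero (measure_mono_null hON hNull)
  have hOU : O ⊆ U := Set.sdiff_eq_empty.1 hempty
  -- A boundary point is a limit of interior ones along the segment towards (d/3, d/3), and U is
  -- closed.
  have hzU : z ∈ U := by
    obtain ⟨h1, h2, h3⟩ := (mem_stdTriangle hd).1 hz
    let γ : ℝ → ℝ × ℝ := fun t => ((1 - t) * z.1 + t * (d / 3), (1 - t) * z.2 + t * (d / 3))
    have hγ : Filter.Tendsto γ (nhdsWithin 0 (Set.Ioi 0)) (nhds z) := by
      have : Continuous γ := by fun_prop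
      have h0 := (this.tendsto 0).mono_left (nhdsWithin_le_nhds (s := Set.Ioi 0))
      simpa [γ] using h0
    refine hU.mem_of_tendsto hγ ?_
    filter_upwards [Ioo_mem_nhdsGT (one_pos : (0 : ℝ) < 1)] with t ht
    refine hOU ⟨?_, ?_, ?_⟩
    · change 0 < (1 - t) * z.1 + t * (d / 3)
      have := mul_nonneg (sub_nonneg.2 ht.2.le) h1
      have := mul_pos ht.1 hdR
      linarith
    · change 0 < (1 - t) * z.2 + t * (d / 3)
      have := mul_nonneg (sub_nonneg.2 ht.2.le) h2
      have := mul_pos ht.1 hdR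
      linarith
    · change (1 - t) * z.1 + t * (d / 3) + ((1 - t) * z.2 + t * (d / 3)) < d
      have := mul_le_mul_of_nonneg_left h3 (sub_nonneg.2 ht.2.le)
      have := mul_pos ht.1 hdR
      linarith
  obtain ⟨v, hv, h⟩ := Set.mem_iUnion₂.1 hzU
  exact ⟨v, hv, h⟩

/-- Triangles dual to different vertices only meet in a line. -/
lemma aedisjoint_dualCell (hP : P.NonSingular) {v w : ℝ × ℝ} (hv : P.IsVertex v)
    (hvw : v ≠ w) : AEDisjoint volume (P.dualCell v) (P.dualCell w) := by
  obtain ⟨p, q, r, e, hdet⟩ := IsVertex.isPrim hP hv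
  have hne : v.1 - w.1 ≠ 0 ∨ v.2 - w.2 ≠ 0 := by
    by_contra! h
    exact hvw (Prod.ext (sub_eq_zero.1 h.1) (sub_eq_zero.1 h.2))
  -- Comparing values at v and w, an exponent i active at v satisfies ⟨i, v - w⟩ ≥ P(v) - P(w), and
  -- one active at w the opposite inequality. The triangles thus lie on different sides of a line.
  refine volume_eq_zero_of_collinear (collinear_of_line (m := v.1 - w.1) (n := v.2 - w.2)
    (c := P.eval v - P.eval w) hne ?_)
  rintro x ⟨hx, hx'⟩
  refine le_antisymm (hull_le (fun i hi => ?_) hx') (le_hull (fun i hi => ?_) hx)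
  · have h1 := term_le_eval (active_subset _ hi) v
    rw [eval_eq_term (Finset.mem_coe.1 hi)]
    simp only [term_eq, pair] at *
    linarith
  · have h1 := term_le_eval (active_subset _ hi) w
    rw [eval_eq_term (Finset.mem_coe.1 hi)]
    simp only [term_eq, pair] at *
    linarith

/-- A non-singular curve of degree `d` has `d²` vertices. -/
lemma card_vertices (hd : 0 < d) (hN : P.newtonPolygon = stdTriangle d) (hP : P.NonSingular) :
    (finite_setOf_isVertex hP).toFinset.card = d ^ 2 := by
  have hT : stdTriangle d = ⋃ v ∈ (finite_setOf_isVertex hP).toFinset, P.dualCell v := by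
    refine Set.Subset.antisymm (fun z hz => ?_) (Set.iUnion₂_subset fun v _ => ?_)
    · obtain ⟨v, hv, h⟩ := exists_isVertex_mem_dualCell hd hN hP hz
      exact Set.mem_biUnion (show v ∈ ((finite_setOf_isVertex hP).toFinset : Set (ℝ × ℝ)) by
        simpa using hv) h
    · exact hN ▸ dualCell_subset v
  have harea : area (stdTriangle d) = (d : ℝ) ^ 2 := by
    rw [stdTriangle, area_triangle]
    simp [det3, sq]
  have hsum : area (stdTriangle d) =
      ∑ v ∈ (finite_setOf_isVertex hP).toFinset, area (P.dualCell v) := by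
    unfold area
    rw [← Finset.mul_sum, ← measureReal_biUnion_finset₀ (f := P.dualCell) ?_
      (fun v _ => (isCompact_hull (P.active v).finite_toSet).measurableSet.nullMeasurableSet)
      (fun v _ => volume_hull_ne_top (P.active v).finite_toSet), ← hT]
    intro v hv w hw hvw
    exact aedisjoint_dualCell hP (by simpa using hv) hvw
  have hone : ∀ v ∈ (finite_setOf_isVertex hP).toFinset, area (P.dualCell v) = 1 := fun v hv =>
    (IsVertex.isPrim hP (show P.IsVertex v by simpa using hv)).area_eq
  rw [harea, Finset.sum_congr rfl hone] at hsum
  simp only [Finset.sum_const, nsmul_eq_mul, mul_one] at hsum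
  exact_mod_cast hsum.symm

end TropPoly
/-! ### Classification of primitive triangles -/

/-- The vertices of a translate of `T_1`. -/
def unitAt (a : ℤ × ℤ) : Finset (ℤ × ℤ) := {a, a + (1, 0), a + (0, 1)}

/-- The points of `A` lie in a translate of `T_2`, away from two of its corners. -/
def Narrow (A : Finset (ℤ × ℤ)) : Prop :=
  ∃ a : ℤ × ℤ, (∀ i ∈ A, a.1 ≤ i.1 ∧ a.2 ≤ i.2 ∧ i.1 + i.2 ≤ a.1 + a.2 + 2) ∧
    ∃ j j' : Fin 3, j ≠ j' ∧ (∀ i ∈ A, phi j i ≤ phi j a - ![0, 0, 2] j + 1) ∧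
      ∀ i ∈ A, phi j' i ≤ phi j' a - ![0, 0, 2] j' + 1

/-- One edge is of each of the two kinds. -/
def Mixed (A : Finset (ℤ × ℤ)) : Prop :=
  (∃ k, ∀ j, MaxEdge A j ↔ j = k) ∧ (∃ k, ∀ j, MinEdge A j ↔ j = k) ∧
    ∃ j, ∃ p ∈ A, ∃ q ∈ A, phi j q - phi j p = 2

/-- One of the three forms has large variation, and there is at most one edge of either kind. -/
def Wide (A : Finset (ℤ × ℤ)) : Prop :=
  (∃ j, ∃ p ∈ A, ∃ q ∈ A, 3 ≤ phi j q - phi j p) ∧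
    ∀ k k', (MinEdge A k ∨ MaxEdge A k) → (MinEdge A k' ∨ MaxEdge A k') → k = k'

lemma abs_le_one_of_mul {x y : ℤ} (h : |x * y| = 1) : |x| ≤ 1 ∧ |y| ≤ 1 := by
  have hu : IsUnit (x * y) := Int.isUnit_iff_abs_eq.2 h
  exact ⟨(Int.isUnit_iff_abs_eq.1 (isUnit_of_mul_isUnit_left hu)).le,
    (Int.isUnit_iff_abs_eq.1 (isUnit_of_mul_isUnit_right hu)).le⟩

/-- When both edges at c are parallel to edges of T_1 of different directions, the determinant is,
up to sign, the product of their lattice lengths. Both lengths are therefore 1, and each form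
changes by at most 1 along such an edge. -/
lemma abs_phi_le_one {k k' : Fin 3} (hk : k ≠ k') {c a b : ℤ × ℤ} (h : phi k c = phi k a)
    (h' : phi k' c = phi k' b) (hd : |det3 c a b| = 1) (j : Fin 3) :
    |phi j a - phi j c| ≤ 1 ∧ |phi j b - phi j c| ≤ 1 := by
  obtain ⟨c1, c2⟩ := c
  obtain ⟨a1, a2⟩ := a
  obtain ⟨b1, b2⟩ := b
  simp only [det3] at hd
  have fin : ∀ x y : ℤ, |x * y| = 1 → (-1 ≤ x ∧ x ≤ 1) ∧ (-1 ≤ y ∧ y ≤ 1) := fun x y h =>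
    ⟨abs_le.1 (abs_le_one_of_mul h).1, abs_le.1 (abs_le_one_of_mul h).2⟩
  rw [abs_le, abs_le]
  fin_cases k <;> fin_cases k' <;> simp [phi] at h h' hk
  · have := fin (a2 - c2) (b1 - c1) (by
      rw [← hd, ← abs_neg]; congr 1; rw [h, h']; ring)
    fin_cases j <;> simp [phi] <;> omega
  · have e : b2 - c2 = -(b1 - c1) := by linarith
    have := fin (a2 - c2) (b1 - c1) (by
      rw [← hd, ← abs_neg]; congr 1; rw [e, h]; ring)
    fin_cases j <;> simp [phi] <;> omega
  · have := fin (a1 - c1) (b2 - c2) (by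
      rw [← hd]; congr 1; rw [h, h']; ring)
    fin_cases j <;> simp [phi] <;> omega
  · have e : b2 - c2 = -(b1 - c1) := by linarith
    have := fin (a1 - c1) (b1 - c1) (by
      rw [← hd, ← abs_neg]; congr 1; rw [e, h]; ring)
    fin_cases j <;> simp [phi] <;> omega
  · have e : a2 - c2 = -(a1 - c1) := by linarith
    have := fin (a1 - c1) (b2 - c2) (by
      rw [← hd]; congr 1; rw [e, h']; ring)
    fin_cases j <;> simp [phi] <;> omega
  · have e : a2 - c2 = -(a1 - c1) := by linarith
    have := fin (a1 - c1) (b1 - c1) (by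
      rw [← hd]; congr 1; rw [e, h']; ring)
    fin_cases j <;> simp [phi] <;> omega

/-- Two different edges of a triangle share a vertex c: if one of them is pq, the other contains the
third vertex r. Both other vertices differ from c by at most 1 in every form, hence from each other
by at most 2. -/
lemma phi_sub_le_two {A : Finset (ℤ × ℤ)} (hA : IsPrim A) {k k' : Fin 3} (hk : k ≠ k')
    (h : ∃ p ∈ A, ∃ q ∈ A, p ≠ q ∧ phi k p = phi k q)
    (h' : ∃ p ∈ A, ∃ q ∈ A, p ≠ q ∧ phi k' p = phi k' q) (j : Fin 3) :
    ∀ p ∈ A, ∀ q ∈ A, phi j q - phi j p ≤ 2 := by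
  have main : ∀ c a b : ℤ × ℤ, A = {c, a, b} → |det3 c a b| = 1 → phi k c = phi k a →
      phi k' c = phi k' b → ∀ p ∈ A, ∀ q ∈ A, phi j q - phi j p ≤ 2 := by
    rintro c a b rfl hd h1 h2 p hp q hq
    have := abs_phi_le_one hk h1 h2 hd j
    rw [abs_le, abs_le] at this
    simp only [Finset.mem_insert, Finset.mem_singleton] at hp hq
    rcases hp with rfl | rfl | rfl <;> rcases hq with rfl | rfl | rfl <;> omega
  obtain ⟨p, hp, q, hq, hpq, e⟩ := h
  obtain ⟨p', hp', q', hq', hpq', e'⟩ := h'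
  obtain ⟨r, hr, hd⟩ := hA.exists_third hp hq hpq
  have main' : ∀ s ∈ A, s ≠ r → phi k' s = phi k' r → ∀ p ∈ A, ∀ q ∈ A, phi j q - phi j p ≤ 2 := by
    intro s hs hsr hsk
    rw [hr] at hs
    simp only [Finset.mem_insert, Finset.mem_singleton] at hs
    rcases hs with rfl | rfl | rfl
    · exact main _ _ _ hr hd e hsk
    · exact main s p r (by rw [hr, Finset.insert_comm]) (by rw [IsPrim.swap, abs_neg, hd])
        e.symm hsk
    · exact absurd rfl hsr
  by_cases h1 : p' = r
  · subst h1; exact main' q' hq' hpq'.symm e'.symm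
  by_cases h2 : q' = r
  · subst h2; exact main' p' hp' hpq' e'
  exfalso
  rw [hr] at hp' hq'
  simp only [Finset.mem_insert, Finset.mem_singleton, h1, h2, or_false] at hp' hq'
  rcases hp' with rfl | rfl <;> rcases hq' with rfl | rfl
  · exact hpq' rfl
  · exact hpq (eq_of_phi_eq hk e e')
  · exact hpq (eq_of_phi_eq hk e e'.symm)
  · exact hpq' rfl

-- A finite check. With one vertex at the origin and all forms varying by at most 2, the other
-- vertices (x, y) and (z, w) have coordinates between -2 and 2. The translate of T_2 must contain
-- the origin, so its corner (a, b) has coordinates between -2 and 0.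
set_option maxRecDepth 100000 in
set_option synthInstance.maxHeartbeats 400000 in
set_option synthInstance.maxSize 4000 in
lemma classify_aux : ∀ x ∈ ([-2, -1, 0, 1, 2] : List ℤ), ∀ y ∈ ([-2, -1, 0, 1, 2] : List ℤ),
    ∀ z ∈ ([-2, -1, 0, 1, 2] : List ℤ), ∀ w ∈ ([-2, -1, 0, 1, 2] : List ℤ),
    (x * w - y * z = 1 ∨ x * w - y * z = -1) →
    (-2 ≤ x + y ∧ x + y ≤ 2) → (-2 ≤ z + w ∧ z + w ≤ 2) → (-2 ≤ x - z ∧ x - z ≤ 2) →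
    (-2 ≤ y - w ∧ y - w ≤ 2) → (-2 ≤ (x + y) - (z + w) ∧ (x + y) - (z + w) ≤ 2) →
    (∃ a ∈ ({(0, 0), (x, y), (z, w)} : Finset (ℤ × ℤ)),
      ({(0, 0), (x, y), (z, w)} : Finset (ℤ × ℤ)) = {a, a + (1, 0), a + (0, 1)}) ∨
    (((∀ k, MaxEdge {(0, 0), (x, y), (z, w)} k ∧ ¬ MinEdge {(0, 0), (x, y), (z, w)} k) ∨
        ((∃ k, ∀ j, MaxEdge {(0, 0), (x, y), (z, w)} j ↔ j = k) ∧
          (∃ k, ∀ j, MinEdge {(0, 0), (x, y), (z, w)} j ↔ j = k) ∧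
          ∃ j, ∃ p ∈ ({(0, 0), (x, y), (z, w)} : Finset (ℤ × ℤ)),
            ∃ q ∈ ({(0, 0), (x, y), (z, w)} : Finset (ℤ × ℤ)), phi j q - phi j p = 2)) ∧
      ∃ a ∈ ([-2, -1, 0] : List ℤ), ∃ b ∈ ([-2, -1, 0] : List ℤ),
        (∀ i ∈ ({(0, 0), (x, y), (z, w)} : Finset (ℤ × ℤ)),
          a ≤ i.1 ∧ b ≤ i.2 ∧ i.1 + i.2 ≤ a + b + 2) ∧
        ∃ j j' : Fin 3, j ≠ j' ∧
          (∀ i ∈ ({(0, 0), (x, y), (z, w)} : Finset (ℤ × ℤ)),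
            phi j i ≤ phi j (a, b) - ![0, 0, 2] j + 1) ∧
          ∀ i ∈ ({(0, 0), (x, y), (z, w)} : Finset (ℤ × ℤ)),
            phi j' i ≤ phi j' (a, b) - ![0, 0, 2] j' + 1) := by
  decide +kernel

lemma minEdge_image {A : Finset (ℤ × ℤ)} (c : ℤ × ℤ) {k : Fin 3} :
    MinEdge (A.image (c + ·)) k ↔ MinEdge A k := by
  simp only [MinEdge, Finset.exists_mem_image, Finset.forall_mem_image, phi_add, ne_eq,
    add_right_inj, add_le_add_iff_left]

lemma maxEdge_image {A : Finset (ℤ × ℤ)} (c : ℤ × ℤ) {k : Fin 3} :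
    MaxEdge (A.image (c + ·)) k ↔ MaxEdge A k := by
  simp only [MaxEdge, Finset.exists_mem_image, Finset.forall_mem_image, phi_add, ne_eq,
    add_right_inj, add_le_add_iff_left]

/-- A primitive triangle is a translate of `T_1` or of `-T_1`, or has one edge of each kind, or is
wide. -/
lemma IsPrim.classify {A : Finset (ℤ × ℤ)} (hA : IsPrim A) :
    (∃ a, A = unitAt a) ∨ ((∀ k, MaxEdge A k ∧ ¬ MinEdge A k) ∧ Narrow A) ∨
      (Mixed A ∧ Narrow A) ∨ Wide A := by
  by_cases hw : ∃ j, ∃ p ∈ A, ∃ q ∈ A, 3 ≤ phi j q - phi j p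
  -- By `phi_sub_le_two`, a variation of at least 3 excludes two edges in different directions of
  -- T_1.
  · refine Or.inr (Or.inr (Or.inr ⟨hw, fun k k' hk hk' => ?_⟩))
    by_contra hne
    have aux : ∀ k, (MinEdge A k ∨ MaxEdge A k) → ∃ p ∈ A, ∃ q ∈ A, p ≠ q ∧ phi k p = phi k q := by
      rintro k (⟨p, hp, q, hq, h1, h2, -⟩ | ⟨p, hp, q, hq, h1, h2, -⟩) <;>
        exact ⟨p, hp, q, hq, h1, h2⟩
    obtain ⟨j, p, hp, q, hq, h3⟩ := hw
    linarith [phi_sub_le_two hA hne (aux k hk) (aux k' hk') j p hp q hq]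
  push Not at hw
  obtain ⟨c, q, r, rfl, hd⟩ := hA
  obtain ⟨⟨x, y⟩, rfl⟩ : ∃ u, q = c + u := ⟨q - c, by abel⟩
  obtain ⟨⟨z, w⟩, rfl⟩ : ∃ u, r = c + u := ⟨r - c, by abel⟩
  have hw' : ∀ j, ∀ p ∈ ({(0, 0), (x, y), (z, w)} : Finset (ℤ × ℤ)),
      ∀ q ∈ ({(0, 0), (x, y), (z, w)} : Finset (ℤ × ℤ)), phi j q - phi j p < 3 := by
    intro j p hp q hq
    have := hw j (c + p) (by simp at hp ⊢; rcases hp with rfl | rfl | rfl <;> simp)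
      (c + q) (by simp at hq ⊢; rcases hq with rfl | rfl | rfl <;> simp)
    rw [phi_add, phi_add] at this
    linarith
  have hset : ({c, c + (x, y), c + (z, w)} : Finset (ℤ × ℤ)) =
      Finset.image (c + ·) {(0, 0), (x, y), (z, w)} := by
    simp [Finset.image_insert, show ((0, 0) : ℤ × ℤ) = 0 from rfl]
  simp only [Finset.mem_insert, Finset.mem_singleton, forall_eq_or_imp, forall_eq] at hw'
  have w0 := hw' 0
  have w1 := hw' 1
  have w2 := hw' 2
  simp only [phi] at w0 w1 w2
  simp at w0 w1 w2
  have mem : ∀ t : ℤ, -2 ≤ t → t ≤ 2 → t ∈ ([-2, -1, 0, 1, 2] : List ℤ) := by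
    intro t h1 h2; interval_cases t <;> simp
  have hd' : x * w - y * z = 1 ∨ x * w - y * z = -1 := by
    have := (abs_eq one_pos.le).1 hd
    simp [det3] at this
    exact this
  rw [hset]
  rcases classify_aux x (mem x (by omega) (by omega)) y (mem y (by omega) (by omega))
    z (mem z (by omega) (by omega)) w (mem w (by omega) (by omega)) hd' (by omega) (by omega)
    (by omega) (by omega) (by omega) with ⟨a, -, ha⟩ | ⟨h, a, -, b, -, hN⟩
  · left
    refine ⟨c + a, ?_⟩
    rw [ha]
    simp [Finset.image_insert, unitAt, add_assoc]
  · right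
    have hnar : Narrow (Finset.image (c + ·) {(0, 0), (x, y), (z, w)}) := by
      obtain ⟨hN1, j, j', hj, h1, h2⟩ := hN
      refine ⟨c + (a, b), ?_, j, j', hj, ?_, ?_⟩
      · intro i hi
        obtain ⟨i', hi', rfl⟩ := Finset.mem_image.1 hi
        have := hN1 i' hi'
        simp only [Prod.fst_add, Prod.snd_add]
        omega
      · intro i hi
        obtain ⟨i', hi', rfl⟩ := Finset.mem_image.1 hi
        have := h1 i' hi'
        rw [phi_add, phi_add]
        omega
      · intro i hi
        obtain ⟨i', hi', rfl⟩ := Finset.mem_image.1 hi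
        have := h2 i' hi'
        rw [phi_add, phi_add]
        omega
    rcases h with h | ⟨h1, h2, j, p, hp, q, hq, h3⟩
    · exact Or.inl ⟨fun k => by rw [maxEdge_image, minEdge_image]; exact h k, hnar⟩
    · refine Or.inr (Or.inl ⟨⟨?_, ?_, j, c + p, Finset.mem_image_of_mem _ hp, c + q,
        Finset.mem_image_of_mem _ hq, ?_⟩, hnar⟩)
      · simpa only [maxEdge_image] using h1
      · simpa only [minEdge_image] using h2
      · rw [phi_add, phi_add]; linarith

lemma unitAt_edges (a : ℤ × ℤ) (k : Fin 3) : MinEdge (unitAt a) k ∧ ¬ MaxEdge (unitAt a) k := by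
  have e : unitAt a = Finset.image (a + ·) {(0, 0), (1, 0), (0, 1)} := by
    simp [Finset.image_insert, unitAt, show ((0, 0) : ℤ × ℤ) = 0 from rfl]
  rw [e, minEdge_image, maxEdge_image]
  revert k
  decide

/-! ### Areas of Minkowski sums -/

/-- The determinant of two lattice vectors. -/
def cross (u w : ℤ × ℤ) : ℤ := u.1 * w.2 - u.2 * w.1

lemma det3_add (p u w : ℤ × ℤ) : det3 p (p + u) (p + w) = cross u w := by
  simp [det3, cross]

lemma det3_translate (p q r t : ℤ × ℤ) : det3 (p + t) (q + t) (r + t) = det3 p q r := by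
  simp [det3]

/-- The diagonal through a + u and a + w separates two triangles of area |cross u w| each. Only this
lower bound is needed. -/
lemma two_mul_cross_le_area (a u w : ℤ × ℤ) (h : cross u w ≠ 0) :
    2 * |(cross u w : ℝ)| ≤ area (hull {a, a + u, a + w, a + w + u}) := by
  have key := area_add_le (A := {a, a + u, a + w}) (B := {a + u, a + w, a + w + u})
    (C := {a, a + u, a + w, a + w + u}) (Set.toFinite _) (Set.toFinite _) (Set.toFinite _)
    (hull_mono (by intro i; simp; tauto)) (hull_mono (by intro i; simp; tauto))
    (cross u w * (w.2 - u.2)) (-cross u w * (w.1 - u.1))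
    (cross u w * (w.2 - u.2) * (a + u).1 + -cross u w * (w.1 - u.1) * (a + u).2)
    (by
      by_contra! h0
      have h1 := (mul_eq_zero.1 h0.1).resolve_left h
      have h2 := (mul_eq_zero.1 h0.2).resolve_left (neg_ne_zero.2 h)
      apply h
      rw [cross, sub_eq_zero.1 h1, sub_eq_zero.1 h2]; ring)
    (by
      rintro i (rfl | rfl | rfl)
      · have := sq_nonneg (cross u w)
        simp only [cross, Prod.fst_add, Prod.snd_add] at *
        nlinarith
      · exact le_rfl
      · simp only [cross, Prod.fst_add, Prod.snd_add] at *
        nlinarith)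
    (by
      rintro i (rfl | rfl | rfl)
      · exact le_rfl
      · simp only [cross, Prod.fst_add, Prod.snd_add] at *
        nlinarith
      · have := sq_nonneg (cross u w)
        simp only [cross, Prod.fst_add, Prod.snd_add] at *
        nlinarith)
  rw [area_triangle, area_triangle, det3_add] at key
  have e : det3 (a + u) (a + w) (a + w + u) = -cross u w := by
    simp [det3, cross]; ring
  rw [e] at key
  push_cast at key
  rw [abs_neg] at key
  linarith

/-- The initial point of the edge of `T_1` on which `phi k` is minimal. -/
def edgeStart : Fin 3 → ℤ × ℤ := ![(0, 0), (1, 0), (0, 1)]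

/-- The direction of the edge of `T_1` on which `phi k` is minimal. -/
def edgeDir : Fin 3 → ℤ × ℤ := ![(0, 1), (-1, 0), (1, -1)]

lemma cross_edgeDir (k : Fin 3) (w : ℤ × ℤ) : cross w (edgeDir k) = phi k w := by
  fin_cases k <;> simp [cross, edgeDir, phi]
  ring

lemma lineEdge_eq (k : Fin 3) : lineEdge k = {edgeStart k, edgeStart k + edgeDir k} := by
  revert k; decide

lemma edge_mem_unit (k : Fin 3) : edgeStart k ∈ ({(1, 0), (0, 1), (0, 0)} : Finset (ℤ × ℤ)) ∧
    edgeStart k + edgeDir k ∈ ({(1, 0), (0, 1), (0, 0)} : Finset (ℤ × ℤ)) := by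
  revert k; decide

lemma phi_edgeStart_le (k : Fin 3) {b : ℤ × ℤ}
    (hb : b ∈ ({(1, 0), (0, 1), (0, 0)} : Finset (ℤ × ℤ))) : phi k (edgeStart k) ≤ phi k b := by
  revert k b; decide

lemma phi_edgeDir (k : Fin 3) : phi k (edgeDir k) = 0 := by
  revert k; decide

lemma phi_eq_neg_dir (k : Fin 3) (i : ℤ × ℤ) :
    phi k i = -(dir k).1 * i.1 + -(dir k).2 * i.2 := by
  fin_cases k <;> simp [phi, dir]
  ring

lemma dir_ne (k : Fin 3) : -(dir k).1 ≠ 0 ∨ -(dir k).2 ≠ 0 := by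
  revert k; decide

lemma phi_sub (k : Fin 3) (i j : ℤ × ℤ) : phi k (i - j) = phi k i - phi k j := by
  rw [eq_sub_iff_add_eq, ← phi_add, sub_add_cancel]

/-- Lower bound for the area of the Minkowski sum of a primitive triangle and `T_1`. -/
lemma le_area_add_unit {A : Finset (ℤ × ℤ)} (hA : IsPrim A) {k : Fin 3} {p q : ℤ × ℤ}
    (hp : p ∈ A) (hq : q ∈ A) (hpq : 0 < phi k q - phi k p) :
    2 * ((phi k q - phi k p : ℤ) : ℝ) + 2 ≤
      area (hull (A + {(1, 0), (0, 1), (0, 0)} : Finset (ℤ × ℤ))) := by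
  set B : Finset (ℤ × ℤ) := {(1, 0), (0, 1), (0, 0)} with hB
  have hne : p ≠ q := by rintro rfl; simp at hpq
  obtain ⟨r, hr, hd⟩ := hA.exists_third hp hq hne
  have hrA : r ∈ A := by simp [hr]
  set σ := det3 p q r with hσ
  have hσσ : σ * σ = 1 := by
    rcases (abs_eq one_pos.le).1 hd with h | h <;> rw [h] <;> norm_num
  set m := -σ * (q.2 - p.2) with hm
  set n := σ * (q.1 - p.1) with hn
  -- The form (m, n) is constant on pq and larger by 1 at r, and t is a vertex of T_1 where it is
  -- maximal. So A + t lies on the far side of [p, q] + T_1, and their hulls overlap in a null set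
  -- only.
  obtain ⟨t, ht, htmax⟩ := B.exists_max_image (fun i => m * i.1 + n * i.2) ⟨_, (edge_mem_unit k).1⟩
  have hq' : m * q.1 + n * q.2 = m * p.1 + n * p.2 := by rw [hm, hn]; ring
  have hr' : m * r.1 + n * r.2 = m * p.1 + n * p.2 + 1 := by
    rw [← hσσ, hm, hn]
    have : σ = (q.1 - p.1) * (r.2 - p.2) - (q.2 - p.2) * (r.1 - p.1) := hσ
    linear_combination -σ * this
  have hmn : m ≠ 0 ∨ n ≠ 0 := by
    by_contra! h0
    rw [h0.1, h0.2] at hr'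
    simp at hr'
  have mem : ∀ {a b : ℤ × ℤ}, a ∈ A → b ∈ B → a + b ∈ ((A + B : Finset (ℤ × ℤ)) : Set (ℤ × ℤ)) :=
    fun ha hb => Finset.mem_coe.2 (Finset.add_mem_add ha hb)
  have s1 := area_add_le (A := (({p, q} + B : Finset (ℤ × ℤ)) : Set (ℤ × ℤ)))
    (B := {p + t, q + t, r + t}) (C := ((A + B : Finset (ℤ × ℤ)) : Set (ℤ × ℤ)))
    (Finset.finite_toSet _) (Set.toFinite _) (Finset.finite_toSet _)
    (hull_mono (Finset.coe_subset.2 (Finset.add_subset_add_right (by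
      intro i hi; simp at hi; rcases hi with rfl | rfl <;> assumption))))
    (hull_mono (by rintro i (rfl | rfl | rfl) <;> exact mem (by assumption) ht))
    m n (m * (p + t).1 + n * (p + t).2) hmn
    (by
      intro i hi
      obtain ⟨a, ha, b, hb, rfl⟩ := Finset.mem_add.1 (Finset.mem_coe.1 hi)
      have h1 := htmax b hb
      simp only [Finset.mem_insert, Finset.mem_singleton] at ha
      simp only [Prod.fst_add, Prod.snd_add]
      rcases ha with rfl | rfl <;> linarith)
    (by
      simp only [Prod.fst_add, Prod.snd_add]
      rintro i (rfl | rfl | rfl) <;> simp only [Prod.fst_add, Prod.snd_add] <;> linarith)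
  -- Inside [p, q] + T_1, the line on which `phi k` has its value at q + edgeStart k separates two
  -- pieces. On one side is the parallelogram spanned by q - p and the edge of T_1 with minimal `phi
  -- k`, of area at least 2(phi k q - phi k p). On the other is q + T_1, of area 1.
  have s2 := area_add_le (A := {p + edgeStart k, p + edgeStart k + edgeDir k,
      p + edgeStart k + (q - p), p + edgeStart k + (q - p) + edgeDir k})
    (B := {q + (1, 0), q + (0, 1), q + (0, 0)})
    (C := (({p, q} + B : Finset (ℤ × ℤ)) : Set (ℤ × ℤ)))
    (Set.toFinite _) (Set.toFinite _) (Finset.finite_toSet _)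
    (hull_mono (by
      have e1 : p + edgeStart k + (q - p) = q + edgeStart k := by abel
      rw [e1]
      rintro i (rfl | rfl | rfl | rfl)
      · exact Finset.add_mem_add (by simp) (edge_mem_unit k).1
      · rw [add_assoc]; exact Finset.add_mem_add (by simp) (edge_mem_unit k).2
      · exact Finset.add_mem_add (by simp) (edge_mem_unit k).1
      · rw [add_assoc]; exact Finset.add_mem_add (by simp) (edge_mem_unit k).2))
    (hull_mono (by
      rintro i (rfl | rfl | rfl) <;> exact Finset.add_mem_add (by simp) (by simp [hB])))
    (-(dir k).1) (-(dir k).2) (phi k (q + edgeStart k)) (dir_ne k)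
    (by
      rintro i (rfl | rfl | rfl | rfl) <;> rw [← phi_eq_neg_dir] <;>
        simp only [phi_add, phi_sub, phi_edgeDir] <;> linarith)
    (by
      have aux : ∀ b ∈ B, phi k (q + edgeStart k) ≤
          -(dir k).1 * (q + b).1 + -(dir k).2 * (q + b).2 := by
        intro b hb
        rw [← phi_eq_neg_dir, phi_add, phi_add]
        linarith [phi_edgeStart_le k hb]
      rintro i (rfl | rfl | rfl) <;> exact aux _ (by simp [hB]))
  have s3 := two_mul_cross_le_area (p + edgeStart k) (edgeDir k) (q - p) (by
    have : cross (edgeDir k) (q - p) = -phi k (q - p) := by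
      rw [← cross_edgeDir]; simp only [cross]; ring
    rw [this, phi_sub]; linarith)
  have e3 : |((cross (edgeDir k) (q - p) : ℤ) : ℝ)| = ((phi k q - phi k p : ℤ) : ℝ) := by
    have : cross (edgeDir k) (q - p) = -phi k (q - p) := by
      rw [← cross_edgeDir]; simp only [cross]; ring
    rw [this, phi_sub, ← Int.cast_abs, abs_neg, abs_of_pos hpq]
  rw [e3] at s3
  have a1 : area (hull {p + t, q + t, r + t}) = 1 := by
    rw [area_triangle, det3_translate]
    exact_mod_cast hd
  have a2 : area (hull {q + (1, 0), q + (0, 1), q + (0, 0)}) = 1 := by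
    rw [area_triangle]; simp [det3]
  linarith

/-- T_1 + T_1 lies in T_2, of area 4. -/
lemma area_add_unit_le_of_unitAt (a : ℤ × ℤ) :
    area (hull (unitAt a + {(1, 0), (0, 1), (0, 0)} : Finset (ℤ × ℤ))) ≤ 4 := by
  have h : hull (unitAt a + {(1, 0), (0, 1), (0, 0)} : Finset (ℤ × ℤ)) ⊆
      hull {a, a + (2, 0), a + (0, 2)} := by
    refine hull_subset_hull fun i hi => ?_
    obtain ⟨b, hb, c, hc, rfl⟩ := Finset.mem_add.1 (Finset.mem_coe.1 hi)
    rw [mem_hull_std two_pos]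
    simp only [unitAt, Finset.mem_insert, Finset.mem_singleton] at hb hc
    rcases hb with rfl | rfl | rfl <;> rcases hc with rfl | rfl | rfl <;>
      refine ⟨?_, ?_, ?_⟩ <;> simp <;> linarith
  refine (area_mono (Set.toFinite _) h).trans ?_
  rw [area_triangle]
  simp [det3]

/-- The corner of the translate `a + T_3` at which `phi j` is maximal. -/
def corner (a : ℤ × ℤ) (j : Fin 3) : Set (ℤ × ℤ) :=
  {a + ![(2, 0), (0, 2), (0, 0)] j, a + ![(2, 0), (0, 2), (0, 0)] j + (1, 0),
    a + ![(2, 0), (0, 2), (0, 0)] j + (0, 1)}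

lemma area_corner (a : ℤ × ℤ) (j : Fin 3) : area (hull (corner a j)) = 1 := by
  rw [corner, area_triangle]
  simp [det3]

lemma corner_bounds {a i : ℤ × ℤ} {j : Fin 3} (h : i ∈ corner a j) :
    (a.1 ≤ i.1 ∧ a.2 ≤ i.2 ∧ i.1 + i.2 ≤ a.1 + a.2 + 3) ∧
      phi j a - ![0, 0, 3] j + 2 ≤ phi j i ∧
      ∀ j', j' ≠ j → phi j' i ≤ phi j' a - ![0, 0, 3] j' + 2 := by
  fin_cases j <;> rcases h with rfl | rfl | rfl <;>
    refine ⟨⟨?_, ?_, ?_⟩, ?_, fun j' hj' => ?_⟩ <;> (try fin_cases j') <;>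
    first
    | exact absurd rfl hj'
    | (simp [phi]; done)
    | (simp [phi]; omega)

lemma phi_unit_le (j : Fin 3) {c : ℤ × ℤ}
    (hc : c ∈ ({(1, 0), (0, 1), (0, 0)} : Finset (ℤ × ℤ))) :
    phi j c - ![0, 0, 2] j ≤ 1 - ![0, 0, 3] j := by
  revert j c; decide

/-- The Minkowski sum lies in a translate of T_3, of area 9, and stays away from two unit corners.
The resulting bound 7 is not sharp, but it keeps the multiplicity at v at most 5/2. -/
lemma area_add_unit_le_of_narrow {A : Finset (ℤ × ℤ)} (hA : Narrow A) :
    area (hull (A + {(1, 0), (0, 1), (0, 0)} : Finset (ℤ × ℤ))) ≤ 7 := by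
  obtain ⟨a, hb, j, j', hjj, hj, hj'⟩ := hA
  set S : Finset (ℤ × ℤ) := A + {(1, 0), (0, 1), (0, 0)} with hS
  have hbox : ∀ i ∈ S, a.1 ≤ i.1 ∧ a.2 ≤ i.2 ∧ i.1 + i.2 ≤ a.1 + a.2 + 3 := by
    intro i hi
    obtain ⟨b, hb', c, hc, rfl⟩ := Finset.mem_add.1 hi
    have := hb b hb'
    simp only [Finset.mem_insert, Finset.mem_singleton] at hc
    rcases hc with rfl | rfl | rfl <;> simp <;> omega
  have hphi : ∀ j : Fin 3, (∀ i ∈ A, phi j i ≤ phi j a - ![0, 0, 2] j + 1) →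
      ∀ i ∈ S, phi j i ≤ phi j a - ![0, 0, 3] j + 2 := by
    intro j hj i hi
    obtain ⟨b, hb', c, hc, rfl⟩ := Finset.mem_add.1 hi
    have h1 := hj b hb'
    have h2 := phi_unit_le j hc
    rw [phi_add]
    linarith
  have hin : ∀ i : ℤ × ℤ, (a.1 ≤ i.1 ∧ a.2 ≤ i.2 ∧ i.1 + i.2 ≤ a.1 + a.2 + 3) →
      toReal i ∈ hull {a, a + (3, 0), a + (0, 3)} := by
    intro i hi
    rw [mem_hull_std three_pos]
    simp only [toReal_fst, toReal_snd]
    exact_mod_cast hi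
  have hfin : ∀ j, (corner a j).Finite := fun j => by unfold corner; exact Set.toFinite _
  have s1 := area_add_le (A := (S : Set (ℤ × ℤ)) ∪ corner a j') (B := corner a j)
    (C := {a, a + (3, 0), a + (0, 3)}) (S.finite_toSet.union (hfin _)) (hfin _) (Set.toFinite _)
    (hull_subset_hull (by
      rintro i (hi | hi)
      · exact hin i (hbox i hi)
      · exact hin i (corner_bounds hi).1))
    (hull_subset_hull fun i hi => hin i (corner_bounds hi).1)
    (-(dir j).1) (-(dir j).2) (phi j a - ![0, 0, 3] j + 2) (dir_ne j)
    (by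
      rintro i (hi | hi) <;> rw [← phi_eq_neg_dir]
      · exact hphi j hj i hi
      · exact (corner_bounds hi).2.2 j hjj)
    (by
      intro i hi
      rw [← phi_eq_neg_dir]
      exact (corner_bounds hi).2.1)
  have s2 := area_add_le (A := (S : Set (ℤ × ℤ))) (B := corner a j')
    (C := (S : Set (ℤ × ℤ)) ∪ corner a j') S.finite_toSet (hfin _) (S.finite_toSet.union (hfin _))
    (hull_mono Set.subset_union_left) (hull_mono Set.subset_union_right)
    (-(dir j').1) (-(dir j').2) (phi j' a - ![0, 0, 3] j' + 2) (dir_ne j')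
    (by
      intro i hi
      rw [← phi_eq_neg_dir]
      exact hphi j' hj' i hi)
    (by
      intro i hi
      rw [← phi_eq_neg_dir]
      exact (corner_bounds hi).2.1)
  rw [area_corner] at s1 s2
  have h9 : area (hull {a, a + (3, 0), a + (0, 3)}) = 9 := by
    rw [area_triangle]
    simp [det3]
  linarith

/-- The area of the Minkowski sum of a primitive triangle and one of its edges. -/
lemma area_add_edge {p δ r f : ℤ × ℤ} (hd : |det3 p (p + δ) r| = 1) :
    3 ≤ area (hull (({p, p + δ, r} : Finset (ℤ × ℤ)) + {f, f + δ} : Finset (ℤ × ℤ))) ∧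
      area (hull (({p, p + δ, r} : Finset (ℤ × ℤ)) + {f, f + δ} : Finset (ℤ × ℤ))) ≤ 4 := by
  obtain ⟨ρ, rfl⟩ : ∃ ρ, r = p + ρ := ⟨r - p, by abel⟩
  rw [det3_add] at hd
  have hS : ((({p, p + δ, p + ρ} : Finset (ℤ × ℤ)) + {f, f + δ} : Finset (ℤ × ℤ)) : Set (ℤ × ℤ)) =
      {p + f, p + f + δ, p + f + δ + δ, p + f + ρ, p + f + ρ + δ} := by
    ext i
    simp only [Finset.coe_add, Set.mem_add, Finset.coe_insert, Finset.coe_singleton,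
      Set.mem_insert_iff, Set.mem_singleton_iff]
    constructor
    · rintro ⟨a, rfl | rfl | rfl, b, rfl | rfl, rfl⟩
      · exact Or.inl rfl
      · right; left; abel
      · right; left; abel
      · right; right; left; abel
      · right; right; right; left; abel
      · right; right; right; right; abel
    · rintro (rfl | rfl | rfl | rfl | rfl)
      · exact ⟨p, Or.inl rfl, f, Or.inl rfl, rfl⟩
      · exact ⟨p, Or.inl rfl, f + δ, Or.inr rfl, by abel⟩
      · exact ⟨p + δ, by simp, f + δ, by simp, by abel⟩
      · exact ⟨p + ρ, by simp, f, by simp, by abel⟩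
      · exact ⟨p + ρ, by simp, f + δ, by simp, by abel⟩
  rw [hS]
  set X := p + f
  have hc0 : cross δ ρ ≠ 0 := by intro h; simp [h] at hd
  have hcc : cross δ ρ * cross δ ρ = 1 := by
    rcases (abs_eq one_pos.le).1 hd with h | h <;> rw [h] <;> norm_num
  have hdR : |((cross δ ρ : ℤ) : ℝ)| = 1 := by exact_mod_cast hd
  -- The sum is a trapezoid. From below it contains a parallelogram of area at least 2 and a
  -- triangle of area 1, from above it lies in the doubled triangle.
  constructor
  · have s1 := area_add_le (A := {X, X + δ, X + ρ, X + ρ + δ}) (B := {X + δ, X + δ + δ, X + δ + ρ})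
      (C := {X, X + δ, X + δ + δ, X + ρ, X + ρ + δ}) (Set.toFinite _) (Set.toFinite _)
      (Set.toFinite _) (hull_mono (by intro i; simp; tauto))
      (hull_mono (by
        have : X + δ + ρ = X + ρ + δ := by abel
        rw [this]
        intro i; simp; tauto))
      (cross δ ρ * ρ.2) (-cross δ ρ * ρ.1)
      (cross δ ρ * ρ.2 * (X + δ).1 + -cross δ ρ * ρ.1 * (X + δ).2)
      (by
        by_contra! h0
        have h1 := (mul_eq_zero.1 h0.1).resolve_left hc0
        have h2 := (mul_eq_zero.1 h0.2).resolve_left (neg_ne_zero.2 hc0)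
        apply hc0
        rw [cross, h1, h2]; ring)
      (by
        have h3 : 0 ≤ cross δ ρ * (δ.1 * ρ.2 - δ.2 * ρ.1) := by
          have : cross δ ρ * (δ.1 * ρ.2 - δ.2 * ρ.1) = 1 := hcc
          rw [this]; norm_num
        rintro i (rfl | rfl | rfl | rfl) <;> simp only [Prod.fst_add, Prod.snd_add] <;>
          linarith)
      (by
        have h3 : 0 ≤ cross δ ρ * (δ.1 * ρ.2 - δ.2 * ρ.1) := by
          have : cross δ ρ * (δ.1 * ρ.2 - δ.2 * ρ.1) = 1 := hcc
          rw [this]; norm_num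
        rintro i (rfl | rfl | rfl) <;> simp only [Prod.fst_add, Prod.snd_add] <;> linarith)
    have s2 := two_mul_cross_le_area X δ ρ hc0
    have s3 : area (hull {X + δ, X + δ + δ, X + δ + ρ}) = 1 := by
      rw [area_triangle, det3_add, hdR]
    linarith
  · have hsub : hull {X, X + δ, X + δ + δ, X + ρ, X + ρ + δ} ⊆
        hull {X, X + (δ + δ), X + (ρ + ρ)} := by
      have mid : ∀ i a b : ℤ × ℤ, a ∈ ({X, X + (δ + δ), X + (ρ + ρ)} : Set (ℤ × ℤ)) →
          b ∈ ({X, X + (δ + δ), X + (ρ + ρ)} : Set (ℤ × ℤ)) → i + i = a + b →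
          toReal i ∈ hull {X, X + (δ + δ), X + (ρ + ρ)} := by
        intro i a b ha hb e
        have h := (convex_convexHull ℝ _).midpoint_mem (toReal_mem_hull ha) (toReal_mem_hull hb)
        have e1 : toReal i = midpoint ℝ (toReal a) (toReal b) := by
          rw [midpoint_eq_smul_add, ← toReal_add, ← e, toReal_add, ← two_smul ℝ (toReal i),
            smul_smul]
          simp
        rw [e1]; exact h
      refine hull_subset_hull ?_
      rintro i (rfl | rfl | rfl | rfl | rfl)
      · exact toReal_mem_hull (by simp)
      · exact mid _ X (X + (δ + δ)) (by simp) (by simp) (by abel)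
      · exact toReal_mem_hull (by simp [add_assoc])
      · exact mid _ X (X + (ρ + ρ)) (by simp) (by simp) (by abel)
      · exact mid _ (X + (δ + δ)) (X + (ρ + ρ)) (by simp) (by simp) (by abel)
    refine (area_mono (Set.toFinite _) hsub).trans ?_
    rw [area_triangle, det3_add]
    have : cross (δ + δ) (ρ + ρ) = 4 * cross δ ρ := by simp [cross]; ring
    rw [this]
    push_cast
    rw [abs_mul, hdR]
    norm_num

namespace TropPoly

variable {P : TropPoly} {v : ℝ × ℝ} {k : Fin 3}

/-! ### Multiplicities of the components -/

lemma dualCell_mul (P Q : TropPoly) (x : ℝ × ℝ) :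
    (P.mul Q).dualCell x = hull ((P.active x + Q.active x : Finset (ℤ × ℤ)) : Set (ℤ × ℤ)) := by
  rw [dualCell, active_mul]

lemma area_dualCell_tropLine_self (v : ℝ × ℝ) : area ((tropLine v).dualCell v) = 1 := by
  rw [dualCell, tropLine_active_self]
  refine IsPrim.area_eq ⟨(1, 0), (0, 1), (0, 0), rfl, ?_⟩
  decide

lemma interMult_self (hP : P.NonSingular) (hv : P.IsVertex v) :
    P.interMult (tropLine v) v =
      (area (hull ((P.active v + {(1, 0), (0, 1), (0, 0)} : Finset (ℤ × ℤ)) : Set (ℤ × ℤ))) - 2) /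
        2 := by
  have h1 : area (P.dualCell v) = 1 := (IsVertex.isPrim hP hv).area_eq
  rw [interMult, dualCell_mul, tropLine_active_self, h1, area_dualCell_tropLine_self]
  norm_num

lemma le_interMult_self (hP : P.NonSingular) (hv : P.IsVertex v) {p q : ℤ × ℤ}
    (hp : p ∈ P.active v) (hq : q ∈ P.active v) (hpq : 0 < phi k q - phi k p) :
    ((phi k q - phi k p : ℤ) : ℝ) ≤ P.interMult (tropLine v) v := by
  rw [interMult_self hP hv]
  have := le_area_add_unit (IsVertex.isPrim hP hv) hp hq hpq
  linarith

lemma interMult_self_le_of_unitAt (hP : P.NonSingular) (hv : P.IsVertex v) {a : ℤ × ℤ}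
    (ha : P.active v = unitAt a) : P.interMult (tropLine v) v ≤ 1 := by
  rw [interMult_self hP hv, ha]
  have := area_add_unit_le_of_unitAt a
  linarith

lemma interMult_self_le_of_narrow (hP : P.NonSingular) (hv : P.IsVertex v)
    (h : Narrow (P.active v)) : P.interMult (tropLine v) v ≤ 5 / 2 := by
  rw [interMult_self hP hv]
  have := area_add_unit_le_of_narrow h
  linarith

/-- The lattice length of q - p divides the determinant ±1. -/
lemma eq_add_edgeDir {p q r : ℤ × ℤ} (h : phi k p = phi k q) (hd : |det3 p q r| = 1) :
    q = p + edgeDir k ∨ p = q + edgeDir k := by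
  obtain ⟨p1, p2⟩ := p
  obtain ⟨q1, q2⟩ := q
  obtain ⟨r1, r2⟩ := r
  simp only [det3] at hd
  have fin : ∀ x y : ℤ, |x * y| = 1 → x = 1 ∨ x = -1 := fun x y h => by
    have h1 : IsUnit (x * y) := Int.isUnit_iff_abs_eq.2 h
    exact Int.isUnit_iff.1 (isUnit_of_mul_isUnit_left h1)
  fin_cases k <;> simp [phi, edgeDir] at h ⊢
  · have := fin (q2 - p2) (r1 - p1) (by rw [← hd, ← abs_neg]; congr 1; rw [h]; ring)
    omega
  · have := fin (q1 - p1) (r2 - p2) (by rw [← hd]; congr 1; rw [h]; ring)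
    omega
  · have e : q2 - p2 = -(q1 - p1) := by linarith
    have := fin (q1 - p1) (r2 - p2 + (r1 - p1)) (by rw [← hd]; congr 1; rw [e]; ring)
    omega

/-- At the far end the cell of the line is the edge of T_1 with direction `edgeDir k`, which is also
an edge of the dual triangle, and it has area 0. By `area_add_edge` the sum has area between 3 and
4; subtracting 1 and halving gives the bounds. -/
lemma interMult_end (hP : P.NonSingular) (hv : P.IsVertex v) {l : ℝ}
    (hl : P.BoundedEdge v (dir k) l) :
    1 ≤ P.interMult (tropLine v) (pointAt v (dir k) l) ∧
      P.interMult (tropLine v) (pointAt v (dir k) l) ≤ 3 / 2 := by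
  obtain ⟨p, q, hpq, -⟩ := hl.minPair hP hv
  obtain ⟨-, r, hr, hd, -⟩ := hpq.of_boundedEdge hP hv hl
  have h1 : area (P.dualCell (pointAt v (dir k) l)) = 1 :=
    (IsVertex.isPrim hP (hl.isVertex_end hP hv)).area_eq
  have h2 : area ((tropLine v).dualCell (pointAt v (dir k) l)) = 0 := by
    rw [dualCell, tropLine_active_ray v k hl.2.1, lineEdge_eq, Finset.coe_pair, area_pair]
  have key : ∃ p q, P.active (pointAt v (dir k) l) = {p, q, r} ∧ |det3 p q r| = 1 ∧
      q = p + edgeDir k := by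
    rcases eq_add_edgeDir hpq.eq hd with h | h
    · exact ⟨p, q, hr, hd, h⟩
    · exact ⟨q, p, by rw [hr, Finset.insert_comm], by rw [IsPrim.swap, abs_neg, hd], h⟩
  obtain ⟨p, q, hr, hd, rfl⟩ := key
  have := area_add_edge (f := edgeStart k) hd
  rw [interMult, h1, h2, dualCell_mul, tropLine_active_ray v k hl.2.1, lineEdge_eq, hr]
  constructor <;> linarith

lemma IsVertex.mul (hP : P.NonSingular) (Q : TropPoly) {x : ℝ × ℝ} (hx : P.IsVertex x) :
    (P.mul Q).IsVertex x := by
  obtain ⟨p, q, r, e, hd⟩ := IsVertex.isPrim hP hx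
  obtain ⟨t, ht⟩ := Q.active_nonempty x
  refine isVertex_of_det (p := p + t) (q := q + t) (r := r + t) ?_ ?_ ?_
    (by rw [det3_translate]; exact det3_ne_zero_of_abs hd) <;> rw [active_mul] <;>
    exact Finset.add_mem_add (by simp [e]) ht

/-- In the interior of a leaving edge both cells are segments on which `phi k` is constant, and so
is their Minkowski sum. -/
lemma not_isVertex_mul {p q : ℤ × ℤ} {x : ℝ × ℝ} (h : phi k p = phi k q)
    (hx : P.active x = {p, q}) {t : ℝ} (ht : 0 < t) (hxt : x = pointAt v (dir k) t) :
    ¬ (P.mul (tropLine v)).IsVertex x := by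
  intro hvx
  refine hvx (collinear_of_line (m := ((-(dir k).1 : ℤ) : ℝ)) (n := ((-(dir k).2 : ℤ) : ℝ))
    (c := (phi k p + phi k (edgeStart k) : ℤ)) (by exact_mod_cast dir_ne k) ?_)
  rintro _ ⟨i, hi, rfl⟩
  rw [active_mul, hx, hxt, tropLine_active_ray v k ht, lineEdge_eq] at hi
  obtain ⟨a, ha, b, hb, rfl⟩ := Finset.mem_add.1 (Finset.mem_coe.1 hi)
  have h1 := phi_eq_neg_dir k (a + b)
  simp only [toReal_fst, toReal_snd]
  rw [← Int.cast_mul, ← Int.cast_mul, ← Int.cast_add, ← h1, phi_add, Int.cast_inj]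
  simp only [Finset.mem_insert, Finset.mem_singleton] at ha hb
  rcases ha with rfl | rfl <;> rcases hb with rfl | rfl <;>
    linarith [phi_add k (edgeStart k) (edgeDir k), phi_edgeDir k]

open Classical in
/-- The directions of the bounded edges which leave `v` along the tropical line with vertex `v`. -/
noncomputable def boundedDirs (P : TropPoly) (v : ℝ × ℝ) : Finset (Fin 3) :=
  Finset.univ.filter fun k => ∃ l, P.BoundedEdge v (dir k) l

open Classical in
/-- The length of the bounded edge which leaves `v` in the direction `dir k`. -/
noncomputable def edgeLen (P : TropPoly) (v : ℝ × ℝ) (k : Fin 3) : ℝ :=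
  if h : ∃ l, P.BoundedEdge v (dir k) l then h.choose else 0

lemma mem_boundedDirs : k ∈ P.boundedDirs v ↔ ∃ l, P.BoundedEdge v (dir k) l := by
  simp [boundedDirs]

lemma boundedEdge_edgeLen (h : k ∈ P.boundedDirs v) :
    P.BoundedEdge v (dir k) (P.edgeLen v k) := by
  have h' := mem_boundedDirs.1 h
  rw [edgeLen, dif_pos h']
  exact h'.choose_spec

lemma BoundedEdge.eq_edgeLen (hP : P.NonSingular) (hv : P.IsVertex v) {l : ℝ}
    (h : P.BoundedEdge v (dir k) l) : l = P.edgeLen v k :=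
  h.unique hP hv (boundedEdge_edgeLen (mem_boundedDirs.2 ⟨l, h⟩))

/-- Vertices of the curve remain vertices of the product, while interior points of the leaving edges
are not vertices of it. Only v and the far ends of the bounded edges remain. -/
lemma tropInter_inter_lineComp (hP : P.NonSingular) (hv : P.IsVertex v) :
    P.tropInter (tropLine v) ∩ P.lineComp v =
      ↑(insert v ((P.boundedDirs v).image fun k => pointAt v (dir k) (P.edgeLen v k))) := by
  ext x
  simp only [Set.mem_inter_iff, Finset.coe_insert, Finset.coe_image, Set.mem_insert_iff,
    Set.mem_image, Finset.mem_coe]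
  constructor
  · rintro ⟨⟨-, hx⟩, hE⟩
    rcases (mem_lineComp hP hv).1 hE with rfl | ⟨k, t, ht, rfl, h⟩
    · exact Or.inl rfl
    right
    rcases h with h | ⟨l, h, htl⟩
    · obtain ⟨p, q, hpq, -⟩ := h.minPair hP hv
      exact absurd hx (not_isVertex_mul hpq.eq ((hpq.of_unboundedEdge hP hv h).2 t ht) ht rfl)
    · rcases htl.eq_or_lt with rfl | hlt
      · exact ⟨k, mem_boundedDirs.2 ⟨_, h⟩, by rw [← h.eq_edgeLen hP hv]⟩
      · obtain ⟨p, q, hpq, -⟩ := h.minPair hP hv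
        exact absurd hx
          (not_isVertex_mul hpq.eq ((hpq.of_boundedEdge hP hv h).1 t ht hlt) ht rfl)
  · have aux : ∀ x ∈ P.lineComp v, P.IsVertex x → x ∈ P.tropInter (tropLine v) :=
      fun x hx hxv => ⟨connectedComponentIn_subset _ _ hx, hxv.mul hP _⟩
    rintro (rfl | ⟨k, hk, rfl⟩)
    · have : x ∈ P.lineComp x := (mem_lineComp hP hv).2 (Or.inl rfl)
      exact ⟨aux x this hv, this⟩
    · have hl := boundedEdge_edgeLen hk
      have : pointAt v (dir k) (P.edgeLen v k) ∈ P.lineComp v :=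
        (mem_lineComp hP hv).2 (Or.inr ⟨k, _, hl.2.1, rfl, Or.inr ⟨_, hl, le_rfl⟩⟩)
      exact ⟨aux _ this (hl.isVertex_end hP hv), this⟩

lemma compMult_eq (hP : P.NonSingular) (hv : P.IsVertex v) :
    P.compMult (tropLine v) (P.lineComp v) = P.interMult (tropLine v) v +
      ∑ k ∈ P.boundedDirs v, P.interMult (tropLine v) (pointAt v (dir k) (P.edgeLen v k)) := by
  rw [compMult, tropInter_inter_lineComp hP hv, finsum_mem_coe_finset, Finset.sum_insert,
    Finset.sum_image]
  · intro k hk k' hk' e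
    exact (pointAt_dir_eq (boundedEdge_edgeLen hk).2.1 (boundedEdge_edgeLen hk').2.1.le e).1
  · intro h
    obtain ⟨k, hk, e⟩ := Finset.mem_image.1 h
    exact (boundedEdge_edgeLen hk).2.1.ne'
      (pointAt_dir_injective v k (e.trans (pointAt_zero _ _).symm))

lemma le_compMult (hP : P.NonSingular) (hv : P.IsVertex v) :
    P.interMult (tropLine v) v + (P.boundedDirs v).card ≤
      P.compMult (tropLine v) (P.lineComp v) := by
  rw [compMult_eq hP hv, Finset.card_eq_sum_ones]
  push_cast
  gcongr with k hk
  exact (interMult_end hP hv (boundedEdge_edgeLen hk)).1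

lemma compMult_le (hP : P.NonSingular) (hv : P.IsVertex v) :
    P.compMult (tropLine v) (P.lineComp v) ≤
      P.interMult (tropLine v) v + (P.boundedDirs v).card * (3 / 2) := by
  rw [compMult_eq hP hv, ← nsmul_eq_mul, ← Finset.sum_const]
  gcongr with k hk
  exact (interMult_end hP hv (boundedEdge_edgeLen hk)).2

lemma boundedDirs_subset (hP : P.NonSingular) (hv : P.IsVertex v) (h : k ∈ P.boundedDirs v) :
    MinEdge (P.active v) k :=
  (minEdge_iff_edge hP hv).2 (Or.inr (mem_boundedDirs.1 h))

lemma unboundedEdge_of_not_mem (hP : P.NonSingular) (hv : P.IsVertex v)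
    (h : MinEdge (P.active v) k) (hk : k ∉ P.boundedDirs v) : P.UnboundedEdge v (dir k) :=
  ((minEdge_iff_edge hP hv).1 h).resolve_right fun h' => hk (mem_boundedDirs.2 h')

/-- When the component of the intersection with the tropical line has multiplicity at least `3`. -/
lemma three_le_compMult_iff_of_unitAt (hP : P.NonSingular) (hv : P.IsVertex v) {a : ℤ × ℤ}
    (ha : P.active v = unitAt a) :
    3 ≤ P.compMult (tropLine v) (P.lineComp v) ↔ 2 ≤ (P.boundedDirs v).card := by
  have h1 := le_compMult hP hv
  have h2 := compMult_le hP hv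
  have h3 := interMult_self_le_of_unitAt hP hv ha
  have h4 := le_interMult_self (k := 0) hP hv (p := a) (q := a + (1, 0)) (by simp [ha, unitAt])
    (by simp [ha, unitAt]) (by simp [phi])
  simp [phi] at h4
  -- With at most one bounded edge the total is at most 1 + 3/2 < 3, with two or more it is at least
  -- 1 + 2.
  constructor
  · intro h
    by_contra! hlt
    have : ((P.boundedDirs v).card : ℝ) ≤ 1 := by exact_mod_cast Nat.lt_succ_iff.1 hlt
    linarith
  · intro h
    have : (2 : ℝ) ≤ (P.boundedDirs v).card := by exact_mod_cast h
    linarith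

lemma compMult_lt_three_of_narrow (hP : P.NonSingular) (hv : P.IsVertex v)
    (h : Narrow (P.active v)) (hb : P.boundedDirs v = ∅) :
    P.compMult (tropLine v) (P.lineComp v) < 3 := by
  have h2 := compMult_le hP hv
  have h3 := interMult_self_le_of_narrow hP hv h
  rw [hb] at h2
  simp at h2
  linarith

/-- A form of variation 2 gives at least 2 at v, and a far end adds at least 1. -/
lemma three_le_compMult_of_mixed (hP : P.NonSingular) (hv : P.IsVertex v)
    (h : Mixed (P.active v)) (hb : (P.boundedDirs v).Nonempty) :
    3 ≤ P.compMult (tropLine v) (P.lineComp v) := by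
  have h1 := le_compMult hP hv
  obtain ⟨-, -, j, p, hp, q, hq, e⟩ := h
  have h4 := le_interMult_self (k := j) hP hv hp hq (by omega)
  rw [e] at h4
  have : (1 : ℝ) ≤ (P.boundedDirs v).card := by exact_mod_cast hb.card_pos
  push_cast at h4
  linarith

lemma three_le_compMult_of_wide (hP : P.NonSingular) (hv : P.IsVertex v)
    (h : Wide (P.active v)) : 3 ≤ P.compMult (tropLine v) (P.lineComp v) := by
  have h1 := le_compMult hP hv
  obtain ⟨⟨j, p, hp, q, hq, e⟩, -⟩ := h
  have h4 := le_interMult_self (k := j) hP hv hp hq (by omega)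
  have h5 : (3 : ℝ) ≤ ((phi j q - phi j p : ℤ) : ℝ) := by exact_mod_cast e
  have : (0 : ℝ) ≤ (P.boundedDirs v).card := by positivity
  linarith

end TropPoly
/-! ### The inflection number of a primitive triangle -/

lemma segment_eq_hull (p q : ℤ × ℤ) : segment ℝ (toReal p) (toReal q) = hull {p, q} := by
  rw [hull, Set.image_pair, convexHull_pair]

lemma hull_rotate (p q r : ℤ × ℤ) : hull {p, q, r} = hull {q, r, p} := by
  congr 1; ext; simp; tauto

lemma mem_hull_triple {p q r : ℤ × ℤ} {x : ℝ × ℝ} : x ∈ hull {p, q, r} ↔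
    ∃ a b c : ℝ, 0 ≤ a ∧ 0 ≤ b ∧ 0 ≤ c ∧ a + b + c = 1 ∧
      a • toReal p + b • toReal q + c • toReal r = x := by
  rw [hull, Set.image_insert_eq, Set.image_pair, convexHull_insert (by simp), convexHull_pair,
    mem_convexJoin]
  constructor
  · rintro ⟨_, rfl, y, ⟨s, t, hs, ht, hst, rfl⟩, s', t', hs', ht', hst', rfl⟩
    refine ⟨s', t' * s, t' * t, hs', by positivity, by positivity, ?_, ?_⟩
    · rw [add_assoc, ← mul_add, hst, mul_one, hst']
    · rw [smul_add, smul_smul, smul_smul, add_assoc]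
  · rintro ⟨a, b, c, ha, hb, hc, habc, rfl⟩
    refine ⟨_, rfl, ?_⟩
    rcases eq_or_ne (b + c) 0 with h0 | h0
    · have hb0 : b = 0 := by linarith
      have hc0 : c = 0 := by linarith
      have ha1 : a = 1 := by linarith
      exact ⟨toReal q, left_mem_segment _ _ _, 1, 0, by norm_num, by norm_num, by norm_num,
        by simp [hb0, hc0, ha1]⟩
    · refine ⟨(b / (b + c)) • toReal q + (c / (b + c)) • toReal r,
        ⟨_, _, by positivity, by positivity, by field_simp, rfl⟩, a, b + c, ha, by positivity,
        by linarith, ?_⟩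
      rw [smul_add, smul_smul, smul_smul, mul_div_cancel₀ _ h0, mul_div_cancel₀ _ h0, add_assoc]

/-- The face of a triangle on which a linear form is maximal. -/
def face (Δ : Set (ℝ × ℝ)) (l : StrongDual ℝ (ℝ × ℝ)) : Set (ℝ × ℝ) :=
  {x | x ∈ Δ ∧ ∀ y ∈ Δ, l y ≤ l x}

lemma face_eq_edge {p q r : ℤ × ℤ} {l : StrongDual ℝ (ℝ × ℝ)}
    (h : l (toReal p) = l (toReal q)) (hr : l (toReal r) < l (toReal p)) :
    face (hull {p, q, r}) l = hull {p, q} := by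
  ext x
  constructor
  · rintro ⟨hx, hmax⟩
    obtain ⟨a, b, c, ha, hb, hc, habc, rfl⟩ := mem_hull_triple.1 hx
    have h1 := hmax _ (toReal_mem_hull (show p ∈ ({p, q, r} : Set (ℤ × ℤ)) by simp))
    simp only [map_add, map_smul, smul_eq_mul, ← h] at h1
    have hc0 : c = 0 := by
      by_contra hne
      have : 0 < c := lt_of_le_of_ne hc (Ne.symm hne)
      have e : a = 1 - b - c := by linarith
      rw [e] at h1
      nlinarith
    rw [← segment_eq_hull]
    exact ⟨a, b, ha, hb, by linarith, by simp [hc0]⟩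
  · intro hx
    refine ⟨hull_mono (by intro i; simp; tauto) hx, fun y hy => ?_⟩
    rw [← segment_eq_hull] at hx
    obtain ⟨s, t, hs, ht, hst, rfl⟩ := hx
    obtain ⟨a, b, c, ha, hb, hc, habc, rfl⟩ := mem_hull_triple.1 hy
    simp only [map_add, map_smul, smul_eq_mul, ← h]
    have e1 : s = 1 - t := by linarith
    have e2 : a = 1 - b - c := by linarith
    rw [e1, e2]
    nlinarith

lemma face_subset_singleton {p q r : ℤ × ℤ} {l : StrongDual ℝ (ℝ × ℝ)}
    (hq : l (toReal q) < l (toReal p)) (hr : l (toReal r) < l (toReal p)) :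
    face (hull {p, q, r}) l ⊆ {toReal p} := by
  rintro x ⟨hx, hmax⟩
  obtain ⟨a, b, c, ha, hb, hc, habc, rfl⟩ := mem_hull_triple.1 hx
  have h1 := hmax _ (toReal_mem_hull (show p ∈ ({p, q, r} : Set (ℤ × ℤ)) by simp))
  simp only [map_add, map_smul, smul_eq_mul] at h1
  have e : a = 1 - b - c := by linarith
  have h2 : b * (l (toReal p) - l (toReal q)) + c * (l (toReal p) - l (toReal r)) ≤ 0 := by
    rw [e] at h1; linarith
  have h3 := mul_nonneg hb (sub_pos.2 hq).le
  have h4 := mul_nonneg hc (sub_pos.2 hr).le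
  have hb0 : b = 0 :=
    (mul_eq_zero.1 (by linarith : b * (l (toReal p) - l (toReal q)) = 0)).resolve_right
      (sub_pos.2 hq).ne'
  have hc0 : c = 0 :=
    (mul_eq_zero.1 (by linarith : c * (l (toReal p) - l (toReal r)) = 0)).resolve_right
      (sub_pos.2 hr).ne'
  have ha1 : a = 1 := by linarith
  simp [hb0, hc0, ha1]

lemma not_mem_hull_pair {p q r : ℤ × ℤ} (hd : det3 p q r ≠ 0) : toReal r ∉ hull {p, q} := by
  intro hr
  refine not_collinear_of_det (S := {p, q, r}) (by simp) (by simp) (by simp) hd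
    ((collinear_convexHull (collinear_pair ℝ (toReal p) (toReal q))).subset ?_)
  have e : convexHull ℝ {toReal p, toReal q} = hull {p, q} := by rw [hull, Set.image_pair]
  rw [e]
  rintro _ ⟨i, rfl | rfl | rfl, rfl⟩
  · exact toReal_mem_hull (by simp)
  · exact toReal_mem_hull (by simp)
  · exact hr

lemma isPolygonEdge_hull_pair {p q r : ℤ × ℤ} (hd : det3 p q r ≠ 0) :
    IsPolygonEdge (hull {p, q, r}) (hull {p, q}) := by
  refine ⟨fun _ => ?_, toReal p, toReal q, ?_, (segment_eq_hull p q).symm⟩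
  -- A form constant on pq. The factor `det3 p q r` fixes its sign: its value at r is lower than at
  -- p by the square of the determinant.
  · let l : StrongDual ℝ (ℝ × ℝ) :=
      ((det3 p q r * (q.2 - p.2) : ℤ) : ℝ) • ContinuousLinearMap.fst ℝ ℝ ℝ +
      ((-det3 p q r * (q.1 - p.1) : ℤ) : ℝ) • ContinuousLinearMap.snd ℝ ℝ ℝ
    have hl : ∀ i : ℤ × ℤ, l (toReal i) =
        ((det3 p q r * (q.2 - p.2) * i.1 + -det3 p q r * (q.1 - p.1) * i.2 : ℤ) : ℝ) := by
      intro i; simp [l]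
    refine ⟨l, (face_eq_edge ?_ ?_).symm⟩
    · rw [hl, hl, Int.cast_inj]; ring
    · rw [hl, hl, Int.cast_lt]
      have := sq_pos_of_ne_zero hd
      have e : det3 p q r = (q.1 - p.1) * (r.2 - p.2) - (q.2 - p.2) * (r.1 - p.1) := rfl
      have h2 : det3 p q r * det3 p q r =
        det3 p q r * ((q.1 - p.1) * (r.2 - p.2) - (q.2 - p.2) * (r.1 - p.1)) := by rw [← e]
      nlinarith
  · intro h
    have := toReal_injective h
    subst this
    simp [det3] at hd

/-- An exposed face is read off from the order of the values at the vertices. Three equal values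
give the whole triangle, which is not a segment, a single maximum gives a point, and two maxima give
an edge. -/
lemma setOf_isPolygonEdge {p q r : ℤ × ℤ} (hd : det3 p q r ≠ 0) :
    {δ | IsPolygonEdge (hull {p, q, r}) δ} = {hull {p, q}, hull {q, r}, hull {r, p}} := by
  have hd2 : det3 q r p ≠ 0 := by rwa [IsPrim.rotate]
  have hd3 : det3 r p q ≠ 0 := by rwa [IsPrim.rotate, IsPrim.rotate]
  ext δ
  constructor
  · rintro ⟨hexp, a, b, hab, rfl⟩
    obtain ⟨l, hl⟩ := hexp ⟨a, left_mem_segment ℝ a b⟩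
    have hl : segment ℝ a b = face (hull {p, q, r}) l := hl
    have hsing : ∀ c, ¬ segment ℝ a b ⊆ {c} := fun c h => hab
      ((h (left_mem_segment ℝ a b)).trans (h (right_mem_segment ℝ a b)).symm)
    have hne : ¬ (l (toReal p) = l (toReal q) ∧ l (toReal q) = l (toReal r)) := by
      rintro ⟨h1, h2⟩
      have hall : ∀ x ∈ hull {p, q, r}, l x = l (toReal p) := by
        intro x hx
        obtain ⟨a, b, c, ha, hb, hc, habc, rfl⟩ := mem_hull_triple.1 hx
        simp only [map_add, map_smul, smul_eq_mul, ← h2, ← h1]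
        rw [← add_mul, ← add_mul, habc, one_mul]
      have hsub : hull {p, q, r} ⊆ segment ℝ a b := by
        rw [hl]
        exact fun x hx => ⟨hx, fun y hy => by rw [hall x hx, hall y hy]⟩
      refine not_collinear_of_det (S := {p, q, r}) (by simp) (by simp) (by simp) hd
        ((collinear_convexHull (collinear_pair ℝ a b)).subset ?_)
      rw [convexHull_pair]
      rintro _ ⟨i, hi, rfl⟩
      exact hsub (toReal_mem_hull hi)
    have hr1 := hull_rotate p q r
    have hr2 := hull_rotate q r p
    rcases lt_trichotomy (l (toReal p)) (l (toReal q)) with h1 | h1 | h1 <;>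
      rcases lt_trichotomy (l (toReal q)) (l (toReal r)) with h2 | h2 | h2 <;>
      rcases lt_trichotomy (l (toReal r)) (l (toReal p)) with h3 | h3 | h3 <;>
      first
      | exact (hne ⟨h1, h2⟩).elim
      | (exfalso; linarith)
      | (left; rw [hl, face_eq_edge h1 h3])
      | (right; left; rw [hl, hr1, face_eq_edge h2 h1])
      | (right; right; rw [Set.mem_singleton_iff, hl, hr1, hr2, face_eq_edge h3 h2])
      | (exact absurd (hl.subset.trans (face_subset_singleton h1 h3)) (hsing _))
      | (exact absurd ((hl.trans (by rw [hr1])).subset.trans (face_subset_singleton h2 h1))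
          (hsing _))
      | (exact absurd ((hl.trans (by rw [hr1, hr2])).subset.trans (face_subset_singleton h3 h2))
          (hsing _))
  · rintro (rfl | rfl | rfl)
    · exact isPolygonEdge_hull_pair hd
    · rw [hull_rotate]; exact isPolygonEdge_hull_pair hd2
    · rw [hull_rotate, hull_rotate]; exact isPolygonEdge_hull_pair hd3

lemma segmentLength_hull_pair {p q r : ℤ × ℤ} (hd : |det3 p q r| = 1) :
    segmentLength (hull {p, q}) = 1 := by
  have : hull {p, q} ∩ Set.range toReal = {toReal p, toReal q} := by
    ext x
    constructor
    · rintro ⟨hx, s, rfl⟩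
      rcases mem_of_toReal_mem_hull hd (hull_mono (by intro i; simp; tauto) hx) with rfl | rfl | rfl
      · simp
      · simp
      · exact absurd hx (not_mem_hull_pair (det3_ne_zero_of_abs hd))
    · rintro (rfl | rfl)
      · exact ⟨toReal_mem_hull (by simp), p, rfl⟩
      · exact ⟨toReal_mem_hull (by simp), q, rfl⟩
  rw [segmentLength, this, Set.ncard_pair (toReal_injective.ne (det3_ne hd).1)]
  norm_num

/-- The contribution of the form `phi k` to the number `r_δ` of the edge `δ = [p, q]`. -/
def edgeWeight (p q r : ℤ × ℤ) (k : Fin 3) : ℝ :=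
  if phi k p = phi k q then (if phi k r < phi k p then 1 else 2) else 0

lemma form_eq (k : Fin 3) (x : ℝ × ℝ) :
    form k x = ((-(dir k).1 : ℤ) : ℝ) * x.1 + ((-(dir k).2 : ℤ) : ℝ) * x.2 := by
  fin_cases k <;> simp [form, dir]
  ring

lemma form_hull_eq_iff {p q : ℤ × ℤ} {k : Fin 3} :
    (∃ a, ∀ x ∈ hull {p, q}, form k x = a) ↔ phi k p = phi k q := by
  constructor
  · rintro ⟨a, h⟩
    have h1 := h _ (toReal_mem_hull (show p ∈ ({p, q} : Set (ℤ × ℤ)) by simp))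
    have h2 := h _ (toReal_mem_hull (show q ∈ ({p, q} : Set (ℤ × ℤ)) by simp))
    rw [form_toReal] at h1 h2
    exact_mod_cast h1.trans h2.symm
  · intro h
    refine ⟨phi k p, fun x hx => ?_⟩
    have e : ∀ i ∈ ({p, q} : Set (ℤ × ℤ)), ((-(dir k).1 : ℤ) : ℝ) * i.1 +
        ((-(dir k).2 : ℤ) : ℝ) * i.2 = phi k p := by
      intro i hi
      have := form_eq k (toReal i)
      rw [form_toReal] at this
      simp only [toReal_fst, toReal_snd] at this
      rw [← this]
      rcases hi with rfl | rfl
      · rfl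
      · rw [h]
    rw [form_eq]
    exact le_antisymm (hull_le (fun i hi => (e i hi).le) hx) (le_hull (fun i hi => (e i hi).ge) hx)

lemma form_hull_le_iff {p q r : ℤ × ℤ} {k : Fin 3} :
    (∃ a, (∀ x ∈ hull {p, q}, form k x = a) ∧ ∀ x ∈ hull {p, q, r}, form k x ≤ a) ↔
      phi k p = phi k q ∧ phi k r ≤ phi k p := by
  constructor
  · rintro ⟨a, h, h'⟩
    refine ⟨form_hull_eq_iff.1 ⟨a, h⟩, ?_⟩
    have h1 := h _ (toReal_mem_hull (show p ∈ ({p, q} : Set (ℤ × ℤ)) by simp))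
    have h2 := h' _ (toReal_mem_hull (show r ∈ ({p, q, r} : Set (ℤ × ℤ)) by simp))
    rw [form_toReal] at h1 h2
    exact_mod_cast h2.trans_eq h1.symm
  · rintro ⟨h, hr⟩
    obtain ⟨a, ha⟩ := form_hull_eq_iff.2 h
    refine ⟨a, ha, fun x hx => ?_⟩
    have h1 := ha _ (toReal_mem_hull (show p ∈ ({p, q} : Set (ℤ × ℤ)) by simp))
    rw [form_toReal] at h1
    rw [form_eq, ← h1]
    refine hull_le (fun i hi => ?_) hx
    have := form_eq k (toReal i)
    rw [form_toReal] at this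
    simp only [toReal_fst, toReal_snd] at this
    rw [← this, Int.cast_le]
    rcases hi with rfl | rfl | rfl
    exacts [le_rfl, h.ge, hr]

/-- An edge is parallel to at most one edge of T_1, so the existence of a suitable form k can be
replaced by a sum over k with at most one nonzero term. -/
lemma edgeDefect_hull {p q r : ℤ × ℤ} (hd : |det3 p q r| = 1) :
    edgeDefect (hull {p, q, r}) (hull {p, q}) = ∑ k, edgeWeight p q r k := by
  rw [edgeDefect, segmentLength_hull_pair hd]
  simp only [form_hull_le_iff, form_hull_eq_iff]
  by_cases h : ∃ k, phi k p = phi k q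
  · obtain ⟨k, hk⟩ := h
    have huniq : ∀ j, phi j p = phi j q → j = k := by
      intro j hj
      by_contra hne
      exact (det3_ne hd).1 (eq_of_phi_eq hne hj hk)
    rw [Finset.sum_eq_single k (fun j _ hj => by
      rw [edgeWeight, if_neg fun h => hj (huniq j h)]) (by simp)]
    rw [edgeWeight, if_pos hk]
    have hne := phi_third_ne (det3_ne_zero_of_abs hd) hk
    by_cases hr : phi k r < phi k p
    · rw [if_pos hr, if_pos ⟨k, hk, hr.le⟩]
    · rw [if_neg hr, if_neg, if_pos ⟨k, hk⟩, mul_one]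
      rintro ⟨j, hj, hj'⟩
      obtain rfl := huniq j hj
      exact hr (lt_of_le_of_ne hj' hne)
  · rw [if_neg fun ⟨k, hk, _⟩ => h ⟨k, hk⟩, if_neg h]
    exact (Finset.sum_eq_zero fun k _ => by
      rw [edgeWeight, if_neg fun hk => h ⟨k, hk⟩]).symm

/-- The number of edges of `A` of the first kind. -/
def maxCount (A : Finset (ℤ × ℤ)) : ℕ := (Finset.univ.filter fun k => MaxEdge A k).card

/-- The number of edges of `A` of the second kind. -/
def minCount (A : Finset (ℤ × ℤ)) : ℕ := (Finset.univ.filter fun k => MinEdge A k).card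

/-- This regroups the defects by form instead of by edge. For a given k at most one edge has
constant `phi k`, and the third vertex decides whether it is a maximum (weight 1) or a minimum
(weight 2). -/
lemma edgeWeight_sum {p q r : ℤ × ℤ} (hd : |det3 p q r| = 1) (k : Fin 3) :
    edgeWeight p q r k + edgeWeight q r p k + edgeWeight r p q k =
      (if MaxEdge {p, q, r} k then 1 else 0) + 2 * (if MinEdge {p, q, r} k then 1 else 0) := by
  obtain ⟨n1, n2, n3⟩ := det3_ne hd
  have hne : ¬ (phi k p = phi k q ∧ phi k q = phi k r) := fun h =>
    phi_third_ne (det3_ne_zero_of_abs hd) h.1 (h.2.symm.trans h.1.symm)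
  have hmax : MaxEdge {p, q, r} k ↔ (phi k p = phi k q ∧ phi k r ≤ phi k p) ∨
      (phi k q = phi k r ∧ phi k p ≤ phi k q) ∨ (phi k r = phi k p ∧ phi k q ≤ phi k r) := by
    simp [MaxEdge, n1, n2, n3, n1.symm, n2.symm, n3.symm]
    omega
  have hmin : MinEdge {p, q, r} k ↔ (phi k p = phi k q ∧ phi k p ≤ phi k r) ∨
      (phi k q = phi k r ∧ phi k q ≤ phi k p) ∨ (phi k r = phi k p ∧ phi k r ≤ phi k q) := by
    simp [MinEdge, n1, n2, n3, n1.symm, n2.symm, n3.symm]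
    omega
  simp only [hmax, hmin, edgeWeight]
  generalize phi k p = x at *
  generalize phi k q = y at *
  generalize phi k r = z at *
  rcases lt_trichotomy x y with h1 | h1 | h1 <;> rcases lt_trichotomy y z with h2 | h2 | h2 <;>
    rcases lt_trichotomy z x with h3 | h3 | h3 <;>
    first
    | (exfalso; omega)
    | (split_ifs <;> first | (exfalso; omega) | norm_num)

/-- The inflection number of a primitive triangle. -/
lemma IsPrim.inflNumber_eq {A : Finset (ℤ × ℤ)} (hA : IsPrim A) :
    inflNumber (hull A) = 3 - maxCount A - 2 * minCount A := by
  have harea := hA.area_eq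
  obtain ⟨p, q, r, rfl, hd⟩ := hA
  have hd0 := det3_ne_zero_of_abs hd
  have hd2 : |det3 q r p| = 1 := by rwa [IsPrim.rotate]
  have hd3 : |det3 r p q| = 1 := by rwa [IsPrim.rotate, IsPrim.rotate]
  have hcoe : (({p, q, r} : Finset (ℤ × ℤ)) : Set (ℤ × ℤ)) = {p, q, r} := by simp
  have e1 : hull {p, q} ∉ ({hull {q, r}, hull {r, p}} : Finset (Set (ℝ × ℝ))) := by
    simp only [Finset.mem_insert, Finset.mem_singleton]
    rintro (h | h)
    · exact not_mem_hull_pair hd0 (h ▸ toReal_mem_hull (by simp))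
    · exact not_mem_hull_pair hd0 (h ▸ toReal_mem_hull (by simp))
  have e2 : hull {q, r} ∉ ({hull {r, p}} : Finset (Set (ℝ × ℝ))) := by
    simp only [Finset.mem_singleton]
    intro h
    exact not_mem_hull_pair (det3_ne_zero_of_abs hd2) (h ▸ toReal_mem_hull (by simp))
  rw [hcoe] at harea
  have hset : ({hull {p, q}, hull {q, r}, hull {r, p}} : Set (Set (ℝ × ℝ))) =
      (({hull {p, q}, hull {q, r}, hull {r, p}} : Finset (Set (ℝ × ℝ))) : Set (Set (ℝ × ℝ))) := by
    simp
  rw [hcoe, inflNumber, harea, setOf_isPolygonEdge hd0, hset, finsum_mem_coe_finset,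
    Finset.sum_insert e1, Finset.sum_insert e2, Finset.sum_singleton, edgeDefect_hull hd]
  have h2 := edgeDefect_hull hd2
  have h3 := edgeDefect_hull hd3
  rw [← hull_rotate p q r] at h2
  rw [← hull_rotate q r p, ← hull_rotate p q r] at h3
  rw [h2, h3, ← add_assoc, ← Finset.sum_add_distrib, ← Finset.sum_add_distrib,
    Finset.sum_congr rfl fun k _ => edgeWeight_sum hd k, Finset.sum_add_distrib, ← Finset.mul_sum,
    Finset.sum_boole, Finset.sum_boole, maxCount, minCount]
  ring

/-- The lattice points of the edge of `T_d` on which `phi k` is minimal. -/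
def side (d : ℕ) (k : Fin 3) (j : ℤ) : ℤ × ℤ := ![(0, j), (d - j, 0), (j, d - j)] k

lemma side_add_one (d : ℕ) (k : Fin 3) (j : ℤ) : side d k (j + 1) = side d k j + edgeDir k := by
  fin_cases k <;> simp [side, edgeDir] <;> ring

lemma phi_side (d : ℕ) (k : Fin 3) (j : ℤ) : phi k (side d k j) = ![0, 0, -(d : ℤ)] k := by
  fin_cases k <;> simp [side, phi]
  ring

/-- The coordinate along the edge of `T_d` on which `phi k` is minimal. -/
def sideCoord (d : ℕ) (k : Fin 3) (i : ℤ × ℤ) : ℤ := ![i.2, d - i.1, i.1] k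

lemma sideCoord_side (d : ℕ) (k : Fin 3) (j : ℤ) : sideCoord d k (side d k j) = j := by
  fin_cases k <;> simp [side, sideCoord]

lemma eq_side {d : ℕ} {k : Fin 3} {i : ℤ × ℤ} (h : phi k i = ![0, 0, -(d : ℤ)] k) :
    i = side d k (sideCoord d k i) := by
  fin_cases k <;> simp [side, sideCoord, phi] at h ⊢ <;> ext <;> simp <;> linarith

lemma cast_sideCoord (d : ℕ) (k : Fin 3) (i : ℤ × ℤ) : (sideCoord d k i : ℝ) =
    ![0, (d : ℝ), 0] k + (![0, -1, 1] k * (toReal i).1 + ![1, 0, 0] k * (toReal i).2) := by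
  fin_cases k <;> simp [sideCoord]
  ring

lemma edgeDir_coord (k : Fin 3) : ((![0, -1, 1] k : ℝ) * (toReal (edgeDir k)).1 +
    ![1, 0, 0] k * (toReal (edgeDir k)).2) = 1 := by
  fin_cases k <;> simp [edgeDir]

/-- If the middle of two consecutive lattice points of a side lies in a lattice segment of the
side which is primitive, then the segment has these two points as its ends. -/
lemma eq_side_of_convex {d : ℕ} {k : Fin 3} {p : ℤ × ℤ} {j : ℤ} {b : ℝ} (hb0 : 0 ≤ b) (hb1 : b ≤ 1)
    (hp : phi k p = ![0, 0, -(d : ℤ)] k)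
    (h : toReal (side d k j) + (1 / 2 : ℝ) • toReal (edgeDir k) =
      toReal p + b • toReal (edgeDir k)) : p = side d k j := by
  have h1 := congrArg Prod.fst h
  have h2 := congrArg Prod.snd h
  simp only [Prod.fst_add, Prod.snd_add, Prod.smul_fst, Prod.smul_snd, smul_eq_mul] at h1 h2
  have e1 := cast_sideCoord d k (side d k j)
  have e2 := cast_sideCoord d k p
  have e3 := edgeDir_coord k
  rw [sideCoord_side] at e1
  have e4 : (j : ℝ) + 1 / 2 = sideCoord d k p + b := by
    linear_combination e1 - e2 + (![0, -1, 1] k : ℝ) * h1 + (![1, 0, 0] k : ℝ) * h2 +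
      (b - 1 / 2) * e3
  have e5 : sideCoord d k p = j := by
    have l1 : ((sideCoord d k p : ℤ) : ℝ) < j + 1 := by linarith
    have l2 : (j : ℝ) < (sideCoord d k p : ℤ) + 1 := by linarith
    have l1' : sideCoord d k p < j + 1 := by exact_mod_cast l1
    have l2' : j < sideCoord d k p + 1 := by exact_mod_cast l2
    omega
  rw [eq_side hp, e5]

lemma toReal_ne_mid {d : ℕ} {k : Fin 3} {p : ℤ × ℤ} {j : ℤ} (hp : phi k p = ![0, 0, -(d : ℤ)] k) :
    toReal (side d k j) + (1 / 2 : ℝ) • toReal (edgeDir k) ≠ toReal p := by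
  intro h
  obtain rfl := eq_side_of_convex (b := 0) le_rfl zero_le_one hp (by rw [h]; simp)
  have e3 := edgeDir_coord k
  rw [add_eq_left, smul_eq_zero] at h
  have h0 := h.resolve_left (by norm_num)
  rw [h0] at e3
  simp at e3

/-! ### Counting edges in the directions of a tropical line -/

namespace TropPoly

variable {P : TropPoly} {v : ℝ × ℝ} {k : Fin 3} {d : ℕ}

lemma side_zero_mem_support (hd : 0 < d) (hN : P.newtonPolygon = stdTriangle d) (k : Fin 3) :
    side d k 0 ∈ P.support := by
  obtain ⟨h0, h1, h2⟩ := corner_mem_support hd hN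
  fin_cases k <;> simpa [side]

lemma le_phi (hd : 0 < d) (hN : P.newtonPolygon = stdTriangle d) {i : ℤ × ℤ}
    (hi : i ∈ P.support) (k : Fin 3) : ![0, 0, -(d : ℤ)] k ≤ phi k i := by
  have := support_bounds hd hN hi
  fin_cases k <;> simp [phi] <;> omega

lemma sideCoord_bounds (hd : 0 < d) (hN : P.newtonPolygon = stdTriangle d) {i : ℤ × ℤ}
    (hi : i ∈ P.support) (k : Fin 3) : 0 ≤ sideCoord d k i ∧ sideCoord d k i ≤ d := by
  have := support_bounds hd hN hi
  fin_cases k <;> simp [sideCoord] <;> omega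

/-- Along an unbounded edge p stays active forever, so `phi k p` is minimal on the whole support.
That minimum is the value of `phi k` on a side of T_d. -/
lemma phi_eq_of_unboundedEdge (hd : 0 < d) (hN : P.newtonPolygon = stdTriangle d)
    (hP : P.NonSingular) (hv : P.IsVertex v) {p q : ℤ × ℤ} (h : P.MinPair v k p q)
    (hu : P.UnboundedEdge v (dir k)) : phi k p = ![0, 0, -(d : ℤ)] k := by
  have h1 := (h.of_unboundedEdge hP hv hu).1 _ (side_zero_mem_support hd hN k)
  rw [phi_side] at h1
  exact le_antisymm h1 (le_phi hd hN (active_subset _ h.left) k)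

lemma exists_side_of_unboundedEdge (hd : 0 < d) (hN : P.newtonPolygon = stdTriangle d)
    (hP : P.NonSingular) (hv : P.IsVertex v) (hu : P.UnboundedEdge v (dir k)) :
    ∃ j : ℕ, j < d ∧ P.MinPair v k (side d k j) (side d k (j + 1)) := by
  have key : ∀ p q, P.MinPair v k p q → q = p + edgeDir k →
      ∃ j : ℕ, j < d ∧ P.MinPair v k (side d k j) (side d k (j + 1)) := by
    intro p q h hq
    have hp := eq_side (phi_eq_of_unboundedEdge hd hN hP hv h hu)
    have b1 := sideCoord_bounds hd hN (active_subset _ h.left) k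
    have b2 := sideCoord_bounds hd hN (active_subset _ h.right) k
    obtain ⟨j, hj⟩ := Int.eq_ofNat_of_zero_le b1.1
    rw [hj] at hp
    have hp' : p = side d k j := hp
    rw [hp', ← side_add_one] at hq
    rw [hq, sideCoord_side] at b2
    refine ⟨j, by omega, ?_⟩
    rw [← hq, ← hp']
    exact h
  obtain ⟨p, q, h, -⟩ := hu.minPair hP hv
  obtain ⟨r, hr, hdet, -⟩ := h.exists_third hP hv
  rcases eq_add_edgeDir h.eq hdet with e | e
  · exact key p q h e
  · exact key q p h.symm e

/-- Both vertices lie on the face where p and q are active. This is the ray issued from v, and it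
contains no other vertex. -/
lemma MinPair.eq_of_unboundedEdge (hP : P.NonSingular) {w : ℝ × ℝ} {p q : ℤ × ℤ}
    (hv : P.IsVertex v) (hw : P.IsVertex w) (h : P.MinPair v k p q) (h' : P.MinPair w k p q)
    (hu : P.UnboundedEdge v (dir k)) : v = w := by
  have hmem : w ∈ {y | ({p, q} : Finset (ℤ × ℤ)) ⊆ P.active y} := by
    simp [Finset.insert_subset_iff, h'.left, h'.right]
  rw [h.setOf_eq hP hv] at hmem
  obtain ⟨t, ht, -, rfl⟩ := hmem
  rcases ht.eq_or_lt with rfl | ht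
  · exact (pointAt_zero _ _).symm
  · exact absurd hw (not_isVertex_of_subset_pair ((h.of_unboundedEdge hP hv hu).2 t ht).subset)

/-- The midpoint z of a unit segment of a side lies in some dual triangle. As `phi k` is minimal on
the side, only vertices of the triangle lying on it enter the barycentric expression of z. They are
not all three, by non-degeneracy, and not a single one, because z is not a lattice point. The two
remaining ones are consecutive, with z between them. -/
lemma exists_minPair_side (hd : 0 < d) (hN : P.newtonPolygon = stdTriangle d)
    (hP : P.NonSingular) (k : Fin 3) {j : ℕ} (hj : j < d) :
    ∃ v, P.IsVertex v ∧ P.MinPair v k (side d k j) (side d k (j + 1)) := by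
  set z := toReal (side d k j) + (1 / 2 : ℝ) • toReal (edgeDir k) with hz
  have hjR : (j : ℝ) + 1 ≤ d := by exact_mod_cast hj
  have hzT : z ∈ stdTriangle d := by
    rw [mem_stdTriangle hd, hz]
    have : (0 : ℝ) ≤ j := by positivity
    fin_cases k <;> simp [side, edgeDir] <;> (try constructor) <;> (try constructor) <;> linarith
  obtain ⟨v, hv, hzv⟩ := exists_isVertex_mem_dualCell hd hN hP hzT
  refine ⟨v, hv, ?_⟩
  obtain ⟨p, q, r, hA, hdet⟩ := IsVertex.isPrim hP hv
  have hge : ∀ i ∈ P.active v, ![0, 0, -(d : ℤ)] k ≤ phi k i := fun i hi =>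
    le_phi hd hN (active_subset _ hi) k
  have two : ∀ p q r : ℤ × ℤ, P.active v = {p, q, r} → |det3 p q r| = 1 →
      phi k p = ![0, 0, -(d : ℤ)] k → phi k q = ![0, 0, -(d : ℤ)] k →
      ∀ a b : ℝ, 0 ≤ a → 0 ≤ b → a + b = 1 → a • toReal p + b • toReal q = z →
      P.MinPair v k (side d k j) (side d k (j + 1)) := by
    intro p q r hA hdet hp hq a b ha hb hab e
    rcases eq_add_edgeDir (hp.trans hq.symm) hdet with h | h
    · have hpj : p = side d k j := by
        refine eq_side_of_convex (b := b) hb (by linarith) hp ?_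
        rw [← hz, ← e, h, toReal_add, smul_add, ← add_assoc, ← add_smul, hab, one_smul]
      rw [side_add_one, ← hpj, ← h]
      exact ⟨by simp [hA], by simp [hA], (det3_ne hdet).1, hp.trans hq.symm,
        fun s hs => hp ▸ hge s hs⟩
    · have hqj : q = side d k j := by
        refine eq_side_of_convex (b := a) ha (by linarith) hq ?_
        rw [← hz, ← e, h, toReal_add, smul_add, add_right_comm, ← add_smul, hab, one_smul]
      rw [side_add_one, ← hqj, ← h]
      exact ⟨by simp [hA], by simp [hA], (det3_ne hdet).1.symm, hq.trans hp.symm,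
        fun s hs => hq ▸ hge s hs⟩
  have hzv' : z ∈ hull {p, q, r} := by
    have : z ∈ hull (P.active v : Set (ℤ × ℤ)) := hzv
    rw [hA] at this
    simpa using this
  obtain ⟨a, b, c, ha, hb, hc, habc, e⟩ := mem_hull_triple.1 hzv'
  have hform : form k z = ((![0, 0, -(d : ℤ)] k : ℤ) : ℝ) := by
    rw [← phi_side d k j, ← form_toReal, hz, form_eq, form_eq]
    have h0 := form_eq k (toReal (edgeDir k))
    rw [form_toReal, phi_edgeDir] at h0
    simp only [Prod.fst_add, Prod.snd_add, Prod.smul_fst, Prod.smul_snd, smul_eq_mul]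
    push_cast at h0 ⊢
    linear_combination -(1 / 2 : ℝ) * h0
  have hlin : form k z = a * phi k p + b * phi k q + c * phi k r := by
    rw [← e, ← form_toReal, ← form_toReal, ← form_toReal, form_eq, form_eq, form_eq, form_eq]
    simp only [Prod.fst_add, Prod.snd_add, Prod.smul_fst, Prod.smul_snd, smul_eq_mul]
    ring
  set m := ![0, 0, -(d : ℤ)] k with hm
  have hp := hge p (by simp [hA])
  have hq := hge q (by simp [hA])
  have hr := hge r (by simp [hA])
  have hpR : (m : ℝ) ≤ phi k p := by exact_mod_cast hp
  have hqR : (m : ℝ) ≤ phi k q := by exact_mod_cast hq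
  have hrR : (m : ℝ) ≤ phi k r := by exact_mod_cast hr
  have hsum : a * (phi k p - m) + b * (phi k q - m) + c * (phi k r - m) = 0 := by
    have : (a + b + c) * (m : ℝ) = m := by rw [habc, one_mul]
    linarith
  have n1 := mul_nonneg ha (sub_nonneg.2 hpR)
  have n2 := mul_nonneg hb (sub_nonneg.2 hqR)
  have n3 := mul_nonneg hc (sub_nonneg.2 hrR)
  have conv : ∀ {t : ℝ} {i : ℤ × ℤ}, t * ((phi k i : ℝ) - m) = 0 → t = 0 ∨ phi k i = m := by
    intro t i h
    rcases mul_eq_zero.1 h with h | h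
    · exact Or.inl h
    · right; exact_mod_cast sub_eq_zero.1 h
  have c1 := conv (by linarith : a * ((phi k p : ℝ) - m) = 0)
  have c2 := conv (by linarith : b * ((phi k q : ℝ) - m) = 0)
  have c3 := conv (by linarith : c * ((phi k r : ℝ) - m) = 0)
  have d2 : |det3 q r p| = 1 := by rwa [IsPrim.rotate]
  have d3 : |det3 r p q| = 1 := by rwa [IsPrim.rotate, IsPrim.rotate]
  -- Each vertex has weight zero or lies on the side. The three cases with exactly two vertices on
  -- the side are the possible ones.
  rcases c1 with rfl | f1 <;> rcases c2 with rfl | f2 <;> rcases c3 with rfl | f3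
  · norm_num at habc
  · have : c = 1 := by linarith
    subst this
    exact absurd (by rw [← hz, ← e]; simp) (toReal_ne_mid (j := j) f3)
  · have : b = 1 := by linarith
    subst this
    exact absurd (by rw [← hz, ← e]; simp) (toReal_ne_mid (j := j) f2)
  · exact two q r p (by rw [hA]; ext; simp; tauto) d2 f2 f3 b c hb hc (by linarith)
      (by rw [← e]; simp)
  · have : a = 1 := by linarith
    subst this
    exact absurd (by rw [← hz, ← e]; simp) (toReal_ne_mid (j := j) f1)
  · exact two r p q (by rw [hA]; ext; simp; tauto) d3 f3 f1 c a hc ha (by linarith)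
      (by rw [← e]; simp [add_comm])
  · exact two p q r hA hdet f1 f2 a b ha hb (by linarith) (by rw [← e]; simp)
  · exact absurd (f3.trans f1.symm) (phi_third_ne (det3_ne_zero_of_abs hdet) (f1.trans f2.symm))

/-- A curve of degree `d` has `d` unbounded edges in each of the three directions. -/
lemma card_unbounded (hd : 0 < d) (hN : P.newtonPolygon = stdTriangle d) (hP : P.NonSingular)
    (k : Fin 3) : ((finite_setOf_isVertex hP).toFinset.filter fun v =>
      MinEdge (P.active v) k ∧ k ∉ P.boundedDirs v).card = d := by
  have hS : ∀ v ∈ (finite_setOf_isVertex hP).toFinset.filter fun v =>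
      MinEdge (P.active v) k ∧ k ∉ P.boundedDirs v,
      P.IsVertex v ∧ P.UnboundedEdge v (dir k) := by
    intro v hv
    simp only [Finset.mem_filter, Set.Finite.mem_toFinset] at hv
    exact ⟨hv.1, unboundedEdge_of_not_mem hP hv.1 hv.2.1 hv.2.2⟩
  have hex : ∀ v, v ∈ ((finite_setOf_isVertex hP).toFinset.filter fun v =>
      MinEdge (P.active v) k ∧ k ∉ P.boundedDirs v) →
      ∃ j : ℕ, j < d ∧ P.MinPair v k (side d k j) (side d k (j + 1)) := fun v hv =>
    exists_side_of_unboundedEdge hd hN hP (hS v hv).1 (hS v hv).2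
  -- To a vertex corresponds the position j of the unit segment of the side dual to its unbounded
  -- edge.
  choose! f hf using hex
  conv_rhs => rw [← Finset.card_range d]
  refine Finset.card_nbij f (fun v hv => Finset.mem_coe.2 (Finset.mem_range.2 (hf v hv).1)) ?_ ?_
  · intro v hv w hw e
    have h1 := (hf v hv).2
    have h2 := (hf w hw).2
    rw [← e] at h2
    exact h1.eq_of_unboundedEdge hP (hS v hv).1 (hS w hw).1 h2 (hS v hv).2
  · intro j hj
    obtain ⟨v, hv, h⟩ := exists_minPair_side hd hN hP k (Finset.mem_range.1 hj)
    have hu : P.UnboundedEdge v (dir k) := by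
      rcases h.unboundedEdge_or hP hv with h' | ⟨l, -, -, s, hs, -, hlt⟩
      · exact h'.1
      · rw [phi_side] at hlt
        exact absurd (le_phi hd hN (active_subset _ (show s ∈ P.active _ by rw [hs]; simp)) k)
          hlt.not_ge
    have hmem : v ∈ (finite_setOf_isVertex hP).toFinset.filter fun v =>
        MinEdge (P.active v) k ∧ k ∉ P.boundedDirs v := by
      simp only [Finset.mem_filter, Set.Finite.mem_toFinset]
      refine ⟨hv, minEdge_iff.2 ⟨_, _, h⟩, fun hk => ?_⟩
      obtain ⟨l, hl⟩ := mem_boundedDirs.1 hk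
      exact hl.not_unboundedEdge hP hv hu
    refine ⟨v, hmem, ?_⟩
    have h2 := (hf v hmem).2
    have hsub := (h.subset_pair hP hv h2) (Finset.mem_insert_self _ _)
    have hsub2 := (h.subset_pair hP hv h2) (Finset.mem_insert_of_mem (Finset.mem_singleton_self _))
    simp only [Finset.mem_insert, Finset.mem_singleton] at hsub hsub2
    have inj : ∀ {a b : ℤ}, side d k a = side d k b → a = b := fun h => by
      have := congrArg (sideCoord d k) h
      rwa [sideCoord_side, sideCoord_side] at this
    rcases hsub with h3 | h3 <;> rcases hsub2 with h4 | h4 <;> have h3 := inj h3 <;>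
      have h4 := inj h4 <;> omega

/-- On T_d each form `phi k` is maximal at a single corner. Hence no unbounded edge runs opposite to
`dir k`. -/
lemma not_forall_phi_le (hd : 0 < d) (hN : P.newtonPolygon = stdTriangle d) {p q : ℤ × ℤ}
    (hp : p ∈ P.support) (hq : q ∈ P.support) (hpq : p ≠ q) (h : phi k p = phi k q) :
    ¬ ∀ s ∈ P.support, phi k s ≤ phi k p := by
  intro hall
  apply hpq
  obtain ⟨c0, c1, c2⟩ := corner_mem_support hd hN
  have b1 := support_bounds hd hN hp
  have b2 := support_bounds hd hN hq
  have h0 := hall _ c0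
  have h1 := hall _ c1
  have h2 := hall _ c2
  fin_cases k <;> simp [phi] at h h0 h1 h2 <;> ext <;> omega

/-- A vertex at which `phi k` is maximal on an edge is the far end of a bounded edge. -/
lemma exists_boundedEdge_of_maxEdge (hd : 0 < d) (hN : P.newtonPolygon = stdTriangle d)
    (hP : P.NonSingular) {w : ℝ × ℝ} (hw : P.IsVertex w) (h : MaxEdge (P.active w) k) :
    ∃ v l, P.IsVertex v ∧ P.BoundedEdge v (dir k) l ∧ pointAt v (dir k) l = w := by
  obtain ⟨p, hp, q, hq, hpq, e, hmax⟩ := h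
  have hpair : ∀ i, pair i (-toReal (dir k)) = phi k i := by
    intro i
    have := pair_dir k i
    simp only [pair, Prod.fst_neg, Prod.snd_neg] at this ⊢
    linarith
  -- Walk backwards from w. Never being overtaken would make p and q two maxima of `phi k` on the
  -- support, so a starting vertex v is reached at some distance l.
  rcases active_forever_or_exists (h := -toReal (dir k)) hp (fun s hs => by
    rw [hpair, hpair]; exact_mod_cast hmax s hs) with ⟨hall, -⟩ | ⟨l, hl, hpl, s, hs, hlt⟩
  · exfalso
    refine not_forall_phi_le hd hN (active_subset _ hp) (active_subset _ hq) hpq e fun s hs => ?_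
    have := hall s hs
    rw [hpair, hpair] at this
    exact_mod_cast this
  rw [hpair, hpair, Int.cast_lt] at hlt
  have hql : q ∈ P.active (w + l • -toReal (dir k)) := by
    refine mem_active_of_term_eq hpl (active_subset _ hq) ?_
    rw [term_add_smul, term_add_smul, term_eq_of_mem_active hp hq, hpair, hpair, e]
  set v := w + l • -toReal (dir k) with hvdef
  have hwv : pointAt v (dir k) l = w := by rw [hvdef, pointAt]; simp
  have hv : P.IsVertex v := isVertex_of_det hpl hql hs (det3_ne_zero_of_phi hpq e hlt.ne')
  have hm : P.MinPair v k p q := by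
    refine ⟨hpl, hql, hpq, e, fun i hi => ?_⟩
    obtain ⟨r, hr, hdet⟩ := (IsVertex.isPrim hP hv).exists_third hpl hql hpq
    have hs' := hs
    rw [hr] at hi hs'
    simp only [Finset.mem_insert, Finset.mem_singleton] at hi hs'
    have hsr : s = r := by
      rcases hs' with rfl | rfl | h
      · exact absurd hlt (lt_irrefl _)
      · exact absurd e hlt.ne
      · exact h
    rcases hi with rfl | rfl | rfl
    · exact le_rfl
    · exact e.le
    · rw [← hsr]; exact hlt.le
  have hnot : ∀ x, P.active x = {p, q} → ¬ P.IsVertex x := fun x hx =>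
    not_isVertex_of_subset_pair hx.subset
  -- The edge leaving v has length exactly l, because neither w nor its own far end can be an
  -- interior point of an edge.
  rcases hm.unboundedEdge_or hP hv with ⟨-, -, hact⟩ | ⟨l', hb, hact, -⟩
  · exact absurd hw (hnot _ (hwv ▸ hact l hl))
  · have hle : l' ≤ l := by
      by_contra! hlt'
      exact hnot _ (hact l hl hlt') (hwv.symm ▸ hw)
    have hge : l ≤ l' := by
      by_contra! hlt'
      refine hnot _ (hm.active_between hP hv (l := l) ?_ hb.2.1 hlt') (hb.isVertex_end hP hv)
      rw [hwv]; exact hp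
    exact ⟨v, l', hv, hb, by rw [le_antisymm hle hge, hwv]⟩

lemma BoundedEdge.maxEdge (hP : P.NonSingular) (hv : P.IsVertex v) {l : ℝ}
    (h : P.BoundedEdge v (dir k) l) : MaxEdge (P.active (pointAt v (dir k) l)) k := by
  obtain ⟨p, q, hpq, -⟩ := h.minPair hP hv
  obtain ⟨-, s, hs, -, hlt⟩ := hpq.of_boundedEdge hP hv h
  rw [hs]
  refine ⟨p, by simp, q, by simp, hpq.ne, hpq.eq, fun i hi => ?_⟩
  simp only [Finset.mem_insert, Finset.mem_singleton] at hi
  rcases hi with rfl | rfl | rfl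
  exacts [le_rfl, hpq.eq.ge, hlt.le]

/-- Otherwise the lengths differ, and the start of the shorter edge is a vertex in the interior of
the longer one. -/
lemma BoundedEdge.eq_of_end_eq (hP : P.NonSingular) {w : ℝ × ℝ} (hv : P.IsVertex v)
    (hw : P.IsVertex w) {l l' : ℝ} (h : P.BoundedEdge v (dir k) l)
    (h' : P.BoundedEdge w (dir k) l') (e : pointAt v (dir k) l = pointAt w (dir k) l') :
    v = w := by
  have aux : ∀ {v w : ℝ × ℝ} {l l' : ℝ}, P.IsVertex v → P.IsVertex w →
      P.BoundedEdge v (dir k) l → P.BoundedEdge w (dir k) l' →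
      pointAt v (dir k) l = pointAt w (dir k) l' → l' ≤ l := by
    intro v w l l' hv hw h h' e
    by_contra! hlt
    obtain ⟨p, q, hpq, -⟩ := h'.minPair hP hw
    have hact := (hpq.of_boundedEdge hP hw h').1 (l' - l) (sub_pos.2 hlt) (by linarith [h.2.1])
    have : pointAt w (dir k) (l' - l) = v := by
      simp only [pointAt, sub_smul] at e ⊢
      rw [← add_sub_assoc, ← e]; abel
    exact not_isVertex_of_subset_pair hact.subset (this.symm ▸ hv)
  have hll : l = l' := le_antisymm (aux hw hv h' h e.symm) (aux hv hw h h' e)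
  rw [hll, pointAt, pointAt] at e
  exact add_right_cancel e

/-- Every bounded edge parallel to a ray of a tropical line has one end of each kind. -/
lemma card_maxEdge (hd : 0 < d) (hN : P.newtonPolygon = stdTriangle d) (hP : P.NonSingular)
    (k : Fin 3) : ((finite_setOf_isVertex hP).toFinset.filter fun v => MaxEdge (P.active v) k).card =
      ((finite_setOf_isVertex hP).toFinset.filter fun v => k ∈ P.boundedDirs v).card := by
  symm
  refine Finset.card_nbij (fun v => pointAt v (dir k) (P.edgeLen v k)) ?_ ?_ ?_
  · intro v hv
    simp only [Finset.coe_filter, Set.Finite.mem_toFinset, Set.mem_ofPred_eq] at hv ⊢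
    have hb := boundedEdge_edgeLen hv.2
    exact ⟨hb.isVertex_end hP hv.1, hb.maxEdge hP hv.1⟩
  · intro v hv w hw e
    simp only [Finset.coe_filter, Set.Finite.mem_toFinset, Set.mem_ofPred_eq] at hv hw
    exact (boundedEdge_edgeLen hv.2).eq_of_end_eq hP hv.1 hw.1 (boundedEdge_edgeLen hw.2) e
  · intro w hw
    simp only [Finset.coe_filter, Set.Finite.mem_toFinset, Set.mem_ofPred_eq] at hw
    obtain ⟨v, l, hv, hb, e⟩ := exists_boundedEdge_of_maxEdge hd hN hP hw.1 hw.2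
    refine ⟨v, ?_, ?_⟩
    · simp only [Finset.coe_filter, Set.Finite.mem_toFinset, Set.mem_ofPred_eq]
      exact ⟨hv, mem_boundedDirs.2 ⟨l, hb⟩⟩
    · simp only [← hb.eq_edgeLen hP hv, e]

lemma sum_card_filter {α : Type*} (V : Finset α) (p : α → Fin 3 → Prop)
    [∀ v k, Decidable (p v k)] :
    ∑ v ∈ V, (Finset.univ.filter fun k => p v k).card =
      ∑ k, (V.filter fun v => p v k).card := by
  simp only [Finset.card_filter]
  exact Finset.sum_comm

/-- The sum of the local contributions of the vertices. -/
lemma sum_contributions (hd : 0 < d) (hN : P.newtonPolygon = stdTriangle d) (hP : P.NonSingular) :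
    ∑ v ∈ (finite_setOf_isVertex hP).toFinset, ((3 : ℝ) - maxCount (P.active v) -
      2 * minCount (P.active v) + 3 * (P.boundedDirs v).card) = 3 * d * (d - 2) := by
  classical
  set V := (finite_setOf_isVertex hP).toFinset with hV
  have hmax : ∑ v ∈ V, maxCount (P.active v) = ∑ v ∈ V, (P.boundedDirs v).card := by
    have e : ∀ v, (P.boundedDirs v).card =
        (Finset.univ.filter fun k => k ∈ P.boundedDirs v).card := by
      intro v; congr 1; ext; simp
    simp only [maxCount, e]
    rw [sum_card_filter, sum_card_filter]
    exact Finset.sum_congr rfl fun k _ => card_maxEdge hd hN hP k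
  -- Leaving edges are either bounded or unbounded, and there are d unbounded ones for each k.
  have hmin : ∑ v ∈ V, minCount (P.active v) = ∑ v ∈ V, (P.boundedDirs v).card + 3 * d := by
    have e : ∀ v ∈ V, minCount (P.active v) = (P.boundedDirs v).card +
        (Finset.univ.filter fun k => MinEdge (P.active v) k ∧ k ∉ P.boundedDirs v).card := by
      intro v hv
      have hv' : P.IsVertex v := by simpa [hV] using hv
      rw [minCount, ← Finset.card_union_of_disjoint]
      · congr 1
        ext k
        simp only [Finset.mem_filter, Finset.mem_univ, true_and, Finset.mem_union]
        have := boundedDirs_subset (k := k) hP hv'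
        tauto
      · rw [Finset.disjoint_left]
        intro k hk hk'
        exact (Finset.mem_filter.1 hk').2.2 hk
    rw [Finset.sum_congr rfl e, Finset.sum_add_distrib, sum_card_filter V fun v k =>
      MinEdge (P.active v) k ∧ k ∉ P.boundedDirs v]
    congr 1
    rw [Finset.sum_congr rfl fun k _ => ?_, Finset.sum_const, Finset.card_univ, Fintype.card_fin,
      smul_eq_mul]
    convert card_unbounded hd hN hP k
  have hcard : V.card = d ^ 2 := card_vertices hd hN hP
  have hmaxR : ∑ v ∈ V, (maxCount (P.active v) : ℝ) = ∑ v ∈ V, ((P.boundedDirs v).card : ℝ) := by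
    exact_mod_cast hmax
  have hminR : ∑ v ∈ V, (minCount (P.active v) : ℝ) =
      ∑ v ∈ V, ((P.boundedDirs v).card : ℝ) + 3 * d := by
    exact_mod_cast hmin
  rw [Finset.sum_add_distrib, Finset.sum_sub_distrib, Finset.sum_sub_distrib, ← Finset.mul_sum,
    ← Finset.mul_sum, hmaxR, hminR, Finset.sum_const, hcard, nsmul_eq_mul]
  push_cast
  ring

/-- In degree at least two, a vertex dual to `T_1` is adjacent to a bounded edge. -/
lemma boundedDirs_nonempty_of_unitAt (hd : 2 ≤ d) (hN : P.newtonPolygon = stdTriangle d)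
    (hP : P.NonSingular) (hv : P.IsVertex v) {a : ℤ × ℤ} (ha : P.active v = unitAt a) :
    (P.boundedDirs v).Nonempty := by
  by_contra hne
  rw [Finset.not_nonempty_iff_eq_empty] at hne
  -- Without bounded edges, each edge of the triangle would lie on the corresponding side of T_d,
  -- which forces T_1 = T_d and d = 1.
  have key : ∀ k, ∀ i ∈ P.active v, (∀ s ∈ P.active v, phi k i ≤ phi k s) →
      phi k i = ![0, 0, -(d : ℤ)] k := by
    intro k i hi hmin
    have hk : MinEdge (P.active v) k := ha ▸ (unitAt_edges a k).1
    obtain ⟨p, q, h⟩ := minEdge_iff.1 hk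
    have hu := unboundedEdge_of_not_mem hP hv hk (by simp [hne])
    rw [← phi_eq_of_unboundedEdge (by omega) hN hP hv h hu]
    exact le_antisymm (hmin p h.left) (h.le i hi)
  have h0 := key 0 a (by simp [ha, unitAt]) (by simp [ha, unitAt, phi])
  have h1 := key 1 a (by simp [ha, unitAt]) (by simp [ha, unitAt, phi])
  have h2 := key 2 (a + (1, 0)) (by simp [ha, unitAt]) (by simp [ha, unitAt, phi]; omega)
  simp [phi] at h0 h1 h2
  omega

end TropPoly
namespace TropPoly

variable {P : TropPoly} {v : ℝ × ℝ} {k : Fin 3}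

/-! ### Stars of vertices -/

/-- The vertex `v` together with the half-open edges which leave it in the directions of a
tropical line. -/
def star (P : TropPoly) (v : ℝ × ℝ) : Set (ℝ × ℝ) :=
  {x | x = v ∨ ∃ k t, 0 < t ∧ x = pointAt v (dir k) t ∧
    (P.UnboundedEdge v (dir k) ∨ ∃ l, P.BoundedEdge v (dir k) l ∧ t < l)}

lemma self_mem_star (P : TropPoly) (v : ℝ × ℝ) : v ∈ P.star v := Or.inl rfl

lemma pointAt_mem_star {t : ℝ} (hk : k ∈ P.boundedDirs v) (h0 : 0 < t) (h1 : t < P.edgeLen v k) :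
    pointAt v (dir k) t ∈ P.star v :=
  Or.inr ⟨k, t, h0, rfl, Or.inr ⟨_, boundedEdge_edgeLen hk, h1⟩⟩

lemma exists_active_of_interior (hP : P.NonSingular) (hv : P.IsVertex v) {t : ℝ} (ht : 0 < t)
    (h : P.UnboundedEdge v (dir k) ∨ ∃ l, P.BoundedEdge v (dir k) l ∧ t < l) :
    ∃ p q, P.MinPair v k p q ∧ P.active (pointAt v (dir k) t) = {p, q} := by
  rcases h with h | ⟨l, h, hl⟩
  · obtain ⟨p, q, hpq, -⟩ := h.minPair hP hv
    exact ⟨p, q, hpq, (hpq.of_unboundedEdge hP hv h).2 t ht⟩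
  · obtain ⟨p, q, hpq, -⟩ := h.minPair hP hv
    exact ⟨p, q, hpq, (hpq.of_boundedEdge hP hv h).1 t ht hl⟩

lemma not_isVertex_of_interior (hP : P.NonSingular) (hv : P.IsVertex v) {t : ℝ}
    (hk : k ∈ P.boundedDirs v) (h0 : 0 < t) (h1 : t < P.edgeLen v k) :
    ¬ P.IsVertex (pointAt v (dir k) t) := by
  obtain ⟨p, q, -, e⟩ := exists_active_of_interior hP hv h0
    (Or.inr ⟨_, boundedEdge_edgeLen hk, h1⟩)
  exact not_isVertex_of_subset_pair e.subset

/-- At an interior point of a leaving edge the active set is a pair {p, q}, so the point is not a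
vertex, and the pair determines k. If two stars share such a point, each centre lies on the ray `dir
k` issued from the other, so the centres agree. The far ends must be excluded from the stars, being
centres of other stars. -/
lemma disjoint_star (hP : P.NonSingular) {w : ℝ × ℝ} (hv : P.IsVertex v) (hw : P.IsVertex w)
    (hvw : v ≠ w) : Disjoint (P.star v) (P.star w) := by
  rw [Set.disjoint_left]
  rintro x (rfl | ⟨k, t, ht, rfl, h⟩) hx
  · rcases hx with h | ⟨k, t, ht, e, h⟩
    · exact hvw h
    · obtain ⟨p, q, -, e'⟩ := exists_active_of_interior hP hw ht h
      exact not_isVertex_of_subset_pair e'.subset (e ▸ hv)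
  · obtain ⟨p, q, hpq, e⟩ := exists_active_of_interior hP hv ht h
    rcases hx with rfl | ⟨k', t', ht', e1, h'⟩
    · exact not_isVertex_of_subset_pair e.subset hw
    · obtain ⟨p', q', hpq', e'⟩ := exists_active_of_interior hP hw ht' h'
      rw [← e1, e] at e'
      have hp' : p' ∈ ({p, q} : Finset (ℤ × ℤ)) := by rw [e']; simp
      have hq' : q' ∈ ({p, q} : Finset (ℤ × ℤ)) := by rw [e']; simp
      have hkk : k = k' := by
        by_contra hne
        refine hpq'.ne (eq_of_phi_eq hne ?_ hpq'.eq)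
        simp only [Finset.mem_insert, Finset.mem_singleton] at hp' hq'
        have := hpq.eq
        rcases hp' with rfl | rfl <;> rcases hq' with rfl | rfl <;> simp [this]
      subst hkk
      have m1 : w ∈ {y | ({p, q} : Finset (ℤ × ℤ)) ⊆ P.active y} := by
        change ({p, q} : Finset (ℤ × ℤ)) ⊆ P.active w
        rw [e']
        simp [Finset.insert_subset_iff, hpq'.left, hpq'.right]
      have m2 : v ∈ {y | ({p', q'} : Finset (ℤ × ℤ)) ⊆ P.active y} := by
        change ({p', q'} : Finset (ℤ × ℤ)) ⊆ P.active v
        rw [← e']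
        simp [Finset.insert_subset_iff, hpq.left, hpq.right]
      rw [hpq.setOf_eq hP hv] at m1
      rw [hpq'.setOf_eq hP hw] at m2
      obtain ⟨s, hs, -, es⟩ := m1
      obtain ⟨s', hs', -, es'⟩ := m2
      have h0 : pointAt v (dir k) (s + s') = pointAt v (dir k) 0 := by
        rw [← pointAt_add, ← es, ← es', pointAt_zero]
      have h1 := pointAt_dir_injective v k h0
      have h2 : s = 0 := by linarith
      rw [h2, pointAt_zero] at es
      exact hvw es.symm

/-! ### The loci attached to the vertices -/

/-- The closed edge which leaves `v` in the direction `dir k`. -/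
def closedEdge (P : TropPoly) (v : ℝ × ℝ) (k : Fin 3) : Set (ℝ × ℝ) :=
  {x | ∃ t, 0 ≤ t ∧ x = pointAt v (dir k) t ∧
    (P.UnboundedEdge v (dir k) ∨ ∃ l, P.BoundedEdge v (dir k) l ∧ t ≤ l)}

lemma closedEdge_eq_seg (hP : P.NonSingular) (hv : P.IsVertex v) (hk : k ∈ P.boundedDirs v) :
    P.closedEdge v k = seg v (dir k) (P.edgeLen v k) := by
  have hb := boundedEdge_edgeLen hk
  ext x
  rw [mem_seg hb.2.1]
  constructor
  · rintro ⟨t, ht, rfl, h | ⟨l, h, hl⟩⟩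
    · exact absurd h (hb.not_unboundedEdge hP hv)
    · exact ⟨t, ht, (h.eq_edgeLen hP hv) ▸ hl, rfl⟩
  · rintro ⟨t, ht, hl, rfl⟩
    exact ⟨t, ht, rfl, Or.inr ⟨_, hb, hl⟩⟩

lemma closedEdge_eq_ray (h : P.UnboundedEdge v (dir k)) :
    P.closedEdge v k = ray v (dir k) := by
  ext x
  exact ⟨fun ⟨t, ht, e, _⟩ => ⟨t, ht, e⟩, fun ⟨t, ht, e⟩ => ⟨t, ht, e, Or.inl h⟩⟩

lemma mem_closedEdge_self (hP : P.NonSingular) (hv : P.IsVertex v)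
    (hk : MinEdge (P.active v) k) : v ∈ P.closedEdge v k := by
  refine ⟨0, le_rfl, (pointAt_zero _ _).symm, ?_⟩
  rcases (minEdge_iff_edge hP hv).1 hk with h | ⟨l, h⟩
  · exact Or.inl h
  · exact Or.inr ⟨l, h, h.2.1.le⟩

lemma mem_lineComp_iff_closedEdge (hP : P.NonSingular) (hv : P.IsVertex v) {x : ℝ × ℝ} :
    x ∈ P.lineComp v ↔ x = v ∨ ∃ k, x ∈ P.closedEdge v k := by
  rw [mem_lineComp hP hv]
  constructor
  · rintro (h | ⟨k, t, ht, e, h⟩)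
    · exact Or.inl h
    · exact Or.inr ⟨k, t, ht.le, e, h⟩
  · rintro (h | ⟨k, t, ht, e, h⟩)
    · exact Or.inl h
    · rcases ht.eq_or_lt with rfl | ht
      · exact Or.inl (by rw [e, pointAt_zero])
      · exact Or.inr ⟨k, t, ht, e, h⟩

lemma minEdge_of_mem_closedEdge (hP : P.NonSingular) (hv : P.IsVertex v) {x : ℝ × ℝ}
    (h : x ∈ P.closedEdge v k) : MinEdge (P.active v) k := by
  obtain ⟨t, -, -, h | ⟨l, h, -⟩⟩ := h
  · exact (minEdge_iff_edge hP hv).2 (Or.inl h)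
  · exact (minEdge_iff_edge hP hv).2 (Or.inr ⟨l, h⟩)

lemma lineComp_eq_singleton (hP : P.NonSingular) (hv : P.IsVertex v)
    (h : ∀ j, ¬ MinEdge (P.active v) j) : P.lineComp v = {v} := by
  ext x
  rw [mem_lineComp_iff_closedEdge hP hv]
  exact ⟨fun hx => hx.resolve_right fun ⟨k, hk⟩ => h k (minEdge_of_mem_closedEdge hP hv hk),
    fun hx => Or.inl hx⟩

lemma lineComp_eq_closedEdge (hP : P.NonSingular) (hv : P.IsVertex v)
    (h : ∀ j, MinEdge (P.active v) j ↔ j = k) : P.lineComp v = P.closedEdge v k := by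
  ext x
  rw [mem_lineComp_iff_closedEdge hP hv]
  constructor
  · rintro (rfl | ⟨j, hj⟩)
    · exact mem_closedEdge_self hP hv ((h k).2 rfl)
    · exact (h j).1 (minEdge_of_mem_closedEdge hP hv hj) ▸ hj
  · exact fun hx => Or.inr ⟨k, hx⟩

lemma eq_of_ne_of_ne {a b c j : Fin 3} (hab : a ≠ b) (hac : a ≠ c) (hbc : b ≠ c) :
    j = a ∨ j = b ∨ j = c := by
  omega

lemma lineComp_eq_union (hP : P.NonSingular) (hv : P.IsVertex v)
    (h : ∀ j, MinEdge (P.active v) j) {a b c : Fin 3} (hab : a ≠ b) (hac : a ≠ c) (hbc : b ≠ c) :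
    P.lineComp v = P.closedEdge v a ∪ P.closedEdge v b ∪ P.closedEdge v c := by
  ext x
  rw [mem_lineComp_iff_closedEdge hP hv]
  constructor
  · rintro (rfl | ⟨j, hj⟩)
    · exact Or.inl (Or.inl (mem_closedEdge_self hP hv (h a)))
    · rcases eq_of_ne_of_ne (j := j) hab hac hbc with rfl | rfl | rfl
      · exact Or.inl (Or.inl hj)
      · exact Or.inl (Or.inr hj)
      · exact Or.inr hj
  · rintro ((hx | hx) | hx) <;> exact Or.inr ⟨_, hx⟩

/-- `IsLocus` allows arbitrary primitive directions u. If u points into the component it is a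
positive multiple of some `dir k`, and primitivity makes it equal to it. -/
lemma eq_dir_of_mem_lineComp (hP : P.NonSingular) (hv : P.IsVertex v) {u : ℤ × ℤ}
    (hu : IsCoprime u.1 u.2) {t : ℝ} (ht : 0 < t) (h : pointAt v u t ∈ P.lineComp v) :
    ∃ k, u = dir k := by
  have habs : ∀ {a : ℤ}, IsUnit a → a = 1 ∨ a = -1 := fun h => Int.isUnit_iff.1 h
  rcases (mem_lineComp hP hv).1 h with h | ⟨k, s, hs, e, -⟩
  · exfalso
    have h1 := congrArg Prod.fst h
    have h2 := congrArg Prod.snd h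
    simp [pointAt, ht.ne'] at h1 h2
    rw [h1, h2] at hu
    exact not_isCoprime_zero_zero hu
  · refine ⟨k, ?_⟩
    have h1 := congrArg Prod.fst e
    have h2 := congrArg Prod.snd e
    fin_cases k <;> simp [pointAt, dir, ht.ne'] at h1 h2 ⊢
    · rw [h2, isCoprime_zero_right] at hu
      rcases habs hu with h3 | h3
      · rw [h3] at h1; push_cast at h1; linarith
      · exact Prod.ext h3 h2
    · rw [h1, isCoprime_zero_left] at hu
      rcases habs hu with h3 | h3
      · rw [h3] at h2; push_cast at h2; linarith
      · exact Prod.ext h1 h3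
    · have h4 : u.1 = u.2 := by
        have : t * (u.1 : ℝ) = t * u.2 := by rw [h1, h2]
        exact_mod_cast mul_left_cancel₀ ht.ne' this
      rw [h4, isCoprime_self] at hu
      rcases habs hu with h3 | h3
      · exact Prod.ext (h4.trans h3) h3
      · rw [h3] at h2; push_cast at h2; linarith

lemma BoundedEdge.exists_dir (hP : P.NonSingular) (hv : P.IsVertex v) {u : ℤ × ℤ} {l : ℝ}
    (h : P.BoundedEdge v u l) (hE : seg v u l ⊆ P.lineComp v) :
    ∃ k, u = dir k ∧ k ∈ P.boundedDirs v ∧ l = P.edgeLen v k := by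
  obtain ⟨k, rfl⟩ := eq_dir_of_mem_lineComp hP hv h.1 h.2.1 (hE (pointAt_mem_seg v u l))
  exact ⟨k, rfl, mem_boundedDirs.2 ⟨l, h⟩, h.eq_edgeLen hP hv⟩

lemma UnboundedEdge.exists_dir (hP : P.NonSingular) (hv : P.IsVertex v) {u : ℤ × ℤ}
    (h : P.UnboundedEdge v u) (hE : ray v u ⊆ P.lineComp v) :
    ∃ k, u = dir k ∧ k ∉ P.boundedDirs v ∧ P.UnboundedEdge v (dir k) := by
  obtain ⟨k, rfl⟩ := eq_dir_of_mem_lineComp hP hv h.1 one_pos (hE ⟨1, zero_le_one, rfl⟩)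
  refine ⟨k, rfl, fun hk => ?_, h⟩
  exact (boundedEdge_edgeLen hk).not_unboundedEdge hP hv h

lemma exists_mem_lineComp (hP : P.NonSingular) (hv : P.IsVertex v)
    (hk : MinEdge (P.active v) k) : ∃ t, 0 < t ∧ pointAt v (dir k) t ∈ P.lineComp v := by
  rcases (minEdge_iff_edge hP hv).1 hk with h | ⟨l, h⟩
  · exact ⟨1, one_pos, (mem_lineComp hP hv).2 (Or.inr ⟨k, 1, one_pos, rfl, Or.inl h⟩)⟩
  · exact ⟨l, h.2.1, (mem_lineComp hP hv).2 (Or.inr ⟨k, l, h.2.1, rfl, Or.inr ⟨l, h, le_rfl⟩⟩)⟩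

lemma minEdge_iff_eq_of_subset_ray (hP : P.NonSingular) (hv : P.IsVertex v)
    (hk : MinEdge (P.active v) k) (hE : P.lineComp v ⊆ ray v (dir k)) (j : Fin 3) :
    MinEdge (P.active v) j ↔ j = k := by
  constructor
  · intro hj
    obtain ⟨t, ht, h⟩ := exists_mem_lineComp hP hv hj
    obtain ⟨s, hs, e⟩ := hE h
    exact (pointAt_dir_eq ht hs e).1
  · rintro rfl; exact hk

lemma seg_subset_ray {u : ℤ × ℤ} {l : ℝ} (hl : 0 < l) : seg v u l ⊆ ray v u := by
  intro x hx
  obtain ⟨t, ht, -, e⟩ := (mem_seg hl).1 hx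
  exact ⟨t, ht, e⟩

/-- The possible loci attached to a vertex with at most one edge in the directions of a line. -/
lemma IsLocus.of_subsingleton (hP : P.NonSingular) (hv : P.IsVertex v) {S : Set (ℝ × ℝ)}
    (h : P.IsLocus v S) (hs : ∀ i j, MinEdge (P.active v) i → MinEdge (P.active v) j → i = j) :
    (S = {v} ∧ P.boundedDirs v = ∅) ∨ ∃ k, k ∈ P.boundedDirs v ∧
      S = {v, pointAt v (dir k) (P.edgeLen v k / 3)} := by
  have key : ∀ {u₁ u₂ : ℤ × ℤ} {l₁ l₂ : ℝ}, u₁ ≠ u₂ → P.BoundedEdge v u₁ l₁ →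
      P.BoundedEdge v u₂ l₂ → seg v u₁ l₁ ⊆ P.lineComp v → seg v u₂ l₂ ⊆ P.lineComp v → False := by
    intro u₁ u₂ l₁ l₂ h12 h1 h2 e1 e2
    obtain ⟨k₁, rfl, hk1, -⟩ := h1.exists_dir hP hv e1
    obtain ⟨k₂, rfl, hk2, -⟩ := h2.exists_dir hP hv e2
    exact h12 (congrArg dir (hs _ _ (boundedDirs_subset hP hv hk1)
      (boundedDirs_subset hP hv hk2)))
  cases h with
  | point hE =>
    refine Or.inl ⟨rfl, Finset.eq_empty_of_forall_notMem fun j hj => ?_⟩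
    obtain ⟨t, ht, h⟩ := exists_mem_lineComp hP hv (boundedDirs_subset hP hv hj)
    rw [hE] at h
    exact ht.ne' (pointAt_dir_injective v j (h.trans (pointAt_zero _ _).symm))
  | unbounded u he hE =>
    obtain ⟨k, rfl, hk, he'⟩ := he.exists_dir hP hv hE.ge
    refine Or.inl ⟨rfl, Finset.eq_empty_of_forall_notMem fun j hj => ?_⟩
    have := hs j k (boundedDirs_subset hP hv hj) ((minEdge_iff_edge hP hv).2 (Or.inl he))
    exact hk (this ▸ hj)
  | bounded u l he hE =>
    obtain ⟨k, rfl, hk, rfl⟩ := he.exists_dir hP hv hE.ge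
    exact Or.inr ⟨k, hk, rfl⟩
  | twoBounded_lt u₁ u₂ u₃ l₁ l₂ h12 h13 h23 he₁ he₂ he₃ hE hl =>
    exact (key h12 he₁ he₂ (by rw [hE]; exact fun x hx => Or.inl (Or.inl hx))
      (by rw [hE]; exact fun x hx => Or.inl (Or.inr hx))).elim
  | twoBounded_eq u₁ u₂ u₃ l₁ l₂ h12 h13 h23 he₁ he₂ he₃ hE hl =>
    exact (key h12 he₁ he₂ (by rw [hE]; exact fun x hx => Or.inl (Or.inl hx))
      (by rw [hE]; exact fun x hx => Or.inl (Or.inr hx))).elim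
  | threeBounded_lt u₁ u₂ u₃ l₁ l₂ l₃ h12 h13 h23 he₁ he₂ he₃ hE hl₁ hl₂ =>
    exact (key h12 he₁ he₂ (by rw [hE]; exact fun x hx => Or.inl (Or.inl hx))
      (by rw [hE]; exact fun x hx => Or.inl (Or.inr hx))).elim
  | threeBounded_eq_lt u₁ u₂ u₃ l₁ l₂ l₃ h12 h13 h23 he₁ he₂ he₃ hE hl₁ hl₂ =>
    exact (key h12 he₁ he₂ (by rw [hE]; exact fun x hx => Or.inl (Or.inl hx))
      (by rw [hE]; exact fun x hx => Or.inl (Or.inr hx))).elim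
  | threeBounded_eq u₁ u₂ u₃ l₁ l₂ l₃ h12 h13 h23 he₁ he₂ he₃ hE hl₁ hl₂ =>
    exact (key h12 he₁ he₂ (by rw [hE]; exact fun x hx => Or.inl (Or.inl hx))
      (by rw [hE]; exact fun x hx => Or.inl (Or.inr hx))).elim

/-- The possible loci attached to a vertex dual to `T_1`. -/
lemma IsLocus.of_forall_minEdge (hP : P.NonSingular) (hv : P.IsVertex v) {S : Set (ℝ × ℝ)}
    (h : P.IsLocus v S) (hall : ∀ j, MinEdge (P.active v) j) :
    ∃ a b c : Fin 3, a ≠ b ∧ a ≠ c ∧ b ≠ c ∧ a ∈ P.boundedDirs v ∧ b ∈ P.boundedDirs v ∧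
      ((c ∉ P.boundedDirs v ∧ P.edgeLen v b < P.edgeLen v a ∧
          S = {pointAt v (dir a) ((P.edgeLen v a - P.edgeLen v b) / 3)}) ∨
        (c ∉ P.boundedDirs v ∧ P.edgeLen v a = P.edgeLen v b ∧ S = ray v (dir c)) ∨
        (c ∈ P.boundedDirs v ∧ P.edgeLen v b ≤ P.edgeLen v a ∧ P.edgeLen v c < P.edgeLen v b ∧
          S = {pointAt v (dir a) ((P.edgeLen v a - P.edgeLen v c) / 3),
            pointAt v (dir b) ((P.edgeLen v b - P.edgeLen v c) / 3)}) ∨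
        (c ∈ P.boundedDirs v ∧ P.edgeLen v b < P.edgeLen v a ∧ P.edgeLen v b = P.edgeLen v c ∧
          S = seg v (dir a) ((P.edgeLen v a - P.edgeLen v b) / 3)) ∨
        (c ∈ P.boundedDirs v ∧ P.edgeLen v a = P.edgeLen v b ∧ P.edgeLen v b = P.edgeLen v c ∧
          S = {v})) := by
  have key : ∀ {u₁ u₂ : ℤ × ℤ} {l₁ l₂ : ℝ} {T : Set (ℝ × ℝ)}, P.BoundedEdge v u₁ l₁ →
      P.BoundedEdge v u₂ l₂ → P.lineComp v = seg v u₁ l₁ ∪ seg v u₂ l₂ ∪ T →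
      (∃ k, u₁ = dir k ∧ k ∈ P.boundedDirs v ∧ l₁ = P.edgeLen v k) ∧
      (∃ k, u₂ = dir k ∧ k ∈ P.boundedDirs v ∧ l₂ = P.edgeLen v k) ∧ T ⊆ P.lineComp v := by
    intro u₁ u₂ l₁ l₂ T h1 h2 hE
    refine ⟨h1.exists_dir hP hv ?_, h2.exists_dir hP hv ?_, ?_⟩ <;> rw [hE]
    · exact fun x hx => Or.inl (Or.inl hx)
    · exact fun x hx => Or.inl (Or.inr hx)
    · exact fun x hx => Or.inr hx
  -- All three directions carry a leaving edge, so the component is not contained in a single ray.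
  have one : ∀ k, ¬ P.lineComp v ⊆ ray v (dir k) := by
    intro k hE
    have h0 := (minEdge_iff_eq_of_subset_ray hP hv (hall k) hE 0).1 (hall 0)
    have h1 := (minEdge_iff_eq_of_subset_ray hP hv (hall k) hE 1).1 (hall 1)
    exact absurd (h0.trans h1.symm) (by decide)
  cases h with
  | point hE =>
    refine absurd ?_ (one 0)
    rw [hE]
    rintro x rfl
    exact self_mem_ray _ _
  | unbounded u he hE =>
    obtain ⟨k, rfl, -⟩ := he.exists_dir hP hv hE.ge
    exact absurd hE.le (one k)
  | bounded u l he hE =>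
    obtain ⟨k, rfl, -⟩ := he.exists_dir hP hv hE.ge
    exact absurd (hE.le.trans (seg_subset_ray he.2.1)) (one k)
  | twoBounded_lt u₁ u₂ u₃ l₁ l₂ h12 h13 h23 he₁ he₂ he₃ hE hl =>
    obtain ⟨⟨a, rfl, ha, rfl⟩, ⟨b, rfl, hb, rfl⟩, hT⟩ := key he₁ he₂ hE
    obtain ⟨c, rfl, hc, -⟩ := he₃.exists_dir hP hv hT
    exact ⟨a, b, c, ne_of_apply_ne _ h12, ne_of_apply_ne _ h13, ne_of_apply_ne _ h23, ha, hb,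
      Or.inl ⟨hc, hl, rfl⟩⟩
  | twoBounded_eq u₁ u₂ u₃ l₁ l₂ h12 h13 h23 he₁ he₂ he₃ hE hl =>
    obtain ⟨⟨a, rfl, ha, rfl⟩, ⟨b, rfl, hb, rfl⟩, hT⟩ := key he₁ he₂ hE
    obtain ⟨c, rfl, hc, -⟩ := he₃.exists_dir hP hv hT
    exact ⟨a, b, c, ne_of_apply_ne _ h12, ne_of_apply_ne _ h13, ne_of_apply_ne _ h23, ha, hb,
      Or.inr (Or.inl ⟨hc, hl, rfl⟩)⟩
  | threeBounded_lt u₁ u₂ u₃ l₁ l₂ l₃ h12 h13 h23 he₁ he₂ he₃ hE hl₁ hl₂ =>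
    obtain ⟨⟨a, rfl, ha, rfl⟩, ⟨b, rfl, hb, rfl⟩, hT⟩ := key he₁ he₂ hE
    obtain ⟨c, rfl, hc, rfl⟩ := he₃.exists_dir hP hv hT
    exact ⟨a, b, c, ne_of_apply_ne _ h12, ne_of_apply_ne _ h13, ne_of_apply_ne _ h23, ha, hb,
      Or.inr (Or.inr (Or.inl ⟨hc, hl₁, hl₂, rfl⟩))⟩
  | threeBounded_eq_lt u₁ u₂ u₃ l₁ l₂ l₃ h12 h13 h23 he₁ he₂ he₃ hE hl₁ hl₂ =>
    obtain ⟨⟨a, rfl, ha, rfl⟩, ⟨b, rfl, hb, rfl⟩, hT⟩ := key he₁ he₂ hE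
    obtain ⟨c, rfl, hc, rfl⟩ := he₃.exists_dir hP hv hT
    exact ⟨a, b, c, ne_of_apply_ne _ h12, ne_of_apply_ne _ h13, ne_of_apply_ne _ h23, ha, hb,
      Or.inr (Or.inr (Or.inr (Or.inl ⟨hc, hl₁, hl₂, rfl⟩)))⟩
  | threeBounded_eq u₁ u₂ u₃ l₁ l₂ l₃ h12 h13 h23 he₁ he₂ he₃ hE hl₁ hl₂ =>
    obtain ⟨⟨a, rfl, ha, rfl⟩, ⟨b, rfl, hb, rfl⟩, hT⟩ := key he₁ he₂ hE
    obtain ⟨c, rfl, hc, rfl⟩ := he₃.exists_dir hP hv hT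
    exact ⟨a, b, c, ne_of_apply_ne _ h12, ne_of_apply_ne _ h13, ne_of_apply_ne _ h23, ha, hb,
      Or.inr (Or.inr (Or.inr (Or.inr ⟨hc, hl₁, hl₂, rfl⟩)))⟩

lemma dir_injective : Function.Injective dir := by
  intro a b; revert a b; decide

end TropPoly
/-! ### Connected components of a finite disjoint union -/

/-- K and the union of the other members are disjoint closed sets covering the component. Being
connected and meeting K, the component cannot leave K. -/
lemma connectedComponentIn_eq_of_mem {α : Type*} [TopologicalSpace α] {F : Finset (Set α)}
    (hc : ∀ K ∈ F, IsClosed K) (hp : ∀ K ∈ F, IsPreconnected K)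
    (hd : (F : Set (Set α)).PairwiseDisjoint id) {K : Set α} (hK : K ∈ F) {x : α} (hx : x ∈ K) :
    connectedComponentIn (⋃ K ∈ F, K) x = K := by
  classical
  have hKX : K ⊆ ⋃ K ∈ F, K := Set.subset_biUnion_of_mem (u := id) hK
  refine Set.Subset.antisymm ?_ ((hp K hK).subset_connectedComponentIn hx hKX)
  intro y hy
  by_contra hyK
  have hpre : IsPreconnected (connectedComponentIn (⋃ K ∈ F, K) x) :=
    isPreconnected_connectedComponentIn
  have hsub : connectedComponentIn (⋃ K ∈ F, K) x ⊆ K ∪ ⋃ K' ∈ F.erase K, K' := by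
    intro z hz
    obtain ⟨K', hK', hz'⟩ := Set.mem_iUnion₂.1 (connectedComponentIn_subset _ _ hz)
    by_cases h : K' = K
    · exact Or.inl (h ▸ hz')
    · exact Or.inr (Set.mem_iUnion₂.2 ⟨K', Finset.mem_erase.2 ⟨h, hK'⟩, hz'⟩)
  obtain ⟨z, -, hzK, hz⟩ := isPreconnected_closed_iff.1 hpre K (⋃ K' ∈ F.erase K, K') (hc K hK)
    ((F.erase K).finite_toSet.isClosed_biUnion fun K' h => hc K' (Finset.mem_of_mem_erase h)) hsub
    ⟨x, mem_connectedComponentIn (hKX hx), hx⟩ ⟨y, hy, (hsub hy).resolve_left hyK⟩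
  obtain ⟨K', hK', hz'⟩ := Set.mem_iUnion₂.1 hz
  exact Set.disjoint_left.1 (hd hK (Finset.mem_of_mem_erase hK') (Finset.ne_of_mem_erase hK').symm)
    hzK hz'

lemma setOf_connectedComponentIn_eq {α : Type*} [TopologicalSpace α] {F : Finset (Set α)}
    (hc : ∀ K ∈ F, IsClosed K) (hp : ∀ K ∈ F, IsPreconnected K) (hn : ∀ K ∈ F, K.Nonempty)
    (hd : (F : Set (Set α)).PairwiseDisjoint id) :
    {K | ∃ x ∈ ⋃ K ∈ F, K, K = connectedComponentIn (⋃ K ∈ F, K) x} = (F : Set (Set α)) := by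
  ext K
  constructor
  · rintro ⟨x, hx, rfl⟩
    obtain ⟨K, hK, hxK⟩ := Set.mem_iUnion₂.1 hx
    rw [connectedComponentIn_eq_of_mem hc hp hd hK hxK]
    exact hK
  · intro hK
    obtain ⟨x, hx⟩ := hn K hK
    exact ⟨x, Set.mem_iUnion₂.2 ⟨K, hK, hx⟩, (connectedComponentIn_eq_of_mem hc hp hd hK hx).symm⟩

lemma isClosed_ray (v : ℝ × ℝ) (k : Fin 3) : IsClosed (ray v (dir k)) := by
  have h : ray v (dir k) =
      (fun x => v + x) '' ((fun t : ℝ => t • toReal (dir k)) '' Set.Ici 0) := by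
    ext x
    simp only [ray, pointAt, Set.mem_image, Set.mem_Ici, exists_exists_and_eq_and]
    exact exists_congr fun t => and_congr_right fun _ => eq_comm
  rw [h]
  exact (Homeomorph.addLeft v).isClosedMap _
    ((isClosedEmbedding_smul_left (dir_ne_zero k)).isClosedMap _ isClosed_Ici)

lemma isPreconnected_ray (v : ℝ × ℝ) (u : ℤ × ℤ) : IsPreconnected (ray v u) := by
  have h : ray v u = (fun t : ℝ => pointAt v u t) '' Set.Ici 0 := by
    ext x
    exact exists_congr fun t => and_congr_right fun _ => eq_comm
  rw [h]
  refine isPreconnected_Ici.image _ (Continuous.continuousOn ?_)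
  unfold pointAt
  fun_prop

lemma not_isBounded_ray (v : ℝ × ℝ) (k : Fin 3) : ¬ Bornology.IsBounded (ray v (dir k)) := by
  intro h
  obtain ⟨C, hC⟩ := isBounded_iff_forall_norm_le.1 h
  have hw : 0 < ‖toReal (dir k)‖ := norm_pos_iff.2 (dir_ne_zero k)
  have hC0 : 0 ≤ C := (norm_nonneg _).trans (hC v (TropPoly.self_mem_ray _ _))
  set t := (C + ‖v‖ + 1) / ‖toReal (dir k)‖ with ht
  have ht0 : 0 ≤ t := by positivity
  have h1 := hC _ ⟨t, ht0, rfl⟩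
  have h2 : ‖t • toReal (dir k)‖ = C + ‖v‖ + 1 := by
    rw [norm_smul, Real.norm_of_nonneg ht0, ht, div_mul_cancel₀ _ hw.ne']
  have h3 : ‖t • toReal (dir k)‖ ≤ ‖pointAt v (dir k) t‖ + ‖v‖ := by
    have : t • toReal (dir k) = pointAt v (dir k) t - v := by simp [pointAt]
    rw [this]
    exact norm_sub_le _ _
  linarith

lemma isCompact_seg (v : ℝ × ℝ) (u : ℤ × ℤ) (l : ℝ) : IsCompact (seg v u l) := by
  rw [seg, segment_eq_image]
  exact isCompact_Icc.image (by fun_prop)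

lemma isPreconnected_seg (v : ℝ × ℝ) (u : ℤ × ℤ) (l : ℝ) : IsPreconnected (seg v u l) :=
  (convex_segment _ _).isPreconnected

lemma perm_cases : ∀ {a b c a' b' c' : Fin 3}, a ≠ b → a ≠ c → b ≠ c → a' ≠ b' → a' ≠ c' →
    b' ≠ c' → (a' = a ∧ b' = b ∧ c' = c) ∨ (a' = b ∧ b' = a ∧ c' = c) ∨
      (a' = a ∧ b' = c ∧ c' = b) ∨ (a' = c ∧ b' = a ∧ c' = b) ∨
      (a' = b ∧ b' = c ∧ c' = a) ∨ (a' = c ∧ b' = b ∧ c' = a) := by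
  decide

namespace TropPoly

variable {P : TropPoly} {v : ℝ × ℝ} {k : Fin 3}

/-! ### Multiplicities of the components -/

lemma isUnitTriangle_of_unitAt {a : ℤ × ℤ} (h : P.active v = unitAt a) :
    IsUnitTriangle (P.dualCell v) := by
  refine ⟨a, ?_⟩
  rw [dualCell, h, unitAt]
  push_cast
  rfl

lemma exists_unitAt_of_isUnitTriangle (hP : P.NonSingular) (hv : P.IsVertex v)
    (h : IsUnitTriangle (P.dualCell v)) : ∃ a, P.active v = unitAt a := by
  obtain ⟨a, ha⟩ := h
  have hd : |det3 a (a + (1, 0)) (a + (0, 1))| = 1 := by simp [det3]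
  have hu : IsPrim (unitAt a) := ⟨_, _, _, rfl, hd⟩
  refine ⟨a, Finset.eq_of_subset_of_card_le (fun i hi => ?_) ?_⟩
  · have h1 : toReal i ∈ P.dualCell v := toReal_mem_hull hi
    rw [ha] at h1
    have := mem_of_toReal_mem_hull hd h1
    simpa [unitAt] using this
  · rw [hu.card, (hv.isPrim hP).card]

/-- A singleton determines its point, so the vertex chosen in the definition of `inflMult` is v. -/
lemma inflMult_singleton (hv : P.IsVertex v) (hu : ¬ IsUnitTriangle (P.dualCell v)) :
    P.inflMult {v} = inflNumber (P.dualCell v) := by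
  have h : ∃ w, P.IsVertex w ∧ ¬ IsUnitTriangle (P.dualCell w) ∧ ({v} : Set (ℝ × ℝ)) = {w} :=
    ⟨v, hv, hu, rfl⟩
  rw [inflMult, dif_pos h, ← Set.singleton_injective h.choose_spec.2.2]

lemma inflMult_eq_three_of_not_isVertex {p : ℝ × ℝ} (hp : ¬ P.IsVertex p) :
    P.inflMult {p} = 3 := by
  rw [inflMult, dif_neg, if_neg]
  · rintro ⟨-, w, rfl, hw, -⟩
    exact hp hw
  · rintro ⟨w, hw, -, e⟩
    exact hp (Set.singleton_injective e ▸ hw)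

lemma inflMult_ray (v : ℝ × ℝ) (k : Fin 3) : P.inflMult (ray v (dir k)) = 3 := by
  rw [inflMult, dif_neg, if_neg]
  · rintro ⟨h, -⟩
    exact not_isBounded_ray v k h
  · rintro ⟨w, -, -, e⟩
    exact not_isBounded_ray v k (e ▸ Bornology.isBounded_singleton)

lemma inflMult_eq_six {K : Set (ℝ × ℝ)} (hK : Bornology.IsBounded K) (hvK : v ∈ K)
    (hv : P.IsVertex v) (hu : IsUnitTriangle (P.dualCell v)) : P.inflMult K = 6 := by
  rw [inflMult, dif_neg, if_pos ⟨hK, v, hvK, hv, hu⟩]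
  rintro ⟨w, -, hw, rfl⟩
  obtain rfl : v = w := hvK
  exact hw hu

/-! ### The inflection locus near a vertex -/

/-- The part of the inflection locus which comes from the tropical line with vertex `v`. -/
def locusAt (P : TropPoly) (v : ℝ × ℝ) : Set (ℝ × ℝ) :=
  {x | 3 ≤ P.compMult (tropLine v) (P.lineComp v) ∧ ∃ S, P.IsLocus v S ∧ x ∈ S}

lemma inflSet_eq (P : TropPoly) : P.inflSet = {x | ∃ v, P.IsVertex v ∧ x ∈ P.locusAt v} := by
  ext x
  exact ⟨fun ⟨v, S, hv, h3, hS, hx⟩ => ⟨v, hv, h3, S, hS, hx⟩,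
    fun ⟨v, hv, h3, S, hS, hx⟩ => ⟨v, S, hv, h3, hS, hx⟩⟩

/-- `IsLocus` is a relation, as the edges of a component may be labelled in several ways. The union
over all admissible S is a single set once every labelling gives the same one. -/
lemma locusAt_eq {S : Set (ℝ × ℝ)} (h3 : 3 ≤ P.compMult (tropLine v) (P.lineComp v))
    (hS : P.IsLocus v S) (hu : ∀ T, P.IsLocus v T → T = S) : P.locusAt v = S := by
  ext x
  exact ⟨fun ⟨_, T, hT, hx⟩ => hu T hT ▸ hx, fun hx => ⟨h3, S, hS, hx⟩⟩

lemma locusAt_eq_empty (h3 : P.compMult (tropLine v) (P.lineComp v) < 3) : P.locusAt v = ∅ :=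
  Set.eq_empty_of_forall_notMem fun _ hx => absurd hx.1 h3.not_ge

/-- `X` is the union of finitely many disjoint closed connected subsets of the star of `v`, and
`c` is the sum of their multiplicities. -/
def Splits (P : TropPoly) (v : ℝ × ℝ) (X : Set (ℝ × ℝ)) (c : ℝ) : Prop :=
  ∃ F : Finset (Set (ℝ × ℝ)), (∀ K ∈ F, IsClosed K ∧ IsPreconnected K ∧ K.Nonempty ∧ K ⊆ P.star v) ∧
    (F : Set (Set (ℝ × ℝ))).PairwiseDisjoint id ∧ X = ⋃ K ∈ F, K ∧ ∑ K ∈ F, P.inflMult K = c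

lemma splits_empty (P : TropPoly) (v : ℝ × ℝ) : P.Splits v ∅ 0 :=
  ⟨∅, by simp, by simp, by simp, by simp⟩

lemma splits_of_isPreconnected {K : Set (ℝ × ℝ)} (hc : IsClosed K) (hp : IsPreconnected K)
    (hv : v ∈ K) (hs : K ⊆ P.star v) : P.Splits v K (P.inflMult K) :=
  ⟨{K}, by simpa using ⟨hc, hp, ⟨v, hv⟩, hs⟩, by simp, by simp, by simp⟩

lemma splits_singleton {p : ℝ × ℝ} (hp : p ∈ P.star v) : P.Splits v {p} (P.inflMult {p}) :=
  ⟨{{p}}, by simpa using ⟨isPreconnected_singleton, hp⟩, by simp, by simp, by simp⟩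

lemma splits_pair {p q : ℝ × ℝ} (hp : p ∈ P.star v) (hq : q ∈ P.star v) (hpq : p ≠ q) :
    P.Splits v {p, q} (P.inflMult {p} + P.inflMult {q}) := by
  classical
  have hne : ({p} : Set (ℝ × ℝ)) ≠ {q} := fun h => hpq (Set.singleton_injective h)
  refine ⟨{{p}, {q}}, ?_, ?_, ?_, Finset.sum_pair hne⟩
  · simpa using ⟨⟨isPreconnected_singleton, hp⟩, isPreconnected_singleton, hq⟩
  · push_cast
    rw [Set.pairwiseDisjoint_insert]
    refine ⟨Set.pairwiseDisjoint_singleton _ _, fun j hj _ => ?_⟩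
    obtain rfl : j = {q} := hj
    simpa using hpq
  · ext x; simp [or_comm]

lemma seg_subset_star {l : ℝ} (hk : k ∈ P.boundedDirs v) (h0 : 0 < l) (h1 : l < P.edgeLen v k) :
    seg v (dir k) l ⊆ P.star v := by
  intro x hx
  obtain ⟨t, ht, htl, rfl⟩ := (mem_seg h0).1 hx
  rcases ht.eq_or_lt with rfl | ht
  · rw [pointAt_zero]
    exact P.self_mem_star v
  · exact pointAt_mem_star hk ht (htl.trans_lt h1)

lemma ray_subset_star (h : P.UnboundedEdge v (dir k)) : ray v (dir k) ⊆ P.star v := by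
  rintro x ⟨t, ht, rfl⟩
  rcases ht.eq_or_lt with rfl | ht
  · rw [pointAt_zero]
    exact P.self_mem_star v
  · exact Or.inr ⟨k, t, ht, rfl, Or.inl h⟩

lemma edgeLen_pos (hk : k ∈ P.boundedDirs v) : 0 < P.edgeLen v k := (boundedEdge_edgeLen hk).2.1

lemma inflMult_pointAt (hP : P.NonSingular) (hv : P.IsVertex v) {t : ℝ}
    (hk : k ∈ P.boundedDirs v) (h0 : 0 < t) (h1 : t < P.edgeLen v k) :
    P.inflMult {pointAt v (dir k) t} = 3 :=
  inflMult_eq_three_of_not_isVertex (not_isVertex_of_interior hP hv hk h0 h1)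

lemma pointAt_ne {t : ℝ} (ht : 0 < t) : v ≠ pointAt v (dir k) t := by
  intro h
  rw [← pointAt_zero v (dir k)] at h
  exact ht.ne (pointAt_dir_injective _ k (by simpa [pointAt_zero] using h))

/-- The locus at a vertex with a single edge in the directions of a line, which is bounded. -/
lemma splits_of_bounded (hP : P.NonSingular) (hv : P.IsVertex v)
    (h3 : 3 ≤ P.compMult (tropLine v) (P.lineComp v)) (hk : k ∈ P.boundedDirs v)
    (h : ∀ j, MinEdge (P.active v) j ↔ j = k) :
    P.Splits v (P.locusAt v) (P.inflMult {v} + 3) := by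
  have h0 := edgeLen_pos hk
  have hS : P.IsLocus v {v, pointAt v (dir k) (P.edgeLen v k / 3)} :=
    IsLocus.bounded _ _ (boundedEdge_edgeLen hk)
      ((lineComp_eq_closedEdge hP hv h).trans (closedEdge_eq_seg hP hv hk))
  have h1 : P.edgeLen v k / 3 < P.edgeLen v k := by linarith
  have h2 := splits_pair (P.self_mem_star v) (pointAt_mem_star hk (by linarith) h1)
    (pointAt_ne (by linarith))
  rw [inflMult_pointAt hP hv hk (by linarith) h1] at h2
  rw [locusAt_eq h3 hS]
  · exact h2
  · intro T hT
    rcases hT.of_subsingleton hP hv (fun i j hi hj => ((h i).1 hi).trans ((h j).1 hj).symm) with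
      ⟨-, hb⟩ | ⟨j, hj, rfl⟩
    · rw [hb] at hk
      exact absurd hk (Finset.notMem_empty k)
    · rw [(h j).1 (boundedDirs_subset hP hv hj)]

/-- The locus at a vertex without bounded edges, and with at most one unbounded edge, in the
directions of a line. -/
lemma splits_of_boundedDirs_eq_empty (hP : P.NonSingular) (hv : P.IsVertex v)
    (h3 : 3 ≤ P.compMult (tropLine v) (P.lineComp v)) (hb : P.boundedDirs v = ∅)
    (hs : ∀ i j, MinEdge (P.active v) i → MinEdge (P.active v) j → i = j) :
    P.Splits v (P.locusAt v) (P.inflMult {v}) := by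
  have hS : P.IsLocus v {v} := by
    by_cases h : ∃ k, MinEdge (P.active v) k
    · obtain ⟨k, hk⟩ := h
      have hu := unboundedEdge_of_not_mem hP hv hk (by simp [hb])
      refine IsLocus.unbounded _ hu ?_
      rw [lineComp_eq_closedEdge hP hv (k := k) fun j => ⟨fun hj => hs j k hj hk, fun e => e ▸ hk⟩,
        closedEdge_eq_ray hu]
    · exact IsLocus.point (lineComp_eq_singleton hP hv fun j hj => h ⟨j, hj⟩)
  rw [locusAt_eq h3 hS]
  · exact splits_singleton (P.self_mem_star v)
  · intro T hT
    rcases hT.of_subsingleton hP hv hs with ⟨h, -⟩ | ⟨j, hj, -⟩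
    · exact h
    · simp [hb] at hj

end TropPoly
-- Loci at vertices dual to `T_1`
lemma exists_labels_two {B : Finset (Fin 3)} (hB : B.card = 2) (L : Fin 3 → ℝ) :
    ∃ a b c, a ≠ b ∧ a ≠ c ∧ b ≠ c ∧ a ∈ B ∧ b ∈ B ∧ c ∉ B ∧ L b ≤ L a := by
  have h : ∀ B : Finset (Fin 3), B.card = 2 →
      ∃ a b c, a ≠ b ∧ a ≠ c ∧ b ≠ c ∧ a ∈ B ∧ b ∈ B ∧ c ∉ B := by decide
  obtain ⟨a, b, c, hab, hac, hbc, ha, hb, hc⟩ := h B hB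
  rcases le_total (L b) (L a) with hl | hl
  · exact ⟨a, b, c, hab, hac, hbc, ha, hb, hc, hl⟩
  · exact ⟨b, a, c, hab.symm, hbc, hac, hb, ha, hc, hl⟩

lemma exists_labels_three (L : Fin 3 → ℝ) :
    ∃ a b c, a ≠ b ∧ a ≠ c ∧ b ≠ c ∧ L b ≤ L a ∧ L c ≤ L b := by
  rcases le_total (L 0) (L 1) with h1 | h1 <;> rcases le_total (L 1) (L 2) with h2 | h2 <;>
    rcases le_total (L 0) (L 2) with h3 | h3
  · exact ⟨2, 1, 0, by decide, by decide, by decide, h2, h1⟩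
  · exact ⟨2, 1, 0, by decide, by decide, by decide, h2, h1⟩
  · exact ⟨1, 2, 0, by decide, by decide, by decide, h2, h3⟩
  · exact ⟨1, 0, 2, by decide, by decide, by decide, h1, h3⟩
  · exact ⟨2, 0, 1, by decide, by decide, by decide, h3, h1⟩
  · exact ⟨0, 2, 1, by decide, by decide, by decide, h3, h2⟩
  · exact ⟨0, 1, 2, by decide, by decide, by decide, h1, h2⟩
  · exact ⟨0, 1, 2, by decide, by decide, by decide, h1, h2⟩

namespace TropPoly

variable {P : TropPoly} {v : ℝ × ℝ} {k : Fin 3}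

/-- The locus at a vertex dual to `T_1` with two bounded edges. -/
lemma splits_of_card_eq_two (hP : P.NonSingular) (hv : P.IsVertex v)
    (h3 : 3 ≤ P.compMult (tropLine v) (P.lineComp v)) (hall : ∀ j, MinEdge (P.active v) j)
    (hB : (P.boundedDirs v).card = 2) : P.Splits v (P.locusAt v) 3 := by
  obtain ⟨a, b, c, hab, hac, hbc, ha, hb, hc, hl⟩ := exists_labels_two hB (P.edgeLen v)
  have hu := unboundedEdge_of_not_mem hP hv (hall c) hc
  have hE : P.lineComp v = seg v (dir a) (P.edgeLen v a) ∪ seg v (dir b) (P.edgeLen v b) ∪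
      ray v (dir c) := by
    rw [lineComp_eq_union hP hv hall hab hac hbc, closedEdge_eq_seg hP hv ha,
      closedEdge_eq_seg hP hv hb, closedEdge_eq_ray hu]
  have hinj := dir_injective
  have hb0 := edgeLen_pos hb
  rcases hl.lt_or_eq with hl | hl
  · have hS := IsLocus.twoBounded_lt _ _ _ _ _ (hinj.ne hab) (hinj.ne hac) (hinj.ne hbc)
      (boundedEdge_edgeLen ha) (boundedEdge_edgeLen hb) hu hE hl
    have h0 : 0 < (P.edgeLen v a - P.edgeLen v b) / 3 := by linarith
    have h1 : (P.edgeLen v a - P.edgeLen v b) / 3 < P.edgeLen v a := by linarith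
    rw [locusAt_eq h3 hS]
    · have := splits_singleton (pointAt_mem_star ha h0 h1)
      rwa [inflMult_pointAt hP hv ha h0 h1] at this
    · intro T hT
      obtain ⟨a', b', c', hab', hac', hbc', ha', hb', h⟩ := hT.of_forall_minEdge hP hv hall
      -- The direction c is the only one without a bounded edge, so another labelling can at most
      -- exchange a and b.
      have hc' : c' = c := by
        by_contra hne
        rcases eq_of_ne_of_ne (j := c) hab' hac' hbc' with rfl | rfl | rfl
        exacts [hc ha', hc hb', hne rfl]
      subst hc'
      have hperm : (a' = a ∧ b' = b) ∨ (a' = b ∧ b' = a) := by omega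
      rcases h with ⟨-, hl', rfl⟩ | ⟨-, hl', rfl⟩ | ⟨h, -⟩ | ⟨h, -⟩ | ⟨h, -⟩
      · rcases hperm with ⟨rfl, rfl⟩ | ⟨rfl, rfl⟩
        · rfl
        · linarith
      · rcases hperm with ⟨rfl, rfl⟩ | ⟨rfl, rfl⟩ <;> linarith
      all_goals exact absurd h hc
  · have hS := IsLocus.twoBounded_eq _ _ _ _ _ (hinj.ne hab) (hinj.ne hac) (hinj.ne hbc)
      (boundedEdge_edgeLen ha) (boundedEdge_edgeLen hb) hu hE hl.symm
    rw [locusAt_eq h3 hS]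
    · have := splits_of_isPreconnected (P := P) (isClosed_ray v c) (isPreconnected_ray v _)
        (self_mem_ray v _) (ray_subset_star hu)
      rwa [inflMult_ray] at this
    · intro T hT
      obtain ⟨a', b', c', hab', hac', hbc', ha', hb', h⟩ := hT.of_forall_minEdge hP hv hall
      have hc' : c' = c := by
        by_contra hne
        rcases eq_of_ne_of_ne (j := c) hab' hac' hbc' with rfl | rfl | rfl
        exacts [hc ha', hc hb', hne rfl]
      subst hc'
      have hperm : (a' = a ∧ b' = b) ∨ (a' = b ∧ b' = a) := by omega
      rcases h with ⟨-, hl', rfl⟩ | ⟨-, hl', rfl⟩ | ⟨h, -⟩ | ⟨h, -⟩ | ⟨h, -⟩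
      · rcases hperm with ⟨rfl, rfl⟩ | ⟨rfl, rfl⟩ <;> linarith
      · rfl
      all_goals exact absurd h hc

/-- The locus at a vertex dual to `T_1` with three bounded edges. -/
lemma splits_of_forall_mem (hP : P.NonSingular) (hv : P.IsVertex v)
    (h3 : 3 ≤ P.compMult (tropLine v) (P.lineComp v)) (hall : ∀ j, MinEdge (P.active v) j)
    (hB : ∀ j, j ∈ P.boundedDirs v) (hT1 : IsUnitTriangle (P.dualCell v)) :
    P.Splits v (P.locusAt v) 6 := by
  obtain ⟨a, b, c, hab, hac, hbc, hl1, hl2⟩ := exists_labels_three (P.edgeLen v)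
  have hE : P.lineComp v = seg v (dir a) (P.edgeLen v a) ∪ seg v (dir b) (P.edgeLen v b) ∪
      seg v (dir c) (P.edgeLen v c) := by
    rw [lineComp_eq_union hP hv hall hab hac hbc, closedEdge_eq_seg hP hv (hB a),
      closedEdge_eq_seg hP hv (hB b), closedEdge_eq_seg hP hv (hB c)]
  have hinj := dir_injective
  have hb0 := edgeLen_pos (hB b)
  have hc0 := edgeLen_pos (hB c)
  have hbe := fun j => boundedEdge_edgeLen (hB j)
  rcases hl2.lt_or_eq with hl2 | hl2
  · have hS := IsLocus.threeBounded_lt _ _ _ _ _ _ (hinj.ne hab) (hinj.ne hac) (hinj.ne hbc)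
      (hbe a) (hbe b) (hbe c) hE hl1 hl2
    have ha0 : 0 < (P.edgeLen v a - P.edgeLen v c) / 3 := by linarith
    have ha1 : (P.edgeLen v a - P.edgeLen v c) / 3 < P.edgeLen v a := by linarith
    have hb0 : 0 < (P.edgeLen v b - P.edgeLen v c) / 3 := by linarith
    have hb1 : (P.edgeLen v b - P.edgeLen v c) / 3 < P.edgeLen v b := by linarith
    rw [locusAt_eq h3 hS]
    · have := splits_pair (pointAt_mem_star (hB a) ha0 ha1) (pointAt_mem_star (hB b) hb0 hb1)
        fun e => hab (pointAt_dir_eq ha0 hb0.le e).1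
      rw [inflMult_pointAt hP hv (hB a) ha0 ha1, inflMult_pointAt hP hv (hB b) hb0 hb1] at this
      norm_num at this
      exact this
    · intro T hT
      obtain ⟨a', b', c', hab', hac', hbc', -, -, h⟩ := hT.of_forall_minEdge hP hv hall
      rcases h with ⟨h, -⟩ | ⟨h, -⟩ | ⟨-, h1, h2, rfl⟩ | ⟨-, h1, h2, rfl⟩ | ⟨-, h1, h2, rfl⟩
      · exact absurd (hB _) h
      · exact absurd (hB _) h
      -- A relabelling is a permutation of a, b, c. Either it contradicts the inequalities between
      -- the lengths, or it gives the same pair of points, possibly in the other order.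
      all_goals
        rcases perm_cases hab hac hbc hab' hac' hbc' with ⟨rfl, rfl, rfl⟩ | ⟨rfl, rfl, rfl⟩ |
          ⟨rfl, rfl, rfl⟩ | ⟨rfl, rfl, rfl⟩ | ⟨rfl, rfl, rfl⟩ | ⟨rfl, rfl, rfl⟩ <;>
        first | rfl | exact Set.pair_comm _ _ | linarith
  · rcases hl1.lt_or_eq with hl1 | hl1
    · have hS := IsLocus.threeBounded_eq_lt _ _ _ _ _ _ (hinj.ne hab) (hinj.ne hac) (hinj.ne hbc)
        (hbe a) (hbe b) (hbe c) hE hl1 hl2.symm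
      have ha0 : 0 < (P.edgeLen v a - P.edgeLen v b) / 3 := by linarith
      have ha1 : (P.edgeLen v a - P.edgeLen v b) / 3 < P.edgeLen v a := by linarith
      rw [locusAt_eq h3 hS]
      · have := splits_of_isPreconnected (P := P)
          (isCompact_seg v (dir a) ((P.edgeLen v a - P.edgeLen v b) / 3)).isClosed
          (isPreconnected_seg v _ _) (left_mem_segment ℝ _ _) (seg_subset_star (hB a) ha0 ha1)
        rwa [inflMult_eq_six (isCompact_seg v _ _).isBounded (left_mem_segment ℝ _ _) hv hT1]
          at this
      · intro T hT
        obtain ⟨a', b', c', hab', hac', hbc', -, -, h⟩ := hT.of_forall_minEdge hP hv hall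
        rcases h with ⟨h, -⟩ | ⟨h, -⟩ | ⟨-, h1, h2, rfl⟩ | ⟨-, h1, h2, rfl⟩ | ⟨-, h1, h2, rfl⟩
        · exact absurd (hB _) h
        · exact absurd (hB _) h
        all_goals
          rcases perm_cases hab hac hbc hab' hac' hbc' with ⟨rfl, rfl, rfl⟩ | ⟨rfl, rfl, rfl⟩ |
            ⟨rfl, rfl, rfl⟩ | ⟨rfl, rfl, rfl⟩ | ⟨rfl, rfl, rfl⟩ | ⟨rfl, rfl, rfl⟩ <;>
          first | rfl | (rw [hl2]; done) | linarith
    · have hS := IsLocus.threeBounded_eq _ _ _ _ _ _ (hinj.ne hab) (hinj.ne hac) (hinj.ne hbc)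
        (hbe a) (hbe b) (hbe c) hE hl1.symm hl2.symm
      rw [locusAt_eq h3 hS]
      · have := splits_singleton (P.self_mem_star v)
        rwa [inflMult_eq_six Bornology.isBounded_singleton (Set.mem_singleton v) hv hT1] at this
      · intro T hT
        obtain ⟨a', b', c', hab', hac', hbc', -, -, h⟩ := hT.of_forall_minEdge hP hv hall
        rcases h with ⟨h, -⟩ | ⟨h, -⟩ | ⟨-, h1, h2, rfl⟩ | ⟨-, h1, h2, rfl⟩ | ⟨-, h1, h2, rfl⟩
        · exact absurd (hB _) h
        · exact absurd (hB _) h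
        all_goals
          rcases perm_cases hab hac hbc hab' hac' hbc' with ⟨rfl, rfl, rfl⟩ | ⟨rfl, rfl, rfl⟩ |
            ⟨rfl, rfl, rfl⟩ | ⟨rfl, rfl, rfl⟩ | ⟨rfl, rfl, rfl⟩ | ⟨rfl, rfl, rfl⟩ <;>
          first | rfl | linarith

/-! ### The contribution of a vertex and the total -/

lemma inflNumber_dualCell (hP : P.NonSingular) (hv : P.IsVertex v) :
    inflNumber (P.dualCell v) = 3 - maxCount (P.active v) - 2 * minCount (P.active v) :=
  (hv.isPrim hP).inflNumber_eq

/-- The contribution of a vertex. -/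
lemma splits_locusAt {d : ℕ} (hd : 2 ≤ d) (hN : P.newtonPolygon = stdTriangle d)
    (hP : P.NonSingular) (hv : P.IsVertex v) :
    P.Splits v (P.locusAt v) (3 - maxCount (P.active v) - 2 * minCount (P.active v) +
      3 * (P.boundedDirs v).card) := by
  -- All three directions are leaving directions for T_1, so a vertex with at most one of them is
  -- not dual to T_1. Its singleton then has multiplicity i_Δ.
  have hnu : (∃ k, ∀ j, MinEdge (P.active v) j → j = k) → ¬ IsUnitTriangle (P.dualCell v) := by
    rintro ⟨k, hk⟩ h
    obtain ⟨a, ha⟩ := exists_unitAt_of_isUnitTriangle hP hv h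
    have h01 := (hk 0 (ha ▸ (unitAt_edges a 0).1)).trans (hk 1 (ha ▸ (unitAt_edges a 1).1)).symm
    exact absurd h01 (by decide)
  -- With a single leaving edge, which is bounded, v contributes i_Δ and the point at a third of the
  -- edge contributes 3.
  have hone : 3 ≤ P.compMult (tropLine v) (P.lineComp v) → ∀ k ∈ P.boundedDirs v,
      (∀ j, MinEdge (P.active v) j ↔ j = k) →
      P.Splits v (P.locusAt v) (3 - maxCount (P.active v) - 2 * minCount (P.active v) +
        3 * (P.boundedDirs v).card) := by
    intro h3 k hk h
    have hB : P.boundedDirs v = {k} :=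
      Finset.eq_singleton_iff_unique_mem.2
        ⟨hk, fun j hj => (h j).1 (boundedDirs_subset hP hv hj)⟩
    have := splits_of_bounded hP hv h3 hk h
    rw [inflMult_singleton hv (hnu ⟨k, fun j => (h j).1⟩), inflNumber_dualCell hP hv] at this
    simpa [hB] using this
  rcases (hv.isPrim hP).classify with ⟨a, ha⟩ | ⟨h, hn⟩ | ⟨h, hn⟩ | h
  · have hall : ∀ j, MinEdge (P.active v) j := fun j => ha ▸ (unitAt_edges a j).1
    have hmin : minCount (P.active v) = 3 := by simp [minCount, hall]
    have hmax : maxCount (P.active v) = 0 := by simp [maxCount, ha, (unitAt_edges a _).2]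
    have h0 := (boundedDirs_nonempty_of_unitAt hd hN hP hv ha).card_pos
    have hle : (P.boundedDirs v).card ≤ 3 := Finset.card_le_univ _
    have hiff := three_le_compMult_iff_of_unitAt hP hv ha
    have hcases : (P.boundedDirs v).card = 1 ∨ (P.boundedDirs v).card = 2 ∨
      (P.boundedDirs v).card = 3 := by omega
    -- The contribution of T_1 is 3(b - 1), where b is the number of bounded leaving edges. The
    -- value b = 0 occurs only in degree one.
    rcases hcases with h | h | h <;> rw [hmin, hmax, h] <;> norm_num
    · rw [locusAt_eq_empty (not_le.1 fun h3 => absurd (hiff.1 h3) (by omega))]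
      exact P.splits_empty v
    · exact splits_of_card_eq_two hP hv (hiff.2 h.ge) hall h
    · refine splits_of_forall_mem hP hv (hiff.2 (by omega)) hall ?_ (isUnitTriangle_of_unitAt ha)
      intro j
      rw [(Finset.card_eq_iff_eq_univ _).1 h]
      exact Finset.mem_univ j
  -- The case of -T_1: no edge leaves v, the multiplicity is below 3, and 3 - max - 2 min = 0.
  · have hB : P.boundedDirs v = ∅ := Finset.eq_empty_of_forall_notMem fun j hj =>
      (h j).2 (boundedDirs_subset hP hv hj)
    have hmin : minCount (P.active v) = 0 := by simp [minCount, fun j => (h j).2]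
    have hmax : maxCount (P.active v) = 3 := by simp [maxCount, fun j => (h j).1]
    rw [locusAt_eq_empty (compMult_lt_three_of_narrow hP hv hn hB), hmin, hmax, hB]
    norm_num
    exact P.splits_empty v
  -- One edge of each kind: i_Δ = 0. If no leaving edge is bounded the locus is empty, otherwise v
  -- is a component of multiplicity 0 next to one of multiplicity 3.
  · obtain ⟨⟨k', hk'⟩, ⟨k, hk⟩, -⟩ := id h
    have hmin : minCount (P.active v) = 1 :=
      Finset.card_eq_one.2 ⟨k, by ext; simp [hk]⟩
    have hmax : maxCount (P.active v) = 1 :=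
      Finset.card_eq_one.2 ⟨k', by ext; simp [hk']⟩
    rcases (P.boundedDirs v).eq_empty_or_nonempty with hB | hB
    · rw [locusAt_eq_empty (compMult_lt_three_of_narrow hP hv hn hB), hmin, hmax, hB]
      norm_num
      exact P.splits_empty v
    · obtain ⟨j, hj⟩ := hB
      obtain rfl := (hk j).1 (boundedDirs_subset hP hv hj)
      exact hone (three_le_compMult_of_mixed hP hv h ⟨j, hj⟩) j hj hk
  -- In the wide case v always belongs to the locus and contributes i_Δ.
  · have h3 := three_le_compMult_of_wide hP hv h
    have hs : ∀ i j, MinEdge (P.active v) i → MinEdge (P.active v) j → i = j :=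
      fun i j hi hj => h.2 i j (Or.inl hi) (Or.inl hj)
    rcases (P.boundedDirs v).eq_empty_or_nonempty with hB | ⟨j, hj⟩
    · have := splits_of_boundedDirs_eq_empty hP hv h3 hB hs
      rw [inflMult_singleton hv, inflNumber_dualCell hP hv] at this
      · simpa [hB] using this
      · by_cases hex : ∃ k, MinEdge (P.active v) k
        · obtain ⟨k, hk⟩ := hex
          exact hnu ⟨k, fun j hj => hs j k hj hk⟩
        · exact hnu ⟨0, fun j hj => absurd ⟨j, hj⟩ hex⟩
    · have hj' := boundedDirs_subset hP hv hj
      exact hone h3 j hj fun i => ⟨fun hi => hs i j hi hj', fun e => e ▸ hj'⟩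

/-- The inflection components of a non-singular curve of degree `d` have total multiplicity
`3d(d - 2)`. -/
theorem finite_inflComponents_and_finsum_inflMult {d : ℕ} (hd : 2 ≤ d)
    (hN : P.newtonPolygon = stdTriangle d) (hP : P.NonSingular) :
    P.inflComponents.Finite ∧
      ∑ᶠ K ∈ P.inflComponents, P.inflMult K = 3 * (d : ℝ) * ((d : ℝ) - 2) := by
  classical
  have hsplit : ∀ v, ∃ F : Finset (Set (ℝ × ℝ)), P.IsVertex v →
      (∀ K ∈ F, IsClosed K ∧ IsPreconnected K ∧ K.Nonempty ∧ K ⊆ P.star v) ∧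
      (F : Set (Set (ℝ × ℝ))).PairwiseDisjoint id ∧ P.locusAt v = ⋃ K ∈ F, K ∧
      ∑ K ∈ F, P.inflMult K = (3 : ℝ) - maxCount (P.active v) - 2 * minCount (P.active v) +
        3 * (P.boundedDirs v).card := by
    intro v
    by_cases hv : P.IsVertex v
    · obtain ⟨F, hF⟩ := splits_locusAt hd hN hP hv
      exact ⟨F, fun _ => hF⟩
    · exact ⟨∅, fun h => absurd h hv⟩
  choose F hF using hsplit
  set V := (finite_setOf_isVertex hP).toFinset with hVdef
  have hV : ∀ {v}, v ∈ V ↔ P.IsVertex v := fun {v} => by simp [hVdef]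
  have hmem : ∀ K ∈ V.biUnion F, ∃ v, P.IsVertex v ∧ K ∈ F v := by
    intro K hK
    obtain ⟨v, hv, hKv⟩ := Finset.mem_biUnion.1 hK
    exact ⟨v, hV.1 hv, hKv⟩
  have hdisj : ∀ v w K K', P.IsVertex v → P.IsVertex w → v ≠ w → K ∈ F v → K' ∈ F w →
      Disjoint K K' := fun v w K K' hv hw hvw hK hK' =>
    (disjoint_star hP hv hw hvw).mono ((hF v hv).1 K hK).2.2.2 ((hF w hw).1 K' hK').2.2.2
  -- Pieces at one vertex are disjoint by construction, pieces at different vertices because their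
  -- stars are.
  have hpd : (V.biUnion F : Set (Set (ℝ × ℝ))).PairwiseDisjoint id := by
    intro K hK K' hK' hne
    obtain ⟨v, hv, hKv⟩ := hmem K hK
    obtain ⟨w, hw, hKw⟩ := hmem K' hK'
    by_cases hvw : v = w
    · subst hvw
      exact (hF v hv).2.1 hKv hKw hne
    · exact hdisj v w K K' hv hw hvw hKv hKw
  have hX : P.inflSet = ⋃ K ∈ V.biUnion F, K := by
    rw [inflSet_eq]
    ext x
    constructor
    · rintro ⟨v, hv, hx⟩
      rw [(hF v hv).2.2.1] at hx
      obtain ⟨K, hK, hxK⟩ := Set.mem_iUnion₂.1 hx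
      exact Set.mem_iUnion₂.2 ⟨K, Finset.mem_biUnion.2 ⟨v, hV.2 hv, hK⟩, hxK⟩
    · intro hx
      obtain ⟨K, hK, hxK⟩ := Set.mem_iUnion₂.1 hx
      obtain ⟨v, hv, hKv⟩ := hmem K hK
      refine ⟨v, hv, ?_⟩
      rw [(hF v hv).2.2.1]
      exact Set.mem_iUnion₂.2 ⟨K, hKv, hxK⟩
  have hprop : ∀ K ∈ V.biUnion F, IsClosed K ∧ IsPreconnected K ∧ K.Nonempty := by
    intro K hK
    obtain ⟨v, hv, hKv⟩ := hmem K hK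
    exact ⟨((hF v hv).1 K hKv).1, ((hF v hv).1 K hKv).2.1, ((hF v hv).1 K hKv).2.2.1⟩
  have hcomp : P.inflComponents = (V.biUnion F : Set (Set (ℝ × ℝ))) := by
    rw [inflComponents, hX]
    exact setOf_connectedComponentIn_eq (fun K hK => (hprop K hK).1)
      (fun K hK => (hprop K hK).2.1) (fun K hK => (hprop K hK).2.2) hpd
  refine ⟨hcomp ▸ Finset.finite_toSet _, ?_⟩
  rw [hcomp, finsum_mem_coe_finset, Finset.sum_biUnion, ← sum_contributions (by omega) hN hP]
  · exact Finset.sum_congr rfl fun v hv => (hF v (hV.1 hv)).2.2.2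
  -- The families F v and F w have no common member: it would be disjoint from itself, yet nonempty.
  · intro v hv w hw hvw
    rw [Function.onFun, Finset.disjoint_left]
    intro K hK hK'
    have h := hdisj v w K K (hV.1 hv) (hV.1 hw) hvw hK hK'
    exact ((hF v (hV.1 hv)).1 K hK).2.2.1.ne_empty (disjoint_self.1 h)

end TropPoly
end TropicalInflection

theorem mainTheorem8 (d : ℕ) (hd : 2 ≤ d) (P : TropicalInflection.TropPoly)
    (hN : P.newtonPolygon = TropicalInflection.stdTriangle d) (hP : P.NonSingular) :
    P.inflComponents.Finite ∧
      ∑ᶠ K ∈ P.inflComponents, P.inflMult K = 3 * (d : ℝ) * ((d : ℝ) - 2) :=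
  P.finite_inflComponents_and_finsum_inflMult hd hN hP
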